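/- All matroids are finite. $U_{r,n}$ is the uniform matroid of rank $r$ on $n$ elements. The free extension $M+e$ of a matroid $M$ by a new element $e$ is the matroid on $E(M)\cup\{e\}$ whose independent sets are the independent sets of $M$ and the sets $I\cup\{e\}$ with $I$ independent in $M$ and not a basis of $M$. The truncation of $M$ is $T(M)=(M+e)/e$, and if $M$ has rank $n+k$ with $k\ge 0$, then $T_n(M)$ is obtained from $M$ by $k$ successive truncations. A *lattice path* from $(0,0)$ to $(m,r)$ is a sequence of $m+r$ unit steps, $r$ of them North and $m$ of them East. Let $P,Q$ be lattice paths from $(0,0)$ to $(m,r)$ such that $P$ never goes above $Q$. The *lattice path matroid* $M[P,Q]$ has ground set $\{1,\dots,m+r\}$, and its bases are the sets $\{i : \text{the } i\text{-th step of } R \text{ is North}\}$, where $R$ runs over the lattice paths from $(0,0)$ to $(m,r)$ that stay in the region bounded by $P$ and $Q$. A matroid is *lattice path* if it is isomorphic to some $M[P,Q]$. Graphs are finite and may have loops, parallel edges and *free edges* (edges with no endpoint). A *bicircular graph* is a subdivision of one of: two vertices joined by three parallel edges (a $\theta$-graph); one vertex with two loops (a tight handcuff); two vertices joined by an edge, with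 one loop at each (a loose handcuff). A matroid is *bicircular* if for some such graph $G$ its ground set is $E(G)$ and its circuits are exactly the singletons of free edges of $G$ and the subsets of $E(G)$ that induce a bicircular graph. An *excluded minor* for a class of matroids is a matroid that is not in the class but all of whose proper minors are in the class. **Lemma.** Let $M$ be a rank-$4$ lattice path matroid. Then $M$ is an excluded minor for the class of matroids that are both bicircular and lattice path if and only if $M$ is isomorphic to one of the matroids $U_{4,7}$, $T_4(U_{3,4}\oplus U_{3,3})$ and $T_4(U_{1,2}\oplus U_{4,5})$. -/

import Mathlib

namespace Matroid

/-! ### Isomorphism, uniform matroids, free extension and truncation -/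

/-- Two matroids are isomorphic if some bijection between their ground sets preserves
independence in both directions. -/
def IsIsomorphic {α β : Type*} (M : Matroid α) (N : Matroid β) : Prop :=
  ∃ e : M.E ≃ N.E, ∀ I : Set M.E,
    M.Indep (Subtype.val '' I) ↔ N.Indep (Subtype.val '' (e '' I))

/-- The uniform matroid `U_{r,n}` with ground set `Fin n`: a set is independent if and only if it
has at most `r` elements. -/
def uniform (r n : ℕ) : Matroid (Fin n) :=
  (IndepMatroid.ofFinite (E := Set.univ) Set.finite_univ (fun I => I.ncard ≤ r)
    (by simp)
    (fun I J hJ hIJ => (Set.ncard_le_ncard hIJ (Set.toFinite J)).trans hJ)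
    (fun I J hI hJ hIJ => by
      obtain ⟨e, heJ, heI⟩ := Set.exists_mem_notMem_of_ncard_lt_ncard hIJ (Set.toFinite I)
      refine ⟨e, heJ, heI, ?_⟩
      rw [Set.ncard_insert_of_notMem heI (Set.toFinite I)]
      omega)
    (fun I _ => Set.subset_univ I)).matroid

/-- If `I` has two distinct one-element independent extensions, of which one is not a base,
then neither is a base. -/
theorem not_isBase_insert_of_not_isBase_insert {α : Type*} {M : Matroid α} {I : Set α} {x y : α}
    (hx : x ∉ I) (hy : y ∉ I) (hyI : M.Indep (insert y I)) (hyB : ¬ M.IsBase (insert y I)) :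
    ¬ M.IsBase (insert x I) := by
  intro hxB
  obtain rfl | hxy := eq_or_ne x y
  · exact hyB hxB
  have := hxB.exchange_isBase_of_indep (e := x) (f := y)
  exact hyB (by
    simpa [Set.insert_sdiff_of_mem, hx] using
      this (by simp [hxy.symm, hy]) (by simpa [Set.insert_sdiff_of_mem, hx] using hyI))

/-- The independence predicate of the free extension by the new element `none`: the independent
sets of `M`, together with the sets `I ∪ {none}` where `I` is independent in `M` and is not a
base of `M`. -/
def FreeExtensionIndep {α : Type*} (M : Matroid α) (I : Set (Option α)) : Prop :=
  M.Indep (some ⁻¹' I) ∧ (none ∈ I → ¬ M.IsBase (some ⁻¹' I))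

theorem FreeExtensionIndep.subset {α : Type*} {M : Matroid α} {I J : Set (Option α)}
    (hJ : M.FreeExtensionIndep J) (hIJ : I ⊆ J) : M.FreeExtensionIndep I := by
  have hss : some ⁻¹' I ⊆ some ⁻¹' J := Set.preimage_mono hIJ
  refine ⟨hJ.1.subset hss, fun hn hB => hJ.2 (hIJ hn) ?_⟩
  rwa [← hB.eq_of_subset_indep hJ.1 hss]

theorem preimage_some_insert_some {α : Type*} (x : α) (I : Set (Option α)) :
    some ⁻¹' (insert (some x) I) = insert x (some ⁻¹' I) := by
  ext; simp

theorem preimage_some_insert_none {α : Type*} (I : Set (Option α)) :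
    some ⁻¹' (insert none I) = some ⁻¹' I := by
  ext; simp

theorem FreeExtensionIndep.maximal_of_isBase {α : Type*} {M : Matroid α} {I : Set (Option α)}
    (hn : none ∉ I) (hB : M.IsBase (some ⁻¹' I)) : Maximal M.FreeExtensionIndep I := by
  refine ⟨⟨hB.indep, fun h => absurd h hn⟩, fun J hJ hIJ => ?_⟩
  have heq := hB.eq_of_subset_indep hJ.1 (Set.preimage_mono hIJ)
  rintro (_ | a) ha
  · exact absurd (heq ▸ hB) (hJ.2 ha)
  · have : a ∈ some ⁻¹' J := ha
    rw [← heq] at this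
    exact this

theorem freeExtensionIndep_aug {α : Type*} (M : Matroid α) ⦃I B : Set (Option α)⦄
    (hI : M.FreeExtensionIndep I) (hImax : ¬ Maximal M.FreeExtensionIndep I)
    (hB : Maximal M.FreeExtensionIndep B) :
    ∃ x ∈ B \ I, M.FreeExtensionIndep (insert x I) := by
  by_cases hnI : none ∈ I
  swap
  · have hI0 : ¬ M.IsBase (some ⁻¹' I) :=
      fun h => hImax (FreeExtensionIndep.maximal_of_isBase hnI h)
    by_cases hnB : none ∈ B
    · refine ⟨none, ⟨hnB, hnI⟩, ?_⟩
      rw [FreeExtensionIndep, preimage_some_insert_none]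
      exact ⟨hI.1, fun _ => hI0⟩
    · have hB0 : M.IsBase (some ⁻¹' B) := by
        by_contra hcon
        have h : M.FreeExtensionIndep (insert none B) := by
          rw [FreeExtensionIndep, preimage_some_insert_none]
          exact ⟨hB.1.1, fun _ => hcon⟩
        exact hnB (hB.2 h (Set.subset_insert _ _) (Set.mem_insert _ _))
      obtain ⟨x, hx, hxI⟩ := hI.1.exists_insert_of_not_isBase hI0 hB0
      refine ⟨some x, hx, ?_, fun h => ?_⟩
      · rwa [preimage_some_insert_some]
      · simp [hnI] at h
  -- now `none ∈ I`, and `I` has a one-element extension by some `y`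
  have hI0 := hI.2 hnI
  obtain ⟨y, hyI, hy⟩ : ∃ y, y ∉ some ⁻¹' I ∧ M.FreeExtensionIndep (insert (some y) I) := by
    by_contra! hcon
    refine hImax ⟨hI, fun J hJ hIJ => ?_⟩
    rintro (_ | a) ha
    · exact hnI
    · by_contra haI
      exact hcon a haI (hJ.subset (Set.insert_subset ha hIJ))
  rw [FreeExtensionIndep, preimage_some_insert_some] at hy
  have hyB := hy.2 (Set.mem_insert_of_mem _ hnI)
  suffices h : ∃ x ∈ (some ⁻¹' B) \ (some ⁻¹' I), M.Indep (insert x (some ⁻¹' I)) by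
    obtain ⟨x, hx, hxI⟩ := h
    refine ⟨some x, hx, ?_⟩
    rw [FreeExtensionIndep, preimage_some_insert_some]
    exact ⟨hxI, fun _ => not_isBase_insert_of_not_isBase_insert hx.2 hyI hy.1 hyB⟩
  by_cases hB0 : M.IsBase (some ⁻¹' B)
  · exact hI.1.exists_insert_of_not_isBase hI0 hB0
  obtain ⟨B', hB'⟩ := M.exists_isBase
  obtain ⟨z, hz, hzB⟩ := hB.1.1.exists_insert_of_not_isBase hB0 hB'
  have hzbase : M.IsBase (insert z (some ⁻¹' B)) := by
    by_contra hcon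
    have h : M.FreeExtensionIndep (insert (some z) B) := by
      rw [FreeExtensionIndep, preimage_some_insert_some]
      exact ⟨hzB, fun _ => hcon⟩
    exact hz.2 (hB.2 h (Set.subset_insert _ _) (Set.mem_insert _ _))
  have key : z ∉ some ⁻¹' I → M.Indep (insert z (some ⁻¹' I)) →
      ∃ x ∈ (some ⁻¹' B) \ (some ⁻¹' I), M.Indep (insert x (some ⁻¹' I)) := by
    intro hzI hzind
    obtain ⟨x, hx, hxI⟩ := hzind.exists_insert_of_not_isBase
      (not_isBase_insert_of_not_isBase_insert hzI hyI hy.1 hyB) hzbase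
    obtain ⟨rfl | hxB, hxn⟩ := hx
    · simp at hxn
    · exact ⟨x, ⟨hxB, fun h => hxn (Set.mem_insert_of_mem _ h)⟩,
        hxI.subset (Set.insert_subset_insert (Set.subset_insert _ _))⟩
  obtain ⟨x, ⟨rfl | hxB, hxI⟩, hxind⟩ := hI.1.exists_insert_of_not_isBase hI0 hzbase
  · exact key hxI hxind
  · exact ⟨x, ⟨hxB, hxI⟩, hxind⟩

theorem freeExtensionIndep_existsMaximal {α : Type*} (M : Matroid α) (X : Set (Option α))
    (hX : X ⊆ insert none (some '' M.E)) :
    ExistsMaximalSubsetProperty M.FreeExtensionIndep X := by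
  intro I hI hIX
  have hXE : some ⁻¹' X ⊆ M.E := by
    intro a ha
    simpa using hX ha
  obtain ⟨J, hIJ, hJ⟩ := M.maximality _ hXE (some ⁻¹' I) hI.1 (Set.preimage_mono hIX)
  have hJX : some '' J ⊆ X := Set.image_subset_iff.2 hJ.prop.2
  have hpre : some ⁻¹' (some '' J) = J := Set.preimage_image_eq _ (Option.some_injective _)
  have hmax : ∀ K : Set (Option α), M.FreeExtensionIndep K → K ⊆ X → J ⊆ some ⁻¹' K →
      some ⁻¹' K ⊆ J :=
    fun K hK hKX hJK => hJ.2 ⟨hK.1, Set.preimage_mono hKX⟩ hJK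
  by_cases hbase : none ∈ X → M.IsBase J
  · by_cases hnI : none ∈ I
    · -- remove an element of `J \ I` to make room for `none`
      have hnX := hIX hnI
      have hne : ¬ J ⊆ some ⁻¹' I := fun h =>
        hI.2 hnI ((hIJ.antisymm h) ▸ hbase hnX)
      obtain ⟨z, hzJ, hzI⟩ := Set.not_subset.1 hne
      have hzJ' : insert z (J \ {z}) = J := by
        rw [Set.insert_sdiff_singleton, Set.insert_eq_of_mem hzJ]
      have hpre' : some ⁻¹' (insert none (some '' (J \ {z}))) = J \ {z} := by
        rw [preimage_some_insert_none, Set.preimage_image_eq _ (Option.some_injective _)]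
      refine ⟨insert none (some '' (J \ {z})), ?_, ⟨⟨?_, ?_⟩, ?_⟩, ?_⟩
      · rintro (_ | a) ha
        · simp
        · have haJ : a ∈ J := hIJ ha
          have : a ≠ z := by rintro rfl; exact hzI ha
          simp [haJ, this]
      · rw [hpre']
        exact hJ.prop.1.subset Set.sdiff_subset
      · rw [hpre']
        intro _ h
        have := h.eq_of_subset_indep hJ.prop.1 Set.sdiff_subset
        rw [← this] at hzJ
        simp at hzJ
      · exact Set.insert_subset hnX ((Set.image_mono Set.sdiff_subset).trans hJX)
      · rintro K ⟨hK, hKX⟩ hJK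
        have hnK : none ∈ K := hJK (Set.mem_insert _ _)
        have hJK' : J \ {z} ⊆ some ⁻¹' K := by
          have := Set.preimage_mono (f := some) hJK
          rwa [hpre'] at this
        rintro (_ | w) hw
        · simp
        · by_contra hwJ
          have hwJ' : w ∉ J \ {z} := by
            intro h
            apply hwJ
            exact Set.mem_insert_of_mem _ ⟨w, h, rfl⟩
          have hwK : insert w (J \ {z}) ⊆ some ⁻¹' K := Set.insert_subset hw hJK'
          have hwind := hK.1.subset hwK
          have hwbase : M.IsBase (insert w (J \ {z})) := by
            by_contra hcon
            have := not_isBase_insert_of_not_isBase_insert (x := z) (by simp) hwJ' hwind hcon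
            rw [hzJ'] at this
            exact this (hbase hnX)
          exact hK.2 hnK (hwbase.eq_of_subset_indep hK.1 hwK ▸ hwbase)
    · refine ⟨some '' J, ?_, ⟨⟨?_, ?_⟩, hJX⟩, ?_⟩
      · rintro (_ | a) ha
        · exact absurd ha hnI
        · exact ⟨a, hIJ ha, rfl⟩
      · rw [hpre]; exact hJ.prop.1
      · intro h; simp at h
      · rintro K ⟨hK, hKX⟩ hJK
        have hJK' : J ⊆ some ⁻¹' K := Set.image_subset_iff.1 hJK
        have hKJ := hmax K hK hKX hJK'
        rintro (_ | a) ha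
        · exact absurd ((hJK'.antisymm hKJ) ▸ hbase (hKX ha)) (hK.2 ha)
        · exact ⟨a, hKJ ha, rfl⟩
  · push Not at hbase
    obtain ⟨hnX, hJB⟩ := hbase
    refine ⟨insert none (some '' J), ?_, ⟨⟨?_, ?_⟩, Set.insert_subset hnX hJX⟩, ?_⟩
    · rintro (_ | a) ha
      · simp
      · exact Set.mem_insert_of_mem _ ⟨a, hIJ ha, rfl⟩
    · rw [preimage_some_insert_none, hpre]; exact hJ.prop.1
    · rw [preimage_some_insert_none, hpre]; exact fun _ => hJB
    · rintro K ⟨hK, hKX⟩ hJK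
      have hJK' : J ⊆ some ⁻¹' K := Set.image_subset_iff.1 ((Set.subset_insert _ _).trans hJK)
      have hKJ := hmax K hK hKX hJK'
      rintro (_ | a) ha
      · simp
      · exact Set.mem_insert_of_mem _ ⟨a, hKJ ha, rfl⟩

/-- The free extension `M + e` of a matroid `M`, where the new element `e` is `none`. -/
def freeExtension {α : Type*} (M : Matroid α) : Matroid (Option α) :=
  (IndepMatroid.mk (insert none (some '' M.E)) M.FreeExtensionIndep
    (by simp [FreeExtensionIndep])
    (fun _ _ hJ hIJ => hJ.subset hIJ)
    (M.freeExtensionIndep_aug)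
    (M.freeExtensionIndep_existsMaximal)
    (fun I hI => by
      rintro (_ | a) ha
      · simp
      · exact Set.mem_insert_of_mem _ ⟨a, hI.1.subset_ground ha, rfl⟩)).matroid

/-- The truncation `T(M) = (M + e) / e`, with its ground set identified with that of `M`. -/
def truncation {α : Type*} (M : Matroid α) : Matroid α :=
  (M.freeExtension ／ {none}).comap some

/-- The truncation `T_n(M)` of a matroid `M` of finite rank `n + k` to rank `n`: the result
of `k` successive truncations. -/
noncomputable def truncationTo {α : Type*} (n : ℕ) (M : Matroid α) : Matroid α :=
  truncation^[M.eRank.toNat - n] M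

/-! ### Excluded minors -/

/-- `M` is an excluded minor for the class of matroids described by `𝒞`: it is not in the class,
but every proper minor of `M` is. -/
def IsExcludedMinor {α : Type*} (𝒞 : Matroid α → Prop) (M : Matroid α) : Prop :=
  ¬ 𝒞 M ∧ ∀ N : Matroid α, N <m M → 𝒞 N

/-! ### Lattice path matroids -/

/-- A lattice path from `(0,0)` to `(m,r)`: a sequence of `m + r` unit steps, of which exactly
`r`, those indexed by `north`, are North steps; the others are East steps. -/
structure LatticePath (m r : ℕ) where
  north : Finset (Fin (m + r))
  card_north : north.card = r

/-- The height (second coordinate) reached by a lattice path after its first `k` steps. -/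
def LatticePath.height {m r : ℕ} (P : LatticePath m r) (k : ℕ) : ℕ :=
  (P.north.filter (fun i => i.val < k)).card

/-- The path `P` never goes above the path `Q`. After `k` steps both paths are on the antidiagonal
`x + y = k`, so that this can be read off from the heights. -/
def LatticePath.NeverAbove {m r : ℕ} (P Q : LatticePath m r) : Prop :=
  ∀ k : ℕ, P.height k ≤ Q.height k

/-- `M` is a lattice path matroid: for some lattice paths `P`, `Q` from `(0,0)` to `(m,r)` such that
`P` never goes above `Q`, the ground set of `M` can be labelled bijectively by the `m + r` steps in
such a way that the bases of `M` are exactly the sets of North steps of the lattice paths `R` from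
`(0,0)` to `(m,r)` that stay in the region bounded by `P` and `Q`. -/
def IsLatticePath {α : Type*} (M : Matroid α) : Prop :=
  ∃ (m r : ℕ) (P Q : LatticePath m r), P.NeverAbove Q ∧
    ∃ e : M.E ≃ Fin (m + r), ∀ B : Set M.E,
      M.IsBase (Subtype.val '' B) ↔
        ∃ R : LatticePath m r, P.NeverAbove R ∧ R.NeverAbove Q ∧ e '' B = (R.north : Set _)

/-! ### Bicircular matroids -/

/-- A graph with vertices in `V` and edges labelled by `ε`, in which loops, parallel edges and free
edges are allowed. The edge `e` is free (has no endpoint) if `G.ends e = none`, is a loop at `v` if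
`G.ends e = some s(v, v)`, and is a link if `G.ends e = some s(u, v)` with `u ≠ v`. -/
structure FreeGraph (V ε : Type*) where
  ends : ε → Option (Sym2 V)

/-- `G.InducesBicircular X`: the edge set `X` induces a bicircular graph in `G`, that is, a
subdivision of one of the three minimal bicircular graphs. In `subdivide`, an edge `e = uv` (possibly
a loop) of a bicircular graph with edge set `X` in `G'` is replaced by the path formed by `e = uw` and
a new edge `e' = wv` through a new vertex `w`. -/
inductive FreeGraph.InducesBicircular {V ε : Type*} : FreeGraph V ε → Set ε → Prop
  | theta {G : FreeGraph V ε} {u v : V} {a b c : ε} (huv : u ≠ v)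
      (hab : a ≠ b) (hac : a ≠ c) (hbc : b ≠ c)
      (ha : G.ends a = some s(u, v)) (hb : G.ends b = some s(u, v)) (hc : G.ends c = some s(u, v)) :
      FreeGraph.InducesBicircular G {a, b, c}
  | tightHandcuff {G : FreeGraph V ε} {v : V} {a b : ε} (hab : a ≠ b)
      (ha : G.ends a = some s(v, v)) (hb : G.ends b = some s(v, v)) :
      FreeGraph.InducesBicircular G {a, b}
  | looseHandcuff {G : FreeGraph V ε} {u v : V} {a b c : ε} (huv : u ≠ v)
      (ha : G.ends a = some s(u, u)) (hb : G.ends b = some s(v, v)) (hc : G.ends c = some s(u, v)) :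
      FreeGraph.InducesBicircular G {a, b, c}
  | subdivide {G G' : FreeGraph V ε} {X : Set ε} {e e' : ε} {u v w : V}
      (hX : FreeGraph.InducesBicircular G' X) (he : e ∈ X) (he' : e' ∉ X)
      (heuv : G'.ends e = some s(u, v))
      (hw : ∀ f ∈ X, ∀ p, G'.ends f = some p → w ∉ p)
      (huw : G.ends e = some s(u, w)) (hwv : G.ends e' = some s(w, v))
      (hrest : ∀ f ∈ X, f ≠ e → G.ends f = G'.ends f) :
      FreeGraph.InducesBicircular G (insert e' X)

/-- `M` is a bicircular matroid: it is the bicircular matroid `B(G)` of a finite graph `G` with edge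
set `M.E`, that is, its circuits are the singletons of free edges of `G` and the sets of edges that
induce a bicircular graph. -/
def IsBicircular {α : Type*} (M : Matroid α) : Prop :=
  M.E.Finite ∧ ∃ (n : ℕ) (G : FreeGraph (Fin n) M.E), ∀ C : Set M.E,
    M.IsCircuit (Subtype.val '' C) ↔
      (∃ e, G.ends e = none ∧ C = {e}) ∨ G.InducesBicircular C

end Matroid

/-!
A lattice path matroid of rank `r` is presented by `r` intervals `[l i, u i]` of labels whose left
ends and whose right ends both increase: the `i`-th North steps of the two bounding paths are the ends
of the `i`-th interval, and the independent sets are the partial transversals of the intervals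
(`IsLatticePath.exists_intervalPresentation`). A bicircular matroid is likewise a transversal matroid,
of a set system in which each element is in at most two of the sets: a set of edges of a graph is
independent if and only if its edges can be matched injectively to endpoints, because the minimal sets
for which this fails are the free edges and the bicircular graphs (`isBicircular_iff`).

So an interval presentation is bicircular if no label is in three of the intervals, and it may become
so after changes that do not affect the partial transversals (`matchable_iff_of_insert_type`). For four
intervals such changes are possible unless one of finitely many numerical conditions on the ends holds,
up to reversal of the order (`hasBicircularPresentation_or_obstruction`). Each of these conditions
provides seven labels. If the first and the last interval meet, these span `U_{4,7}`. If not, but the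
first three intervals have a common label and the last three as well, they span a rank-four matroid
with a single nonspanning circuit, which has four elements or two; these are `T_4(U_{3,4} ⊕ U_{3,3})`
and `T_4(U_{1,2} ⊕ U_{4,5})`. In the remaining cases, the contraction of one more label makes
the seven labels span `U_{3,7}` or a rank-three matroid with one or two parallel pairs. Counting the
pairs of an edge and an endpoint shows that none of these matroids on seven elements is bicircular.

Lattice path matroids are closed under minors (`IsLatticePath.of_isMinor`). An excluded minor of rank
four is therefore not bicircular, and as it has no proper minor with this property, it is one of the
three matroids of rank four above. Conversely, these three are excluded minors, because all the numerical
conditions need seven labels: lattice path matroids of rank at most four with at most six elements are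
bicircular (`IsLatticePath.isBicircular_of_ncard_le_six`).
-/

namespace Matroid

/-! ### Partial transversals -/

section Matchable

variable {α β ι : Type*}

/-- `Matchable T I`: the elements of `I` can be matched injectively to indices, each element `x` to
an index in its *type* `T x`. In other words, `I` is a partial transversal of the set system
`A i = {x | i ∈ T x}`. -/
def Matchable (T : α → Set ι) (I : Set α) : Prop :=
  ∃ f : α → ι, Set.InjOn f I ∧ ∀ x ∈ I, f x ∈ T x

theorem Matchable.subset {T : α → Set ι} {I J : Set α} (hJ : Matchable T J) (h : I ⊆ J) :
    Matchable T I := by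
  obtain ⟨f, hf, hfT⟩ := hJ
  exact ⟨f, hf.mono h, fun x hx => hfT x (h hx)⟩

theorem Matchable.mono {T T' : α → Set ι} {I : Set α} (hI : Matchable T I)
    (h : ∀ x ∈ I, T x ⊆ T' x) : Matchable T' I := by
  obtain ⟨f, hf, hfT⟩ := hI
  exact ⟨f, hf, fun x hx => h x hx (hfT x hx)⟩

theorem matchable_congr {T T' : α → Set ι} {I : Set α} (h : ∀ x ∈ I, T x = T' x) :
    Matchable T I ↔ Matchable T' I :=
  ⟨fun H => H.mono fun x hx => (h x hx).subset, fun H => H.mono fun x hx => (h x hx).superset⟩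

theorem matchable_empty [Nonempty ι] (T : α → Set ι) : Matchable T ∅ :=
  ⟨fun _ => Classical.arbitrary ι, by simp, by simp⟩

theorem matchable_comp_iff [Nonempty ι] {T : β → Set ι} {p : α → β} {I : Set α}
    (hp : Set.InjOn p I) : Matchable (fun x => T (p x)) I ↔ Matchable T (p '' I) := by
  constructor
  · rintro ⟨f, hf, hfT⟩
    obtain rfl | ⟨x₀, -⟩ := I.eq_empty_or_nonempty
    · simpa using matchable_empty T
    have : Nonempty α := ⟨x₀⟩
    have hinv : ∀ x ∈ I, Function.invFunOn p I (p x) = x := fun x hx => hp.leftInvOn_invFunOn hx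
    refine ⟨fun y => f (Function.invFunOn p I y), ?_, ?_⟩
    · rintro _ ⟨x, hx, rfl⟩ _ ⟨y, hy, rfl⟩ h
      simp only [hinv x hx, hinv y hy] at h
      rw [hf hx hy h]
    · rintro _ ⟨x, hx, rfl⟩
      simpa only [hinv x hx] using hfT x hx
  · rintro ⟨f, hf, hfT⟩
    exact ⟨f ∘ p, hf.comp hp (Set.mapsTo_image p I), fun x hx => hfT _ ⟨x, hx, rfl⟩⟩

theorem Matchable.encard_le {T : α → Set ι} {I : Set α} (hI : Matchable T I) :
    I.encard ≤ ENat.card ι := by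
  obtain ⟨f, hf, -⟩ := hI
  rw [← hf.encard_image]
  exact Set.encard_le_card

/-- Extending a matching by one element that is sent to an unused index. -/
theorem Matchable.insert_of_forall_ne {T : α → Set ι} {I : Set α} {f : α → ι} {e : α} {i : ι}
    (hf : Set.InjOn f I) (hfT : ∀ x ∈ I, f x ∈ T x) (hi : i ∈ T e) (hne : ∀ x ∈ I, f x ≠ i) :
    Matchable T (insert e I) := by
  classical
  by_cases he : e ∈ I
  · rw [Set.insert_eq_of_mem he]
    exact ⟨f, hf, hfT⟩
  refine ⟨Function.update f e i, ?_, ?_⟩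
  · have hup : ∀ x ∈ I, Function.update f e i x = f x := fun x hx =>
      Function.update_of_ne (by rintro rfl; exact he hx) _ _
    rw [Set.injOn_insert he]
    refine ⟨fun x hx y hy h => hf hx hy (by rwa [hup x hx, hup y hy] at h), ?_⟩
    rintro ⟨x, hx, h⟩
    rw [hup x hx, Function.update_self] at h
    exact hne x hx h
  · rintro x (rfl | hx)
    · simpa using hi
    · rw [Function.update_of_ne (by rintro rfl; exact he hx)]
      exact hfT x hx

/-- Extending a matching by two elements that are sent to distinct unused indices. -/
theorem Matchable.insert_insert {T : α → Set ι} {I : Set α} {f : α → ι} {e e' : α} {i j : ι}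
    (hf : Set.InjOn f I) (hfT : ∀ x ∈ I, f x ∈ T x) (he' : e' ∉ I) (hi : i ∈ T e) (hj : j ∈ T e')
    (hij : i ≠ j) (hfi : ∀ x ∈ I, f x ≠ i) (hfj : ∀ x ∈ I, f x ≠ j) :
    Matchable T (insert e (insert e' I)) := by
  classical
  have hup : ∀ x ∈ I, Function.update f e' j x = f x := fun x hx =>
    Function.update_of_ne (by rintro rfl; exact he' hx) _ _
  refine Matchable.insert_of_forall_ne (f := Function.update f e' j) ?_ ?_ hi ?_
  · rw [Set.injOn_insert he']
    refine ⟨fun x hx y hy h => hf hx hy (by rwa [hup x hx, hup y hy] at h), ?_⟩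
    rintro ⟨x, hx, h⟩
    rw [hup x hx, Function.update_self] at h
    exact hfj x hx h
  · rintro x (rfl | hx)
    · simpa using hj
    · rw [hup x hx]
      exact hfT x hx
  · rintro x (rfl | hx)
    · simpa using hij.symm
    · rw [hup x hx]
      exact hfi x hx

/-- The augmentation property of partial transversals. A matching of `I` that agrees as much as
possible with a matching of the larger set `J` leaves unused the index of some element of `J \ I`:
an element of `I ∩ J` whose index under `J` is unused by `I` could be moved to that index. -/
theorem Matchable.exists_insert {T : α → Set ι} {I J : Set α} (hI : Matchable T I)
    (hJ : Matchable T J) (hIfin : I.Finite) (hIJ : I.encard < J.encard) :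
    ∃ x ∈ J \ I, Matchable T (insert x I) := by
  classical
  obtain ⟨g, hg, hgT⟩ := hJ
  obtain ⟨f, hf, hfT⟩ := hI
  induction hn : (I ∩ {x | x ∈ J ∧ f x ≠ g x}).ncard using Nat.strong_induction_on
    generalizing f with
  | _ n ih =>
  obtain ⟨_, ⟨x, hxJ, rfl⟩, hx⟩ : ∃ i ∈ g '' J, i ∉ f '' I := by
    by_contra! h
    refine hIJ.not_ge ?_
    rw [← hg.encard_image, ← hf.encard_image]
    exact Set.encard_le_encard h
  have hx' : ∀ y ∈ I, f y ≠ g x := fun y hy h => hx ⟨y, hy, h⟩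
  by_cases hxI : x ∈ I
  · refine ih _ ?_ (Function.update f x (g x)) ?_ ?_ rfl
    · rw [← hn]
      refine Set.ncard_lt_ncard ?_ (hIfin.subset Set.inter_subset_left)
      refine ⟨?_, fun h => ?_⟩
      · rintro y ⟨hyI, hyJ, hy⟩
        have hyx : y ≠ x := by rintro rfl; simp at hy
        rw [Function.update_of_ne hyx] at hy
        exact ⟨hyI, hyJ, hy⟩
      · simpa using (h ⟨hxI, hxJ, hx' x hxI⟩).2.2
    · intro y hy z hz h
      by_cases hyx : y = x <;> by_cases hzx : z = x
      · rw [hyx, hzx]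
      · subst hyx
        rw [Function.update_self, Function.update_of_ne hzx] at h
        exact absurd h.symm (hx' z hz)
      · subst hzx
        rw [Function.update_self, Function.update_of_ne hyx] at h
        exact absurd h (hx' y hy)
      · rw [Function.update_of_ne hyx, Function.update_of_ne hzx] at h
        exact hf hy hz h
    · intro y hy
      by_cases hyx : y = x
      · subst hyx
        simpa using hgT y hxJ
      · rw [Function.update_of_ne hyx]
        exact hfT y hy
  · exact ⟨x, ⟨hxJ, hxI⟩, Matchable.insert_of_forall_ne hf hfT (hgT x hxJ) hx'⟩

/-- A partial transversal extends to one of the size of any given larger partial transversal. -/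
theorem Matchable.exists_superset {T : α → Set ι} {I J E : Set α} (hI : Matchable T I)
    (hJ : Matchable T J) (hE : E.Finite) (hIE : I ⊆ E) (hJE : J ⊆ E) (hIJ : I.ncard ≤ J.ncard) :
    ∃ B, I ⊆ B ∧ B ⊆ E ∧ B.ncard = J.ncard ∧ Matchable T B := by
  induction hn : J.ncard - I.ncard generalizing I with
  | zero => exact ⟨I, subset_rfl, hIE, by omega, hI⟩
  | succ n ih =>
    have hIfin := hE.subset hIE
    have hJfin := hE.subset hJE
    have hlt : I.encard < J.encard := by
      rw [← hIfin.cast_ncard_eq, ← hJfin.cast_ncard_eq]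
      exact_mod_cast (by omega : I.ncard < J.ncard)
    obtain ⟨x, ⟨hxJ, hxI⟩, hx⟩ := hI.exists_insert hJ hIfin hlt
    have hcard := Set.ncard_insert_of_notMem hxI hIfin
    obtain ⟨B, hB, h⟩ := ih hx (Set.insert_subset (hJE hxJ) hIE) (by omega) (by omega)
    exact ⟨B, (Set.subset_insert _ _).trans hB, h⟩

/-- Adding `i` to the type of `x` does not change the partial transversals if there is a set `J ⊆ T x`
of indices such that, whenever distinct elements other than `x` occupy all indices in `J`, one of
these elements has `i` in its type: if `x` is matched to `i`, then either some index in `J` is free for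
`x`, or `x` can exchange indices with such an element. -/
theorem matchable_iff_of_insert_type {T T' : α → Set ι} {x : α} {i : ι} (J : Set ι)
    (hJx : J ⊆ T x) (hx : T' x = insert i (T x)) (hne : ∀ y ≠ x, T' y = T y)
    (hocc : ∀ g : ι → α, Set.InjOn g J → (∀ j ∈ J, g j ≠ x ∧ j ∈ T (g j)) →
      ∃ j ∈ J, i ∈ T (g j)) (I : Set α) :
    Matchable T I ↔ Matchable T' I := by
  classical
  refine ⟨fun h => h.mono fun y _ => ?_, ?_⟩
  · by_cases hy : y = x
    · rw [hy, hx]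
      exact Set.subset_insert _ _
    · rw [hne y hy]
  rintro ⟨f, hf, hfT⟩
  by_cases hxI : x ∈ I ∧ f x ∉ T x
  swap
  · refine ⟨f, hf, fun y hy => ?_⟩
    by_cases hyx : y = x
    · subst hyx
      by_contra h
      exact hxI ⟨hy, h⟩
    · rw [← hne y hyx]
      exact hfT y hy
  obtain ⟨hxI, hfx⟩ := hxI
  have hfxi : f x = i := by
    have := hfT x hxI
    rw [hx] at this
    exact this.resolve_right hfx
  have hfne : ∀ y ∈ I, y ≠ x → f y ∈ T y := fun y hy hyx => hne y hyx ▸ hfT y hy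
  have hiJ : ∀ j ∈ J, j ≠ i := by
    rintro j hj rfl
    exact hfx (hfxi ▸ hJx hj)
  have : Nonempty α := ⟨x⟩
  by_cases hfull : ∀ j ∈ J, ∃ y ∈ I, f y = j
  · choose! g hgI hgf using hfull
    have hgx : ∀ j ∈ J, g j ≠ x := fun j hj h =>
      hiJ j hj (by rw [← hgf j hj, h, hfxi])
    obtain ⟨j, hj, hij⟩ := hocc g
      (fun a ha b hb h => by rw [← hgf a ha, ← hgf b hb, h])
      (fun j hj => ⟨hgx j hj, by simpa only [hgf j hj] using hfne _ (hgI j hj) (hgx j hj)⟩)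
    refine ⟨f ∘ Equiv.swap x (g j), ?_, ?_⟩
    · refine hf.comp (Equiv.injective _).injOn fun y hy => ?_
      by_cases hyx : y = x
      · subst hyx
        simpa using hgI j hj
      by_cases hyg : y = g j
      · subst hyg
        simpa using hxI
      · rwa [Equiv.swap_apply_of_ne_of_ne hyx hyg]
    · intro y hy
      by_cases hyx : y = x
      · subst hyx
        simpa [hgf j hj] using hJx hj
      by_cases hyg : y = g j
      · subst hyg
        simpa [hfxi] using hij
      · simpa [Equiv.swap_apply_of_ne_of_ne hyx hyg] using hfne y hy hyx
  · push Not at hfull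
    obtain ⟨j, hj, hjf⟩ := hfull
    have h := Matchable.insert_of_forall_ne (T := T) (I := I \ {x}) (e := x) (i := j)
      (hf.mono Set.sdiff_subset) (fun y hy => hfne y hy.1 hy.2) (hJx hj)
      (fun y hy => hjf y hy.1)
    rwa [Set.insert_sdiff_singleton, Set.insert_eq_of_mem hxI] at h

theorem Matchable.card_le {T : α → Set ι} {I : Finset α}
    (hI : Matchable T (I : Set α)) {W : Finset ι} (hW : ∀ x ∈ I, T x ⊆ W) : I.card ≤ W.card := by
  classical
  obtain ⟨f, hf, hfT⟩ := hI
  rw [← Finset.card_image_of_injOn hf]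
  refine Finset.card_le_card fun i hi => ?_
  obtain ⟨x, hx, rfl⟩ := Finset.mem_image.1 hi
  exact hW x hx (hfT x hx)

/-- Hall's theorem. -/
theorem exists_card_lt_of_not_matchable [Fintype ι] [Nonempty ι]
    {T : α → Set ι} {X : Finset α} (hX : ¬ Matchable T (X : Set α)) :
    ∃ Y ⊆ X, ∃ W : Finset ι, (∀ x ∈ Y, T x ⊆ W) ∧ (∀ i ∈ W, ∃ x ∈ Y, i ∈ T x) ∧
      W.card < Y.card := by
  classical
  have h := (Finset.all_card_le_biUnion_card_iff_exists_injective
    (fun x : X => (T x).toFinset)).not.2 (by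
      rintro ⟨f, hf, hfT⟩
      refine hX ⟨fun x => if hx : x ∈ X then f ⟨x, hx⟩ else Classical.arbitrary ι, ?_, ?_⟩
      · intro x hx y hy hxy
        simp only [Finset.mem_coe] at hx hy
        simp only [hx, hy, dite_true] at hxy
        simpa using hf hxy
      · intro x hx
        simp only [Finset.mem_coe] at hx
        simpa [hx] using hfT ⟨x, hx⟩)
  push Not at h
  obtain ⟨Y, hY⟩ := h
  refine ⟨Y.map (Function.Embedding.subtype _), ?_, Y.biUnion fun x => (T x).toFinset, ?_, ?_,
    by rwa [Finset.card_map]⟩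
  · intro x hx
    obtain ⟨y, -, rfl⟩ := Finset.mem_map.1 hx
    exact y.2
  · intro x hx i hi
    obtain ⟨y, hy, rfl⟩ := Finset.mem_map.1 hx
    simp only [Finset.coe_biUnion, Set.mem_iUnion, Finset.mem_coe]
    exact ⟨y, hy, by simpa using hi⟩
  · intro i hi
    obtain ⟨y, hy, h⟩ := Finset.mem_biUnion.1 hi
    exact ⟨y, Finset.mem_map_of_mem _ hy, by simpa using h⟩

theorem matchable_range {κ : Type*} [Nonempty ι] {T : α → Set ι} (b : κ → α) {c : κ → ι}
    (hc : Function.Injective c) (h : ∀ k, c k ∈ T (b k)) : Matchable T (Set.range b) := by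
  classical
  by_cases hκ : Nonempty κ
  · have hex : ∀ x ∈ Set.range b, ∃ k, b k = x := fun x hx => hx
    choose! g hg using hex
    refine ⟨fun x => c (g x), fun x hx y hy hxy => ?_, fun x hx => ?_⟩
    · rw [← hg x hx, ← hg y hy, hc hxy]
    · have := h (g x)
      rwa [hg x hx] at this
  · rw [not_nonempty_iff] at hκ
    rw [Set.range_eq_empty]
    exact matchable_empty T

end Matchable

/-! ### Bicircular graphs and matchings of edges to endpoints -/

namespace FreeGraph

variable {V ε : Type*}

/-- The set of endpoints of an edge; it is empty for a free edge. -/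
def inc (G : FreeGraph V ε) (e : ε) : Set V := {v | ∃ p, G.ends e = some p ∧ v ∈ p}

theorem inc_of_ends {G : FreeGraph V ε} {e : ε} {u v : V} (h : G.ends e = some s(u, v)) :
    G.inc e = {u, v} := by
  ext w
  simp [inc, h]

theorem inc_of_ends_none {G : FreeGraph V ε} {e : ε} (h : G.ends e = none) : G.inc e = ∅ := by
  ext w
  simp [inc, h]

theorem inc_congr {G G' : FreeGraph V ε} {e : ε} (h : G.ends e = G'.ends e) :
    G.inc e = G'.inc e := by
  simp only [inc, h]

/-- A set of edges is minimally unmatchable: its edges cannot be matched injectively to endpoints,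
but this becomes possible when any one of them is removed. -/
def IsMinUnmatchable (G : FreeGraph V ε) (X : Set ε) : Prop :=
  ¬ Matchable G.inc X ∧ ∀ g ∈ X, Matchable G.inc (X \ {g})

theorem matchable_pair {G : FreeGraph V ε} {a b : ε} {u v : V} (hu : u ∈ G.inc a)
    (hv : v ∈ G.inc b) (huv : u ≠ v) : Matchable G.inc {a, b} :=
  Matchable.insert_of_forall_ne (f := fun _ => v) (i := u) (by simp) (by simpa using hv) hu
    (by simpa using huv.symm)

theorem isMinUnmatchable_triple {G : FreeGraph V ε} {a b c : ε} {u v : V} (hab : a ≠ b)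
    (hac : a ≠ c) (hbc : b ≠ c) (ha : G.inc a ⊆ {u, v}) (hb : G.inc b ⊆ {u, v})
    (hc : G.inc c ⊆ {u, v}) (h1 : Matchable G.inc {a, b}) (h2 : Matchable G.inc {a, c})
    (h3 : Matchable G.inc {b, c}) : G.IsMinUnmatchable {a, b, c} := by
  constructor
  · rintro ⟨f, hf, hfT⟩
    have hab' : f a ≠ f b := fun h => hab (hf (by simp) (by simp) h)
    have hac' : f a ≠ f c := fun h => hac (hf (by simp) (by simp) h)
    have hbc' : f b ≠ f c := fun h => hbc (hf (by simp) (by simp) h)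
    have ha' := ha (hfT a (by simp))
    have hb' := hb (hfT b (by simp))
    have hc' := hc (hfT c (by simp))
    simp only [Set.mem_insert_iff, Set.mem_singleton_iff] at ha' hb' hc'
    grind
  · rintro g (rfl | rfl | rfl)
    · exact h3.subset (by intro x; simp; tauto)
    · exact h2.subset (by intro x; simp; tauto)
    · exact h1.subset (by intro x; simp; tauto)

/-- Subdividing an edge preserves minimal unmatchability: the new vertex has to be matched to one
of its two edges, and the other one plays the role of the subdivided edge. -/
theorem IsMinUnmatchable.subdivide {G G' : FreeGraph V ε} {X : Set ε} {e e' : ε} {u v w : V}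
    (hX : G'.IsMinUnmatchable X) (he : e ∈ X) (he' : e' ∉ X)
    (heuv : G'.ends e = some s(u, v)) (hw : ∀ f ∈ X, w ∉ G'.inc f)
    (huw : G.ends e = some s(u, w)) (hwv : G.ends e' = some s(w, v))
    (hrest : ∀ f ∈ X, f ≠ e → G.ends f = G'.ends f) : G.IsMinUnmatchable (insert e' X) := by
  classical
  have hee' : e' ≠ e := by rintro rfl; exact he' he
  have hinc : ∀ x ∈ X, x ≠ e → G.inc x = G'.inc x := fun x hx hxe => inc_congr (hrest x hx hxe)
  have hwu : w ≠ u ∧ w ≠ v := by simpa [inc_of_ends heuv] using hw e he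
  have hdel : Matchable G.inc (X \ {e}) :=
    (hX.2 e he).mono fun x hx => (hinc x hx.1 hx.2).superset
  have hdel_w : ∀ d, w ∈ G.inc d → Matchable G.inc (insert d (X \ {e})) := by
    intro d hd
    obtain ⟨f, hf, hfT⟩ := hX.2 e he
    refine Matchable.insert_of_forall_ne hf (fun x hx => hinc x hx.1 hx.2 ▸ hfT x hx) hd ?_
    rintro x hx rfl
    exact hw x hx.1 (hfT x hx)
  constructor
  · rintro ⟨f, hf, hfT⟩
    have hfe : f e ∈ ({u, w} : Set V) := inc_of_ends huw ▸ hfT e (Set.mem_insert_of_mem _ he)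
    have hfe' : f e' ∈ ({w, v} : Set V) := inc_of_ends hwv ▸ hfT e' (Set.mem_insert _ _)
    have hne : f e' ≠ f e := fun h =>
      hee' (hf (Set.mem_insert _ _) (Set.mem_insert_of_mem _ he) h)
    have hfX : ∀ x ∈ X \ {e}, f x ∈ G'.inc x := fun x hx =>
      hinc x hx.1 hx.2 ▸ hfT x (Set.mem_insert_of_mem _ hx.1)
    have hXe : insert e (X \ {e}) = X := by
      rw [Set.insert_sdiff_singleton, Set.insert_eq_of_mem he]
    have hinj : Set.InjOn f (X \ {e}) :=
      hf.mono (Set.sdiff_subset.trans (Set.subset_insert _ _))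
    refine hX.1 (hXe ▸ ?_)
    rcases hfe with hfe | hfe
    · refine Matchable.insert_of_forall_ne hinj hfX (i := u) (by simp [inc_of_ends heuv]) ?_
      rintro x hx h
      exact hx.2 (hf (Set.mem_insert_of_mem _ hx.1) (Set.mem_insert_of_mem _ he) (h.trans hfe.symm))
    · have hfe'v : f e' = v := by
        rcases hfe' with h | h
        · exact absurd (h.trans hfe.symm) hne
        · exact h
      refine Matchable.insert_of_forall_ne hinj hfX (i := v) (by simp [inc_of_ends heuv]) ?_
      rintro x hx h
      have := hf (Set.mem_insert_of_mem _ hx.1) (Set.mem_insert _ _) (h.trans hfe'v.symm)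
      exact he' (this ▸ hx.1)
  · rintro g (rfl | hg)
    · have h := hdel_w e (by simp [inc_of_ends huw])
      refine h.subset ?_
      intro x hx
      by_cases hxe : x = e
      · exact Or.inl hxe
      · exact Or.inr ⟨hx.1.resolve_left hx.2, hxe⟩
    by_cases hge : g = e
    · subst hge
      refine (hdel_w e' (by simp [inc_of_ends hwv])).subset ?_
      rintro x ⟨rfl | hx, hxg⟩
      · exact Or.inl rfl
      · exact Or.inr ⟨hx, hxg⟩
    obtain ⟨f, hf, hfT⟩ := hX.2 g hg
    have heg : e ∈ X \ {g} := ⟨he, fun h => hge h.symm⟩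
    have hfe : f e ∈ ({u, v} : Set V) := inc_of_ends heuv ▸ hfT e heg
    have hfw : ∀ x ∈ X \ {g}, f x ≠ w := by
      rintro x hx rfl
      exact hw x hx.1 (hfT x hx)
    have hset : insert e' X \ {g} ⊆ insert e' (insert e ((X \ {g}) \ {e})) := by
      rintro x ⟨rfl | hx, hxg⟩
      · exact Or.inl rfl
      · by_cases hxe : x = e
        · exact Or.inr (Or.inl hxe)
        · exact Or.inr (Or.inr ⟨⟨hx, hxg⟩, hxe⟩)
    have hfX : ∀ x ∈ (X \ {g}) \ {e}, f x ∈ G.inc x := fun x hx =>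
      hinc x hx.1.1 hx.2 ▸ hfT x hx.1
    have hfne : ∀ x ∈ (X \ {g}) \ {e}, f x ≠ f e := fun x hx h => hx.2 (hf hx.1 heg h)
    have hinj : Set.InjOn f ((X \ {g}) \ {e}) := hf.mono Set.sdiff_subset
    -- in both cases `w` is given to the one of `e`, `e'` that does not take over `f e`
    rcases hfe with hfe | hfe
    · have h1 : Set.InjOn f (insert e ((X \ {g}) \ {e})) := by
        rw [Set.insert_sdiff_singleton, Set.insert_eq_of_mem heg]
        exact hf
      refine (Matchable.insert_of_forall_ne h1 ?_ (e := e') (i := w) (by simp [inc_of_ends hwv])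
        ?_).subset hset
      · rintro x (rfl | hx)
        · rw [inc_of_ends huw, hfe]
          simp
        · exact hfX x hx
      · rintro x (rfl | hx)
        · exact hfw x heg
        · exact hfw x hx.1
    · rw [Set.insert_comm] at hset
      exact (Matchable.insert_insert hinj hfX (fun h => he' h.1.1) (by simp [inc_of_ends huw])
        (by simp [inc_of_ends hwv]) hwu.2 (fun x hx => hfw x hx.1)
        (fun x hx h => hfne x hx (h.trans hfe.symm))).subset hset

theorem InducesBicircular.isMinUnmatchable {G : FreeGraph V ε} {X : Set ε}
    (h : G.InducesBicircular X) : G.IsMinUnmatchable X := by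
  induction h with
  | @theta G u v a b c huv hab hac hbc ha hb hc =>
    refine isMinUnmatchable_triple (u := u) (v := v) hab hac hbc (inc_of_ends ha).subset
      (inc_of_ends hb).subset (inc_of_ends hc).subset ?_ ?_ ?_ <;>
    refine matchable_pair (u := u) (v := v) ?_ ?_ huv <;>
    simp [inc_of_ends ha, inc_of_ends hb, inc_of_ends hc]
  | @tightHandcuff G v a b hab ha hb =>
    constructor
    · rintro ⟨f, hf, hfT⟩
      have h1 := hfT a (by simp)
      have h2 := hfT b (by simp)
      rw [inc_of_ends ha] at h1
      rw [inc_of_ends hb] at h2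
      simp only [Set.mem_insert_iff, Set.mem_singleton_iff, or_self] at h1 h2
      exact hab (hf (by simp) (by simp) (h1.trans h2.symm))
    · have hv : ∀ z : ε, G.ends z = some s(v, v) → Matchable G.inc {z} := fun z hz =>
        ⟨fun _ => v, by simp, by simp [inc_of_ends hz]⟩
      rintro g (rfl | rfl)
      · exact (hv b hb).subset (by intro x; simp; tauto)
      · exact (hv a ha).subset (by intro x; simp; tauto)
  | @looseHandcuff G u v a b c huv ha hb hc =>
    have hab : a ≠ b := by
      rintro rfl
      rw [ha] at hb
      simp [huv] at hb
    have hac : a ≠ c := by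
      rintro rfl
      rw [ha] at hc
      simp [huv] at hc
    have hbc : b ≠ c := by
      rintro rfl
      rw [hb] at hc
      simp [huv.symm] at hc
    refine isMinUnmatchable_triple (u := u) (v := v) hab hac hbc ?_ ?_ ?_
      (matchable_pair (u := u) (v := v) ?_ ?_ huv) (matchable_pair (u := u) (v := v) ?_ ?_ huv)
      (matchable_pair (u := v) (v := u) ?_ ?_ huv.symm) <;>
      simp [inc_of_ends ha, inc_of_ends hb, inc_of_ends hc]
  | @subdivide G G' X e e' u v w hX he he' heuv hw huw hwv hrest ih =>
    exact ih.subdivide he he' heuv (fun f hf ⟨p, hp, hwp⟩ => hw f hf p hp hwp) huw hwv hrest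

/-- The number of ends of the edge `e` at the vertex `v`: a loop has two ends at its vertex. -/
noncomputable def endsAt (G : FreeGraph V ε) (v : V) (e : ε) : ℕ :=
  open Classical in (if v ∈ G.inc e then 1 else 0) + (if G.ends e = some s(v, v) then 1 else 0)

theorem sum_endsAt_le (G : FreeGraph V ε) (W : Finset V) (e : ε) :
    ∑ v ∈ W, G.endsAt v e ≤ 2 := by
  classical
  cases h : G.ends e with
  | none => simp [endsAt, inc_of_ends_none h, h]
  | some p =>
    induction p using Sym2.inductionOn with
    | _ a b =>
      have : ∀ v ∈ W, G.endsAt v e ≤ (if a = v then 1 else 0) + (if b = v then 1 else 0) := by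
        intro v _
        rw [endsAt, inc_of_ends h, h]
        simp only [Set.mem_insert_iff, Set.mem_singleton_iff, Option.some.injEq, Sym2.eq_iff]
        grind
      refine (Finset.sum_le_sum this).trans ?_
      rw [Finset.sum_add_distrib, Finset.sum_ite_eq, Finset.sum_ite_eq]
      split_ifs <;> simp

theorem exists_ends_of_mem_inc {G : FreeGraph V ε} {e : ε} {w : V} (h : w ∈ G.inc e) :
    ∃ u, G.ends e = some s(u, w) := by
  obtain ⟨p, hp, hw⟩ := h
  obtain ⟨u, rfl⟩ := Sym2.mem_iff_exists.1 hw
  exact ⟨u, by rw [hp, Sym2.eq_swap]⟩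

section

variable {G : FreeGraph V ε} {X : Finset ε}

/-- A minimally unmatchable edge set `X` meets exactly `|X| - 1` vertices, each of which is an
endpoint of at least two edges of `X`. -/
theorem IsMinUnmatchable.exists_vertices [Fintype V] [Nonempty V]
    (hX : G.IsMinUnmatchable (X : Set ε)) :
    ∃ W : Finset V, (∀ e ∈ X, G.inc e ⊆ W) ∧ W.card + 1 = X.card ∧
      ∀ v ∈ W, ∃ e ∈ X, ∃ e' ∈ X, e ≠ e' ∧ v ∈ G.inc e ∧ v ∈ G.inc e' := by
  classical
  obtain ⟨Y, hYX, W, hW, hWY, hlt⟩ := exists_card_lt_of_not_matchable hX.1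
  have hmat : ∀ g ∈ X, Matchable G.inc ((X.erase g : Finset ε) : Set ε) := fun g hg => by
    rw [Finset.coe_erase]
    exact hX.2 g hg
  obtain rfl : Y = X := by
    by_contra hne
    obtain ⟨g, hg, hgY⟩ := Finset.exists_of_ssubset (hYX.ssubset_of_ne hne)
    have hsub : Y ⊆ X.erase g := fun y hy =>
      Finset.mem_erase.2 ⟨by rintro rfl; exact hgY hy, hYX hy⟩
    exact (((hmat g hg).subset (Finset.coe_subset.2 hsub)).card_le hW).not_gt hlt
  obtain ⟨g, hg⟩ : Y.Nonempty := Finset.card_pos.1 (by omega)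
  have hcard := (hmat g hg).card_le (W := W) fun x hx => hW x (Finset.mem_of_mem_erase hx)
  rw [Finset.card_erase_of_mem hg] at hcard
  refine ⟨W, hW, by omega, fun v hv => ?_⟩
  obtain ⟨e, he, hve⟩ := hWY v hv
  by_contra! hcon
  have h := (hmat e he).card_le (W := W.erase v) (by
    intro x hx i hi
    rw [Finset.mem_erase] at hx
    rw [Finset.coe_erase]
    refine ⟨hW x hx.2 hi, ?_⟩
    rintro rfl
    exact hcon e he x hx.2 hx.1.symm hve hi)
  rw [Finset.card_erase_of_mem he, Finset.card_erase_of_mem hv] at h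
  have := Finset.card_pos.2 ⟨v, hv⟩
  omega

/-- A minimally unmatchable edge set with at most two vertices, both of degree at least three, is one
of the three smallest bicircular graphs. -/
theorem IsMinUnmatchable.inducesBicircular_of_card_le (hX : G.IsMinUnmatchable (X : Set ε))
    {W : Finset V} (hW : ∀ e ∈ X, G.inc e ⊆ W) (hcard : W.card + 1 = X.card) (hW2 : W.card ≤ 2)
    (hfree : ∀ e ∈ X, G.ends e ≠ none) (hdeg : ∀ v ∈ W, 3 ≤ ∑ e ∈ X, G.endsAt v e) :
    G.InducesBicircular X := by
  classical
  have hends : ∀ e ∈ X, ∃ a ∈ W, ∃ b ∈ W, G.ends e = some s(a, b) := by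
    intro e he
    obtain ⟨p, hp⟩ := Option.ne_none_iff_exists'.1 (hfree e he)
    induction p using Sym2.inductionOn with
    | _ a b =>
      have := hW e he
      rw [inc_of_ends hp] at this
      exact ⟨a, this (by simp), b, this (by simp), hp⟩
  obtain h0 | h1 | h2 : W.card = 0 ∨ W.card = 1 ∨ W.card = 2 := by omega
  · obtain ⟨e, he⟩ := Finset.card_pos.1 (by omega : 0 < X.card)
    obtain ⟨a, ha, -⟩ := hends e he
    rw [Finset.card_eq_zero.1 h0] at ha
    simp at ha
  · obtain ⟨v, rfl⟩ := Finset.card_eq_one.1 h1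
    obtain ⟨a, b, hab, rfl⟩ := Finset.card_eq_two.1 (by omega : X.card = 2)
    have hv : ∀ e ∈ ({a, b} : Finset ε), G.ends e = some s(v, v) := by
      intro e he
      obtain ⟨x, hx, y, hy, h⟩ := hends e he
      rw [Finset.mem_singleton] at hx hy
      rw [h, hx, hy]
    rw [Finset.coe_pair]
    exact .tightHandcuff hab (hv a (by simp)) (hv b (by simp))
  · obtain ⟨u, v, huv, rfl⟩ := Finset.card_eq_two.1 h2
    obtain ⟨a, b, c, hab, hac, hbc, rfl⟩ := Finset.card_eq_three.1 (by omega : X.card = 3)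
    have hsum : ∀ f : ε → ℕ, ∑ e ∈ ({a, b, c} : Finset ε), f e = f a + f b + f c := fun f => by
      rw [Finset.sum_insert (by simp [hab, hac]), Finset.sum_pair hbc, add_assoc]
    have hdu := hdeg u (by simp)
    have hdv := hdeg v (by simp)
    rw [hsum] at hdu hdv
    have hends' : ∀ e ∈ ({a, b, c} : Finset ε),
        (G.ends e = some s(u, u) ∧ G.endsAt u e = 2 ∧ G.endsAt v e = 0) ∨
        (G.ends e = some s(v, v) ∧ G.endsAt u e = 0 ∧ G.endsAt v e = 2) ∨
        (G.ends e = some s(u, v) ∧ G.endsAt u e = 1 ∧ G.endsAt v e = 1) := by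
      intro e he
      obtain ⟨x, hx, y, hy, h⟩ := hends e he
      simp only [Finset.mem_insert, Finset.mem_singleton] at hx hy
      rcases hx with rfl | rfl <;> rcases hy with rfl | rfl <;>
        simp [endsAt, inc_of_ends h, h, huv, huv.symm]
    -- as loops count twice, degree three leaves three links, or one link and a loop at each vertex
    rw [Finset.coe_insert, Finset.coe_pair]
    have h1 : ∀ {x y z : ε}, G.ends x = some s(u, u) → G.ends y = some s(v, v) →
        G.ends z = some s(u, v) → G.InducesBicircular {x, y, z} := fun hx hy hz =>
      .looseHandcuff huv hx hy hz
    rcases hends' a (by simp) with ⟨ha, ha1, ha2⟩ | ⟨ha, ha1, ha2⟩ | ⟨ha, ha1, ha2⟩ <;>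
    rcases hends' b (by simp) with ⟨hb, hb1, hb2⟩ | ⟨hb, hb1, hb2⟩ | ⟨hb, hb1, hb2⟩ <;>
    rcases hends' c (by simp) with ⟨hc, hc1, hc2⟩ | ⟨hc, hc1, hc2⟩ | ⟨hc, hc1, hc2⟩
    all_goals first
      | omega
      | exact .theta huv hab hac hbc ha hb hc
      | exact h1 ha hb hc
      | exact Set.pair_comm b c ▸ h1 ha hc hb
      | exact Set.insert_comm a b _ ▸ h1 hb ha hc
      | (rw [show ({a, b, c} : Set ε) = {b, c, a} by ext; simp; tauto]; exact h1 hb hc ha)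
      | (rw [show ({a, b, c} : Set ε) = {c, a, b} by ext; simp; tauto]; exact h1 hc ha hb)
      | (rw [show ({a, b, c} : Set ε) = {c, b, a} by ext; simp; tauto]; exact h1 hc hb ha)

/-- Suppressing a vertex that is an endpoint of just two edges `e = uw` and `e' = vw` preserves
minimal unmatchability. -/
theorem IsMinUnmatchable.suppress {G G' : FreeGraph V ε} {X : Set ε} {e e' : ε} {u v w : V}
    (hX : G.IsMinUnmatchable (insert e' X)) (he : e ∈ X) (he' : e' ∉ X)
    (heuv : G'.ends e = some s(u, v)) (hw : ∀ f ∈ X, w ∉ G'.inc f)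
    (huw : G.ends e = some s(u, w)) (hwv : G.ends e' = some s(w, v))
    (hrest : ∀ f ∈ X, f ≠ e → G.ends f = G'.ends f) : G'.IsMinUnmatchable X := by
  have hinc : ∀ x ∈ X, x ≠ e → G.inc x = G'.inc x := fun x hx hxe => inc_congr (hrest x hx hxe)
  have hee' : e ≠ e' := by rintro rfl; exact he' he
  have hwu : w ≠ u ∧ w ≠ v := by simpa [inc_of_ends heuv] using hw e he
  have hadd : ∀ {Y : Set ε}, e ∈ Y → insert e (Y \ {e}) = Y := fun hY => by
    rw [Set.insert_sdiff_singleton, Set.insert_eq_of_mem hY]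
  constructor
  · rintro ⟨f, hf, hfT⟩
    have hfw : ∀ x ∈ X, f x ≠ w := by
      rintro x hx rfl
      exact hw x hx (hfT x hx)
    have hfX : ∀ x ∈ X \ {e}, f x ∈ G.inc x := fun x hx => hinc x hx.1 hx.2 ▸ hfT x hx.1
    have hfe : f e ∈ ({u, v} : Set V) := inc_of_ends heuv ▸ hfT e he
    rcases hfe with hfe | hfe
    · refine hX.1 (Matchable.insert_of_forall_ne hf (fun x hx => ?_) (i := w)
        (by simp [inc_of_ends hwv]) hfw)
      by_cases hxe : x = e
      · rw [hxe, hfe, inc_of_ends huw]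
        simp
      · exact hfX x ⟨hx, hxe⟩
    · have h := Matchable.insert_insert (hf.mono Set.sdiff_subset) hfX (e := e) (i := w)
        (fun h => he' h.1) (by simp [inc_of_ends huw]) (by simp [inc_of_ends hwv]) hwu.2
        (fun x hx => hfw x hx.1) (fun x hx h => hx.2 (hf hx.1 he (h.trans hfe.symm)))
      rw [Set.insert_comm, hadd he] at h
      exact hX.1 h
  · intro g hg
    obtain rfl | hge := eq_or_ne g e
    · exact ((hX.2 g (Set.mem_insert_of_mem _ hg)).subset
        (Set.sdiff_subset_sdiff_left (Set.subset_insert _ _))).mono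
        fun x hx => (hinc x hx.1 hx.2).subset
    obtain ⟨f, hf, hfT⟩ := hX.2 g (Set.mem_insert_of_mem _ hg)
    have hsub : X \ {g} ⊆ insert e' X \ {g} := Set.sdiff_subset_sdiff_left (Set.subset_insert _ _)
    have heg : e ∈ X \ {g} := ⟨he, hge.symm⟩
    have heg' : e' ∈ insert e' X \ {g} :=
      ⟨Set.mem_insert _ _, by rintro rfl; exact he' hg⟩
    have hfX : ∀ x ∈ (X \ {g}) \ {e}, f x ∈ G'.inc x := fun x hx =>
      hinc x hx.1.1 hx.2 ▸ hfT x (hsub hx.1)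
    have hfe : f e ∈ ({u, w} : Set V) := inc_of_ends huw ▸ hfT e (hsub heg)
    have hfe' : f e' ∈ ({w, v} : Set V) := inc_of_ends hwv ▸ hfT e' heg'
    have hne : f e ≠ f e' := fun h => hee' (hf (hsub heg) heg' h)
    have hinj : Set.InjOn f ((X \ {g}) \ {e}) := hf.mono (Set.sdiff_subset.trans hsub)
    rw [← hadd heg]
    rcases hfe with hfe | hfe
    · refine Matchable.insert_of_forall_ne hinj hfX (i := u) (by simp [inc_of_ends heuv]) ?_
      exact fun x hx h => hx.2 (hf (hsub hx.1) (hsub heg) (h.trans hfe.symm))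
    · have hfe'v : f e' = v := hfe'.resolve_left fun h => hne (hfe.trans h.symm)
      refine Matchable.insert_of_forall_ne hinj hfX (i := v) (by simp [inc_of_ends heuv]) ?_
      intro x hx h
      have := hf (hsub hx.1) heg' (h.trans hfe'v.symm)
      exact he' (this ▸ hx.1.1)

/-- Conversely to `InducesBicircular.isMinUnmatchable`, a minimally unmatchable set without free edges
induces a bicircular graph: either it has a vertex of degree two, which can be suppressed, or counting
the ends of its edges shows that it has at most two vertices. -/
theorem IsMinUnmatchable.inducesBicircular [Fintype V] [Nonempty V]
    (hX : G.IsMinUnmatchable (X : Set ε))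
    (hfree : ∀ e ∈ X, G.ends e ≠ none) : G.InducesBicircular X := by
  classical
  induction hn : X.card generalizing G X with
  | zero =>
    exact absurd (by simpa [Finset.card_eq_zero.1 hn] using matchable_empty G.inc) hX.1
  | succ n ih =>
  obtain ⟨W, hW, hcard, hdeg⟩ := hX.exists_vertices
  by_cases h3 : ∀ v ∈ W, 3 ≤ ∑ e ∈ X, G.endsAt v e
  · refine hX.inducesBicircular_of_card_le hW hcard ?_ hfree h3
    have h1 := Finset.sum_le_sum h3
    have h2 := Finset.sum_le_sum fun e (_ : e ∈ X) => G.sum_endsAt_le W e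
    rw [Finset.sum_comm] at h1
    simp only [Finset.sum_const, smul_eq_mul] at h1 h2
    omega
  push Not at h3
  obtain ⟨w, hwW, hw3⟩ := h3
  obtain ⟨e, he, e', he', hee', hwe, hwe'⟩ := hdeg w hwW
  have hpos : ∀ x, w ∈ G.inc x → 1 ≤ G.endsAt w x := fun x hx => by simp [endsAt, hx]
  have hother : ∀ x ∈ X, x ≠ e → x ≠ e' → w ∉ G.inc x := by
    intro x hx hxe hxe' hwx
    have hsub : ({e, e', x} : Finset ε) ⊆ X := by
      intro y
      simp only [Finset.mem_insert, Finset.mem_singleton]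
      rintro (rfl | rfl | rfl) <;> assumption
    have h := Finset.sum_le_sum_of_subset (f := G.endsAt w) hsub
    rw [Finset.sum_insert (by simp [hee', hxe.symm]), Finset.sum_pair hxe'.symm] at h
    have := hpos e hwe
    have := hpos e' hwe'
    have := hpos x hwx
    omega
  have hloop : G.endsAt w e + G.endsAt w e' < 3 := by
    have hsub : ({e, e'} : Finset ε) ⊆ X := by
      intro y
      simp only [Finset.mem_insert, Finset.mem_singleton]
      rintro (rfl | rfl) <;> assumption
    have h := Finset.sum_le_sum_of_subset (f := G.endsAt w) hsub
    rw [Finset.sum_pair hee'] at h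
    omega
  obtain ⟨u, hu⟩ := exists_ends_of_mem_inc hwe
  obtain ⟨v, hv⟩ := exists_ends_of_mem_inc hwe'
  have huw : u ≠ w := by
    rintro rfl
    have := hpos e' hwe'
    have : G.endsAt u e = 2 := by simp [endsAt, hwe, hu]
    omega
  have hvw : v ≠ w := by
    rintro rfl
    have := hpos e hwe
    have : G.endsAt v e' = 2 := by simp [endsAt, hwe', hv]
    omega
  rw [Sym2.eq_swap] at hv
  -- suppress the vertex `w` by removing `e'` and giving `e` the ends `u` and `v`
  let G' : FreeGraph V ε := ⟨Function.update G.ends e (some s(u, v))⟩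
  have heuv : G'.ends e = some s(u, v) := by simp [G']
  have hrest : ∀ f, f ≠ e → G.ends f = G'.ends f := fun f hf => by simp [G', hf]
  have hXe : insert e' ((X.erase e' : Finset ε) : Set ε) = X := by
    rw [← Finset.coe_insert, Finset.insert_erase he']
  have heX : e ∈ X.erase e' := Finset.mem_erase.2 ⟨hee', he⟩
  have hw : ∀ f ∈ X.erase e', w ∉ G'.inc f := by
    intro f hf
    rw [Finset.mem_erase] at hf
    by_cases hfe : f = e
    · rw [hfe, inc_of_ends heuv]
      simp [huw.symm, hvw.symm]
    · rw [← inc_congr (hrest f hfe)]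
      exact hother f hf.2 hfe hf.1
  have hmin : G'.IsMinUnmatchable ((X.erase e' : Finset ε) : Set ε) :=
    IsMinUnmatchable.suppress (hXe.symm ▸ hX) heX (by simp) heuv hw hu hv
      fun f _ => hrest f
  have hbic := ih hmin (by
      intro f hf
      by_cases hfe : f = e
      · simp [hfe, heuv]
      · rw [← hrest f hfe]
        exact hfree f (Finset.mem_of_mem_erase hf)) (by rw [Finset.card_erase_of_mem he']; omega)
  rw [← hXe]
  exact .subdivide hbic heX (by simp) heuv (fun f hf p hp hwp => hw f hf ⟨p, hp, hwp⟩) hu hv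
    fun f _ => hrest f

end

/-- The minimally unmatchable edge sets are the circuits of the bicircular matroid. -/
theorem isMinUnmatchable_iff [Fintype V] [Nonempty V] {G : FreeGraph V ε} {C : Set ε}
    (hC : C.Finite) : G.IsMinUnmatchable C ↔
      (∃ e, G.ends e = none ∧ C = {e}) ∨ G.InducesBicircular C := by
  constructor
  · intro h
    by_cases hfree : ∀ e ∈ C, G.ends e ≠ none
    · right
      lift C to Finset ε using hC
      exact h.inducesBicircular hfree
    · push Not at hfree
      obtain ⟨e, heC, he⟩ := hfree
      refine Or.inl ⟨e, he, ?_⟩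
      by_contra hne
      obtain ⟨g, hg, hge⟩ : ∃ g ∈ C, g ≠ e := by
        by_contra! hcon
        exact hne (Set.eq_singleton_iff_unique_mem.2 ⟨heC, hcon⟩)
      obtain ⟨f, -, hfT⟩ := h.2 g hg
      simpa [inc_of_ends_none he] using hfT e ⟨heC, hge.symm⟩
  · rintro (⟨e, he, rfl⟩ | h)
    · refine ⟨fun ⟨f, _, hfT⟩ => ?_, ?_⟩
      · simpa [inc_of_ends_none he] using hfT e rfl
      · rintro g rfl
        simpa using matchable_empty G.inc
    · exact h.isMinUnmatchable

theorem exists_isMinUnmatchable_subset {G : FreeGraph V ε} {X : Set ε} (hfin : X.Finite)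
    (hX : ¬ Matchable G.inc X) : ∃ C ⊆ X, G.IsMinUnmatchable C := by
  have hfin' : {Y | Y ⊆ X ∧ ¬ Matchable G.inc Y}.Finite :=
    hfin.finite_subsets.subset fun Y hY => hY.1
  obtain ⟨C, hCX, hC⟩ := hfin'.exists_le_minimal (a := X) ⟨subset_rfl, hX⟩
  refine ⟨C, hCX, hC.prop.2, fun g hg => ?_⟩
  by_contra h
  exact (hC.le_of_le ⟨Set.sdiff_subset.trans hCX, h⟩ Set.sdiff_subset hg).2 rfl

/-- A set with at most two elements is the set of endpoints of an edge. -/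
theorem exists_ends_of_ncard_le_two (S : Set V) (hfin : S.Finite) (hS : S.ncard ≤ 2) :
    ∃ p : Option (Sym2 V), {v | ∃ q, p = some q ∧ v ∈ q} = S := by
  obtain h | h | h : S.ncard = 0 ∨ S.ncard = 1 ∨ S.ncard = 2 := by omega
  · exact ⟨none, by simp [(Set.ncard_eq_zero hfin).1 h]⟩
  · obtain ⟨v, rfl⟩ := Set.ncard_eq_one.1 h
    exact ⟨some s(v, v), by ext; simp⟩
  · obtain ⟨u, v, -, rfl⟩ := Set.ncard_eq_two.1 h
    exact ⟨some s(u, v), by ext; simp⟩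

theorem inc_ncard_le_two (G : FreeGraph V ε) (e : ε) : (G.inc e).ncard ≤ 2 := by
  cases h : G.ends e with
  | none => simp [inc_of_ends_none h]
  | some p =>
    induction p using Sym2.inductionOn with
    | _ a b =>
      rw [inc_of_ends h]
      exact Set.ncard_insert_le a {b} |>.trans (by simp)

/-- For a finite matroid, having the minimally unmatchable edge sets of a graph as circuits and having
the matchable ones as independent sets is the same. -/
theorem forall_isCircuit_iff_forall_indep {α : Type*} {M : Matroid α} (hfin : M.E.Finite)
    (G : FreeGraph V M.E) :
    (∀ C : Set M.E, M.IsCircuit (Subtype.val '' C) ↔ G.IsMinUnmatchable C) ↔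
      ∀ I : Set M.E, M.Indep (Subtype.val '' I) ↔ Matchable G.inc I := by
  have hfin' : ∀ I : Set M.E, I.Finite := fun I =>
    Set.Finite.of_finite_image (hfin.subset (by simp)) Subtype.val_injective.injOn
  constructor
  · intro h I
    rw [indep_iff_forall_subset_not_isCircuit (by simp)]
    constructor
    · intro hI
      by_contra hcon
      obtain ⟨C, hCI, hC⟩ := exists_isMinUnmatchable_subset (hfin' I) hcon
      exact hI _ (Set.image_mono hCI) ((h C).2 hC)
    · intro hI C hCI hC
      obtain ⟨D, hDI, rfl⟩ := Set.subset_image_iff.1 hCI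
      exact ((h D).1 hC).1 (hI.subset hDI)
  · intro h C
    rw [isCircuit_iff_dep_forall_sdiff_singleton_indep, IsMinUnmatchable, Dep, h,
      and_iff_left (by simp : Subtype.val '' C ⊆ M.E)]
    refine and_congr_right fun _ => ?_
    rw [Set.forall_mem_image]
    refine forall₂_congr fun g _ => ?_
    rw [← h, Set.image_sdiff Subtype.val_injective, Set.image_singleton]

end FreeGraph

/-- Bicircular matroids are the finite matroids whose independent sets are the partial transversals
of a system of sets in which each element is in at most two of the sets. -/
theorem isBicircular_iff {α : Type*} {M : Matroid α} :
    M.IsBicircular ↔ M.E.Finite ∧ ∃ (n : ℕ) (T : α → Set (Fin (n + 1))),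
      (∀ x, (T x).ncard ≤ 2) ∧ ∀ I ⊆ M.E, M.Indep I ↔ Matchable T I := by
  classical
  have key : ∀ (hfin : M.E.Finite) {n : ℕ} (G : FreeGraph (Fin (n + 1)) M.E)
      (T : α → Set (Fin (n + 1))), (∀ x : M.E, T x = G.inc x) →
      ((∀ C : Set M.E, M.IsCircuit (Subtype.val '' C) ↔
        (∃ e, G.ends e = none ∧ C = {e}) ∨ G.InducesBicircular C) ↔
        ∀ I ⊆ M.E, M.Indep I ↔ Matchable T I) := by
    intro hfin n G T hT
    have hfin' : ∀ I : Set M.E, I.Finite := fun I =>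
      Set.Finite.of_finite_image (hfin.subset (by simp)) Subtype.val_injective.injOn
    simp_rw [← FreeGraph.isMinUnmatchable_iff (hfin' _),
      FreeGraph.forall_isCircuit_iff_forall_indep hfin]
    have hm : ∀ I : Set M.E, Matchable G.inc I ↔ Matchable T (Subtype.val '' I) := fun I => by
      rw [← matchable_comp_iff Subtype.val_injective.injOn]
      exact matchable_congr fun x _ => (hT x).symm
    simp_rw [hm]
    refine ⟨fun h I hI => ?_, fun h I => h _ (by simp)⟩
    simpa [Set.inter_eq_right.2 hI] using h (Subtype.val ⁻¹' I)
  constructor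
  · rintro ⟨hfin, n, G, hG⟩
    refine ⟨hfin, ?_⟩
    obtain _ | n := n
    · -- without vertices all edges are free, which can also be said with one vertex
      have hnone : ∀ e, G.ends e = none := fun e => by
        cases h : G.ends e with
        | none => rfl
        | some p => induction p using Sym2.inductionOn with | _ a b => exact a.elim0
      obtain ⟨G', h2⟩ : ∃ G' : FreeGraph (Fin 1) M.E, ∀ e, G'.ends e = none :=
        ⟨⟨fun _ => none⟩, fun _ => rfl⟩
      refine ⟨0, fun _ => ∅, by simp, (key hfin G' _ fun x => ?_).1 fun C => (hG C).trans ?_⟩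
      · exact (FreeGraph.inc_of_ends_none (h2 x)).symm
      · have h1 : ∀ {n} {H : FreeGraph (Fin n) M.E}, (∀ e, H.ends e = none) →
            ¬ H.InducesBicircular C := by
          intro n H hH h
          cases h <;> simp_all
        simp only [h1 hnone, h1 h2, hnone, h2]
    · exact ⟨n, fun x => if hx : x ∈ M.E then G.inc ⟨x, hx⟩ else ∅,
        fun x => by
          dsimp only
          split_ifs
          · exact G.inc_ncard_le_two _
          · simp,
        (key hfin G _ fun x => by simp).1 hG⟩
  · rintro ⟨hfin, n, T, hT2, hT⟩
    choose ends hends using fun x : M.E =>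
      FreeGraph.exists_ends_of_ncard_le_two (T x) (Set.toFinite _) (hT2 x)
    exact ⟨hfin, n + 1, ⟨ends⟩, (key hfin ⟨ends⟩ T fun x => (hends x).symm).2 hT⟩

/-! ### Lattice path matroids by counting conditions, and their minors -/

section LatticePath

variable {α : Type*} {m r : ℕ}

theorem LatticePath.height_of_le (P : LatticePath m r) {k : ℕ} (hk : m + r ≤ k) :
    P.height k = r := by
  rw [height, Finset.filter_true_of_mem fun i _ => i.2.trans_le hk, P.card_north]

/-- A function that grows in steps of `0` or `1` from `0` to `r` is the height function of a path. -/
theorem LatticePath.exists_height_eq {f : ℕ → ℕ} (h0 : f 0 = 0) (hn : f (m + r) = r)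
    (hstep : ∀ j, f j ≤ f (j + 1) ∧ f (j + 1) ≤ f j + 1) :
    ∃ P : LatticePath m r, ∀ k, P.height k = f (min k (m + r)) := by
  classical
  let N : Finset (Fin (m + r)) := {i | f (i + 1) = f i + 1}
  have hN : ∀ k, k ≤ m + r → (N.filter fun i => i.val < k).card = f k := by
    intro k
    induction k with
    | zero => simp [h0]
    | succ k ih =>
      intro hk
      have hsplit : (N.filter fun i => i.val < k + 1) =
          (N.filter fun i => i.val < k) ∪ (if f (k + 1) = f k + 1 then {⟨k, hk⟩} else ∅) := by
        ext i
        by_cases hi : i = ⟨k, hk⟩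
        · subst hi
          split_ifs with h <;> simp [N, h]
        · have hik : i.val ≠ k := fun h => hi (Fin.ext h)
          split_ifs with h <;> simp [N, hi] <;> omega
      rw [hsplit, Finset.card_union_of_disjoint, ih (by omega)]
      · have := hstep k
        split_ifs with h <;> simp <;> omega
      · split_ifs <;> simp
  have hcard : N.card = r := by
    have h := hN _ le_rfl
    rwa [Finset.filter_true_of_mem fun i _ => i.2, hn] at h
  refine ⟨⟨N, hcard⟩, fun k => ?_⟩
  obtain hk | hk := le_total k (m + r)
  · rw [min_eq_left hk]
    exact hN k hk
  · rw [min_eq_right hk, hn, height_of_le _ hk]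

theorem card_filter_toFinset_image {X : Type*} {n : ℕ} (e : X ≃ Fin n) (B : Set X)
    {N : Finset (Fin n)} (hN : e '' B = N) (k : ℕ) :
    (N.filter fun i => i.val < k).card = {x ∈ B | (e x : ℕ) < k}.ncard := by
  rw [← Set.ncard_coe_finset, ← Set.ncard_image_of_injective _ e.injective]
  congr 1
  ext i
  rw [Finset.coe_filter]
  simp only [← Finset.mem_coe, ← hN]
  constructor
  · rintro ⟨⟨x, hx, rfl⟩, hi⟩
    exact ⟨x, ⟨hx, hi⟩, rfl⟩
  · rintro ⟨x, ⟨hx, hi⟩, rfl⟩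
    exact ⟨⟨x, hx, rfl⟩, hi⟩

/-- Labelled sets of North steps of paths between `P` and `Q` are recognized by counting. -/
theorem exists_latticePath_iff {X : Type*} (e : X ≃ Fin (m + r)) (P Q : LatticePath m r)
    (B : Set X) :
    (∃ R : LatticePath m r, P.NeverAbove R ∧ R.NeverAbove Q ∧ e '' B = (R.north : Set _)) ↔
      ∀ k, P.height k ≤ {x ∈ B | (e x : ℕ) < k}.ncard ∧
        {x ∈ B | (e x : ℕ) < k}.ncard ≤ Q.height k := by
  classical
  constructor
  · rintro ⟨R, hPR, hRQ, hR⟩ k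
    rw [← card_filter_toFinset_image e B hR]
    exact ⟨hPR k, hRQ k⟩
  · intro h
    have hN : e '' B = ((e '' B).toFinset : Set (Fin (m + r))) := by simp
    simp_rw [← card_filter_toFinset_image e B hN] at h
    refine ⟨⟨(e '' B).toFinset, ?_⟩, fun k => (h k).1, fun k => (h k).2, hN⟩
    have := h (m + r)
    rw [P.height_of_le le_rfl, Q.height_of_le le_rfl,
      Finset.filter_true_of_mem fun i _ => i.2] at this
    exact this.2.antisymm this.1

/-- The definition of lattice path matroids in terms of labels of the elements. -/
theorem IsLatticePath.exists_labelling {M : Matroid α} (hM : M.IsLatticePath) :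
    ∃ (m r : ℕ) (P Q : LatticePath m r) (p : α → ℕ), Set.BijOn p M.E (Set.Iio (m + r)) ∧
      ∀ B ⊆ M.E, M.IsBase B ↔ ∀ k, P.height k ≤ {x ∈ B | p x < k}.ncard ∧
        {x ∈ B | p x < k}.ncard ≤ Q.height k := by
  classical
  obtain ⟨m, r, P, Q, -, e, he⟩ := hM
  let p : α → ℕ := fun x => if hx : x ∈ M.E then e ⟨x, hx⟩ else 0
  have hp : ∀ x : M.E, p x = e x := fun x => by simp [p]
  refine ⟨m, r, P, Q, p, ⟨?_, ?_, ?_⟩, fun B hB => ?_⟩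
  · intro x hx
    rw [hp ⟨x, hx⟩]
    exact (e _).2
  · intro x hx y hy h
    rw [hp ⟨x, hx⟩, hp ⟨y, hy⟩] at h
    simpa using e.injective (Fin.ext h)
  · intro i hi
    exact ⟨e.symm ⟨i, hi⟩, (e.symm ⟨i, hi⟩).2, by rw [hp]; simp⟩
  · obtain ⟨C, rfl⟩ : ∃ C : Set M.E, Subtype.val '' C = B := ⟨Subtype.val ⁻¹' B, by
      simp [Set.inter_eq_right.2 hB]⟩
    rw [he, exists_latticePath_iff]
    have : ∀ k, {x ∈ Subtype.val '' C | p x < k}.ncard = {x ∈ C | (e x : ℕ) < k}.ncard := by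
      intro k
      rw [← Set.ncard_image_of_injective {x ∈ C | (e x : ℕ) < k} Subtype.val_injective]
      congr 1
      ext x
      constructor
      · rintro ⟨⟨x, hx, rfl⟩, h⟩
        exact ⟨x, ⟨hx, hp x ▸ h⟩, rfl⟩
      · rintro ⟨x, ⟨hx, h⟩, rfl⟩
        exact ⟨⟨x, hx, rfl⟩, by rwa [hp]⟩
    simp_rw [this]

/-- A matroid is lattice path as soon as its bases are described, with respect to some linear order of
the finite ground set, by arbitrary lower and upper bounds on the number of elements in the initial
segments: the bounds that are attained by bases are the heights of two lattice paths. -/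
theorem isLatticePath_of_bounds {M : Matroid α} (hfin : M.E.Finite) {p : α → ℕ}
    (hp : Set.InjOn p M.E) {a b : ℕ → ℤ}
    (hM : ∀ B ⊆ M.E, M.IsBase B ↔ ∀ k, a k ≤ {x ∈ B | p x < k}.ncard ∧
      ({x ∈ B | p x < k}.ncard : ℤ) ≤ b k) : M.IsLatticePath := by
  classical
  have hfin' : Finite M.E := hfin
  have : Fintype M.E := Fintype.ofFinite _
  -- relabel the elements by their ranks in the order given by `p`
  let ρ : M.E → ℕ := fun x => {y : M.E | p y < p x}.ncard
  have hlt : ∀ (x : M.E) k, p x < k ↔ ρ x < {y : M.E | p y < k}.ncard := by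
    intro x k
    constructor
    · intro h
      refine Set.ncard_lt_ncard ⟨fun y hy => lt_trans hy h, fun hsub => ?_⟩ (Set.toFinite _)
      exact lt_irrefl (p x) (hsub h)
    · intro h
      by_contra hk
      exact h.not_ge (Set.ncard_le_ncard (fun y hy => lt_of_lt_of_le hy (not_lt.1 hk))
        (Set.toFinite _))
  have hρinj : Function.Injective ρ := by
    intro x y h
    by_contra hne
    rcases lt_or_gt_of_ne (fun h => hne (Subtype.ext (hp x.2 y.2 h))) with h1 | h1
    · exact (((hlt x _).1 h1).trans_eq h.symm).ne rfl
    · exact (((hlt y _).1 h1).trans_eq h).ne rfl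
  have hρn : ∀ x, ρ x < Fintype.card M.E := fun x => by
    rw [← Nat.card_eq_fintype_card, ← Set.ncard_univ]
    exact Set.ncard_lt_ncard ⟨Set.subset_univ _, fun h => lt_irrefl (p x) (h (Set.mem_univ x))⟩
      (Set.toFinite _)
  obtain ⟨B₀, hB₀⟩ := M.exists_isBase
  obtain ⟨C₀, rfl⟩ : ∃ C : Set M.E, Subtype.val '' C = B₀ := ⟨Subtype.val ⁻¹' B₀, by
    simp [Set.inter_eq_right.2 hB₀.subset_ground]⟩
  have hr : ∀ C : Set M.E, M.IsBase (Subtype.val '' C) → C.ncard = C₀.ncard := fun C hC => by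
    have := hC.ncard_eq_ncard_of_isBase hB₀
    rwa [Set.ncard_image_of_injective _ Subtype.val_injective,
      Set.ncard_image_of_injective _ Subtype.val_injective] at this
  set r := C₀.ncard with hrdef
  obtain ⟨m, hm⟩ : ∃ m, Fintype.card M.E = m + r := by
    refine ⟨Fintype.card M.E - r, (Nat.sub_add_cancel ?_).symm⟩
    rw [← Nat.card_eq_fintype_card, ← Set.ncard_univ]
    exact Set.ncard_le_ncard (Set.subset_univ _) (Set.toFinite _)
  let e : M.E ≃ Fin (m + r) := Equiv.ofBijective (fun x => ⟨ρ x, hm ▸ hρn x⟩) <|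
    (Fintype.bijective_iff_injective_and_card _).2
      ⟨fun x y h => hρinj (by simpa using h), by simp [hm]⟩
  have he : ∀ x, (e x : ℕ) = ρ x := fun x => rfl
  -- the heights of the paths that belong to bases
  let ht : Set M.E → ℕ → ℕ := fun C j => {x ∈ C | (e x : ℕ) < j}.ncard
  have hht : ∀ C k, {x ∈ Subtype.val '' C | p x < k}.ncard = ht C {y : M.E | p y < k}.ncard := by
    intro C k
    simp only [ht]
    rw [← Set.ncard_image_of_injective {x ∈ C | (e x : ℕ) < _} Subtype.val_injective]
    congr 1
    ext x
    constructor
    · rintro ⟨⟨x, hx, rfl⟩, h⟩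
      exact ⟨x, ⟨hx, (hlt x k).1 h⟩, rfl⟩
    · rintro ⟨x, ⟨hx, h⟩, rfl⟩
      exact ⟨⟨x, hx, rfl⟩, (hlt x k).2 h⟩
  have hht0 : ∀ C, ht C 0 = 0 := fun C => by simp [ht]
  have hhtn : ∀ C, M.IsBase (Subtype.val '' C) → ht C (m + r) = r := fun C hC => by
    rw [← hr C hC]
    refine congrArg Set.ncard (Set.sep_eq_self_iff_mem_true.2 fun x _ => ?_)
    rw [hr C hC]
    exact (e x).2
  have hhts : ∀ C j, ht C j ≤ ht C (j + 1) ∧ ht C (j + 1) ≤ ht C j + 1 := by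
    intro C j
    constructor
    · exact Set.ncard_le_ncard (fun x hx => ⟨hx.1, lt_trans hx.2 j.lt_succ_self⟩) (Set.toFinite _)
    · have hsub : {x ∈ C | (e x : ℕ) < j + 1} ⊆
          {x ∈ C | (e x : ℕ) < j} ∪ {x | (e x : ℕ) = j} := by
        rintro x ⟨hx, h⟩
        rcases Nat.lt_succ_iff_lt_or_eq.1 h with h | h
        · exact Or.inl ⟨hx, h⟩
        · exact Or.inr h
      refine (Set.ncard_le_ncard hsub (Set.toFinite _)).trans ((Set.ncard_union_le _ _).trans ?_)
      refine Nat.add_le_add_left ((Set.ncard_le_one (Set.toFinite _)).2 fun x hx y hy => ?_) _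
      exact e.injective (Fin.ext (hx.trans hy.symm))
  let S : ℕ → Set ℕ := fun j => {c | ∃ C, M.IsBase (Subtype.val '' C) ∧ ht C j = c}
  have hS : ∀ j, (S j).Nonempty := fun j => ⟨_, C₀, hB₀, rfl⟩
  have hSb : ∀ j, BddAbove (S j) := fun j => ⟨Fintype.card M.E, by
    rintro _ ⟨C, -, rfl⟩
    rw [← Nat.card_eq_fintype_card, ← Set.ncard_univ]
    exact Set.ncard_le_ncard (Set.subset_univ _) (Set.toFinite _)⟩
  have hSmem : ∀ C j, M.IsBase (Subtype.val '' C) → ht C j ∈ S j := fun C j hC => ⟨C, hC, rfl⟩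
  have hS0 : S 0 = {0} := by
    ext c
    constructor
    · rintro ⟨C, -, rfl⟩
      exact hht0 C
    · rintro rfl
      exact ⟨C₀, hB₀, hht0 C₀⟩
  have hSn : S (m + r) = {r} := by
    ext c
    constructor
    · rintro ⟨C, hC, rfl⟩
      exact hhtn C hC
    · rintro rfl
      exact ⟨C₀, hB₀, hhtn C₀ hB₀⟩
  obtain ⟨P, hP⟩ := LatticePath.exists_height_eq (m := m) (r := r) (f := fun j => sInf (S j))
    (by simp [hS0]) (by simp [hSn]) (by
      intro j
      obtain ⟨C, hC, hCj⟩ := Nat.sInf_mem (hS j)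
      obtain ⟨D, hD, hDj⟩ := Nat.sInf_mem (hS (j + 1))
      have h1 := Nat.sInf_le (hSmem D j hD)
      have h2 := Nat.sInf_le (hSmem C (j + 1) hC)
      have h3 := hhts C j
      have h4 := hhts D j
      omega)
  obtain ⟨Q, hQ⟩ := LatticePath.exists_height_eq (m := m) (r := r) (f := fun j => sSup (S j))
    (by simp [hS0]) (by simp [hSn]) (by
      intro j
      obtain ⟨C, hC, hCj⟩ := Nat.sSup_mem (hS j) (hSb j)
      obtain ⟨D, hD, hDj⟩ := Nat.sSup_mem (hS (j + 1)) (hSb (j + 1))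
      have h1 := le_csSup (hSb j) (hSmem D j hD)
      have h2 := le_csSup (hSb (j + 1)) (hSmem C (j + 1) hC)
      have h3 := hhts C j
      have h4 := hhts D j
      omega)
  refine ⟨m, r, P, Q, fun k => ?_, e, fun C => ?_⟩
  · rw [hP, hQ]
    exact (Nat.sInf_le (hSmem C₀ _ hB₀)).trans (le_csSup (hSb _) (hSmem C₀ _ hB₀))
  · rw [exists_latticePath_iff]
    constructor
    · intro hC k
      have hmin : {x ∈ C | (e x : ℕ) < k}.ncard = ht C (min k (m + r)) := by
        simp only [ht, lt_min_iff, Fin.is_lt, and_true]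
      rw [hmin, hP, hQ]
      exact ⟨Nat.sInf_le (hSmem C _ hC), le_csSup (hSb _) (hSmem C _ hC)⟩
    · intro h
      rw [hM _ (by simp)]
      intro k
      have hk : {y : M.E | p y < k}.ncard ≤ m + r := by
        rw [← hm, ← Nat.card_eq_fintype_card, ← Set.ncard_univ]
        exact Set.ncard_le_ncard (Set.subset_univ _) (Set.toFinite _)
      have hk' := h {y : M.E | p y < k}.ncard
      rw [hP, hQ, min_eq_left hk] at hk'
      obtain ⟨D, hD, hDj⟩ := Nat.sInf_mem (hS {y : M.E | p y < k}.ncard)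
      obtain ⟨D', hD', hDj'⟩ := Nat.sSup_mem (hS {y : M.E | p y < k}.ncard) (hSb _)
      have h1 := ((hM _ (by simp)).1 hD k).1
      have h2 := ((hM _ (by simp)).1 hD' k).2
      rw [hht] at h1 h2 ⊢
      change _ ≤ ht C _ ∧ ht C _ ≤ _ at hk'
      omega

/-- The bases of a minor `N` of a finite matroid `M` are the subsets `B` of its ground set for which
`B ∪ I` is a base of `M`, for a suitable fixed set `I`. -/
theorem IsMinor.exists_isBase_iff {M N : Matroid α} (hN : N ≤m M) (hfin : M.E.Finite) :
    ∃ I ⊆ M.E, Disjoint N.E I ∧ ∀ B ⊆ N.E, N.IsBase B ↔ M.IsBase (B ∪ I) := by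
  obtain ⟨C, D, -, -, -, rfl⟩ := hN.exists_eq_contract_delete_disjoint
  obtain ⟨I₀, hI₀⟩ := M.exists_isBasis' C
  set N := M ／ C ＼ D with hNdef
  have hNE : N.E ⊆ M.E := hN.subset
  have hNC : Disjoint C N.E :=
    Set.disjoint_left.2 fun x hxC hxN => hxN.1.2 hxC
  have hind : ∀ J ⊆ N.E, N.Indep J ↔ M.Indep (J ∪ I₀) := fun J hJ => by
    rw [hNdef, delete_indep_iff, hI₀.contract_indep_iff, and_assoc,
      and_iff_left ⟨hNC.mono_right hJ, Set.disjoint_left.2 fun x hx hxD => (hJ hx).2 hxD⟩]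
  obtain ⟨B₀, hB₀⟩ := N.exists_isBase
  have hB₀E := hB₀.subset_ground
  obtain ⟨S, hS, hBS⟩ := ((hind B₀ hB₀E).1 hB₀.indep).exists_isBase_superset
  have hI₀S : I₀ ⊆ S := Set.subset_union_right.trans hBS
  have hB₀S : B₀ ⊆ S := Set.subset_union_left.trans hBS
  have hdisj : Disjoint N.E (S \ B₀) := by
    rw [Set.disjoint_left]
    rintro x hxN ⟨hxS, hxB⟩
    have h : N.Indep (insert x B₀) := by
      rw [hind _ (Set.insert_subset hxN hB₀E)]
      exact hS.indep.subset (Set.union_subset (Set.insert_subset hxS hB₀S) hI₀S)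
    exact hxB (hB₀.mem_of_insert_indep h)
  have hI₀' : I₀ ⊆ S \ B₀ := fun x hx => ⟨hI₀S hx, fun h =>
    Set.disjoint_left.1 hNC (hI₀.subset hx) (hB₀E h)⟩
  have hScard : S.ncard = B₀.ncard + (S \ B₀).ncard := by
    rw [add_comm, Set.ncard_sdiff_add_ncard_of_subset hB₀S (hfin.subset hS.subset_ground)]
  have hcard : ∀ B ⊆ N.E, (B ∪ S \ B₀).ncard = B.ncard + (S \ B₀).ncard := fun B hB =>
    Set.ncard_union_eq (hdisj.mono_left hB) (hfin.subset (hB.trans hNE))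
      (hfin.subset (Set.sdiff_subset.trans hS.subset_ground))
  have hSE : S \ B₀ ⊆ M.E := Set.sdiff_subset.trans hS.subset_ground
  refine ⟨S \ B₀, hSE, hdisj, fun B hB => ⟨fun h => ?_, fun h => ?_⟩⟩
  · have hBE : B ∪ S \ B₀ ⊆ M.E := Set.union_subset (hB.trans hNE) hSE
    have hspan : M.Spanning (B ∪ S \ B₀) := by
      rw [spanning_iff_ground_subset_closure hBE, ← hS.closure_eq]
      refine M.closure_subset_closure_of_subset_closure fun x hx => ?_
      by_cases hxB₀ : x ∈ B₀
      · by_cases hxB : x ∈ B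
        · exact M.mem_closure_of_mem (Or.inl hxB) hBE
        refine M.closure_subset_closure (Set.union_subset_union_right B hI₀') ?_
        rw [((hind B hB).1 h.indep).mem_closure_iff_of_notMem]
        · rw [← Set.insert_union]
          rw [← not_indep_iff (Set.union_subset (Set.insert_subset (hNE (hB₀E hxB₀)) (hB.trans hNE))
            (hI₀'.trans hSE)), ← hind _ (Set.insert_subset (hB₀E hxB₀) hB)]
          exact fun hcon => hxB (h.mem_of_insert_indep hcon)
        · rintro (h' | h')
          · exact hxB h'
          · exact (hI₀' h').2 hxB₀
      · exact M.mem_closure_of_mem (Or.inr ⟨hx, hxB₀⟩) hBE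
    obtain ⟨S', hS', hS'B⟩ := hspan.exists_isBase_subset
    have := hS'.ncard_eq_ncard_of_isBase hS
    have h2 := h.ncard_eq_ncard_of_isBase hB₀
    rwa [← Set.eq_of_subset_of_ncard_le hS'B (by rw [hcard B hB]; omega) (hfin.subset hBE)]
  · have hBind : N.Indep B :=
      (hind B hB).2 (h.indep.subset (Set.union_subset_union_right B hI₀'))
    obtain ⟨B', hB', hBB'⟩ := hBind.exists_isBase_superset
    have h1 := h.ncard_eq_ncard_of_isBase hS
    have h2 := hB'.ncard_eq_ncard_of_isBase hB₀
    rw [hcard B hB] at h1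
    rwa [Set.eq_of_subset_of_ncard_le hBB' (by omega)
      (hfin.subset (hB'.subset_ground.trans hNE))]

theorem IsLatticePath.finite_ground {M : Matroid α} (hM : M.IsLatticePath) : M.E.Finite := by
  obtain ⟨m, r, -, -, -, e, -⟩ := hM
  exact Finite.of_equiv _ e.symm

/-- Lattice path matroids are closed under minors: the bases `B` of a minor of `M` correspond to bases
`B ∪ I` of `M` with `I` fixed, and the numbers of elements of `B` and of `B ∪ I` in an initial segment
differ by a number that does not depend on `B`. -/
theorem IsLatticePath.of_isMinor {M N : Matroid α} (hM : M.IsLatticePath) (hN : N ≤m M) :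
    N.IsLatticePath := by
  have hfin := hM.finite_ground
  obtain ⟨m, r, P, Q, p, hp, hB⟩ := hM.exists_labelling
  obtain ⟨I, hIE, hdisj, hI⟩ := hN.exists_isBase_iff hfin
  refine isLatticePath_of_bounds (hfin.subset hN.subset) (hp.injOn.mono hN.subset)
    (a := fun k => P.height k - {x ∈ I | p x < k}.ncard)
    (b := fun k => Q.height k - {x ∈ I | p x < k}.ncard) fun B hBN => ?_
  rw [hI B hBN, hB _ (Set.union_subset (hBN.trans hN.subset) hIE)]
  refine forall_congr' fun k => ?_
  have hcount : {x ∈ B ∪ I | p x < k}.ncard =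
      {x ∈ B | p x < k}.ncard + {x ∈ I | p x < k}.ncard := by
    have hun : {x ∈ B ∪ I | p x < k} = {x ∈ B | p x < k} ∪ {x ∈ I | p x < k} := by
      ext x
      simp only [Set.mem_ofPred_eq, Set.mem_union]
      tauto
    rw [hun]
    exact Set.ncard_union_eq ((hdisj.mono_left hBN).mono (Set.sep_subset _ _) (Set.sep_subset _ _))
      (hfin.subset ((Set.sep_subset _ _).trans (hBN.trans hN.subset)))
      (hfin.subset ((Set.sep_subset _ _).trans hIE))
  rw [hcount]
  omega

end LatticePath

/-! ### Interval presentations of lattice path matroids of rank at most four -/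

/-- Increasing sequences can be compared by counting their terms below each bound. -/
theorem forall_le_iff_card_lt_le {r : ℕ} {x y : Fin r → ℕ} (hx : StrictMono x)
    (hy : StrictMono y) : (∀ i, x i ≤ y i) ↔ ∀ k,
      (Finset.univ.filter fun i => y i < k).card ≤ (Finset.univ.filter fun i => x i < k).card := by
  constructor
  · intro h k
    refine Finset.card_le_card fun i hi => ?_
    simp only [Finset.mem_filter, Finset.mem_univ, true_and] at hi ⊢
    exact (h i).trans_lt hi
  · intro h i
    by_contra hi
    have h1 : Finset.univ.filter (fun j => x j < y i + 1) ⊆ Finset.Iio i := by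
      intro j hj
      simp only [Finset.mem_filter, Finset.mem_univ, true_and, Finset.mem_Iio] at hj ⊢
      exact hx.lt_iff_lt.1 (by omega)
    have h2 : Finset.Iic i ⊆ Finset.univ.filter (fun j => y j < y i + 1) := by
      intro j hj
      simp only [Finset.mem_filter, Finset.mem_univ, true_and, Finset.mem_Iic] at hj ⊢
      exact Nat.lt_succ_of_le (hy.monotone hj)
    have := (Finset.card_le_card h2).trans ((h _).trans (Finset.card_le_card h1))
    simp at this

theorem LatticePath.height_eq_card {m r : ℕ} (P : LatticePath m r) (k : ℕ) :
    P.height k =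
      (Finset.univ.filter fun i => (P.north.orderEmbOfFin P.card_north i : ℕ) < k).card := by
  rw [height, ← Finset.card_map (P.north.orderEmbOfFin P.card_north).toEmbedding]
  congr 1
  ext i
  simp only [Finset.mem_filter, Finset.mem_map, Finset.mem_univ, true_and]
  constructor
  · rintro ⟨hi, hik⟩
    rw [← Finset.mem_coe, ← Finset.range_orderEmbOfFin P.north P.card_north] at hi
    obtain ⟨j, rfl⟩ := hi
    exact ⟨j, hik, rfl⟩
  · rintro ⟨j, hj, rfl⟩
    exact ⟨Finset.orderEmbOfFin_mem _ _ _, hj⟩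

/-- The indices of the intervals `[l i, u i]` that contain `z`. -/
def intervalType (l u : Fin 4 → ℤ) (z : ℤ) : Set (Fin 4) := {i | l i ≤ z ∧ z ≤ u i}

/-- A presentation of a matroid of rank at most `4` by four intervals: the elements are labelled by
`0, ..., n - 1`, both ends of the intervals are increasing, and the independent sets are the partial
transversals of the intervals. Only the first `r` intervals count, where `r` is the rank; the other
ones contain no label. -/
structure IntervalPresentation {α : Type*} (M : Matroid α) (n r : ℕ) (p : α → ℤ)
    (l u : Fin 4 → ℤ) : Prop where
  bijOn : Set.BijOn p M.E (Set.Ico 0 n)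
  strictMono_left : StrictMono l
  strictMono_right : StrictMono u
  le : ∀ i, l i ≤ u i
  indep_iff : ∀ I ⊆ M.E, M.Indep I ↔ Matchable (intervalType l u) (p '' I)
  mem_of_lt : ∀ i : Fin 4, (i : ℕ) < r → 0 ≤ l i ∧ u i < n
  eq_of_le : ∀ i : Fin 4, r ≤ (i : ℕ) → l i = n + i ∧ u i = n + i

/-- The ends of the `r` intervals are given by the North steps of the two bounding paths. -/
theorem IsLatticePath.exists_intervalPresentation {α : Type*} {M : Matroid α}
    (hM : M.IsLatticePath) (hr : M.eRank ≤ 4) : ∃ (n r : ℕ) (p : α → ℤ) (l u : Fin 4 → ℤ),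
      M.eRank = r ∧ M.IntervalPresentation n r p l u := by
  classical
  have hfin := hM.finite_ground
  obtain ⟨m, r, P, Q, p, hp, hB⟩ := hM.exists_labelling
  obtain ⟨B₀, hB₀⟩ := M.exists_isBase
  have hBfin : ∀ B ⊆ M.E, B.Finite := fun B h => hfin.subset h
  have hcard : ∀ B, M.IsBase B → B.ncard = r := by
    intro B h
    have h1 := (hB B h.subset_ground).1 h (m + r)
    have h2 : {x ∈ B | p x < m + r} = B :=
      Set.sep_eq_self_iff_mem_true.2 fun x hx => hp.mapsTo (h.subset_ground hx)
    rw [P.height_of_le le_rfl, Q.height_of_le le_rfl, h2] at h1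
    omega
  have hrank : M.eRank = r := by
    rw [← hB₀.encard_eq_eRank, ← (hBfin _ hB₀.subset_ground).cast_ncard_eq, hcard _ hB₀]
  have hr4 : r ≤ 4 := by
    rw [hrank] at hr
    exact_mod_cast hr
  set a : Fin r → ℕ := fun i => Q.north.orderEmbOfFin Q.card_north i with ha
  set b : Fin r → ℕ := fun i => P.north.orderEmbOfFin P.card_north i with hb
  have hamono : StrictMono a := fun i j h => (Q.north.orderEmbOfFin Q.card_north).strictMono h
  have hbmono : StrictMono b := fun i j h => (P.north.orderEmbOfFin P.card_north).strictMono h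
  have halt : ∀ i, a i < m + r := fun i => Fin.is_lt _
  have hblt : ∀ i, b i < m + r := fun i => Fin.is_lt _
  have hab : ∀ i, a i ≤ b i := by
    rw [forall_le_iff_card_lt_le hamono hbmono]
    intro k
    rw [← P.height_eq_card, ← Q.height_eq_card]
    have := (hB B₀ hB₀.subset_ground).1 hB₀ k
    omega
  let l : Fin 4 → ℤ := fun i => if h : (i : ℕ) < r then a ⟨i, h⟩ else (m + r : ℕ) + (i : ℕ)
  let u : Fin 4 → ℤ := fun i => if h : (i : ℕ) < r then b ⟨i, h⟩ else (m + r : ℕ) + (i : ℕ)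
  have hmono : ∀ c : Fin r → ℕ, StrictMono c → (∀ i, c i < m + r) →
      StrictMono fun i : Fin 4 =>
        if h : (i : ℕ) < r then (c ⟨i, h⟩ : ℤ) else (m + r : ℕ) + (i : ℕ) := by
    intro c hc hcn i j hij
    have hij' : (i : ℕ) < j := hij
    dsimp only
    split_ifs with hi hj hj
    · exact_mod_cast hc (show (⟨i, hi⟩ : Fin r) < ⟨j, hj⟩ from hij)
    · have := hcn ⟨i, hi⟩
      omega
    · omega
    · omega
  let pz : α → ℤ := fun x => p x
  have hbij : Set.BijOn pz M.E (Set.Ico 0 ((m + r : ℕ) : ℤ)) := by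
    refine ⟨fun x hx => ?_, fun x hx y hy h => hp.injOn hx hy (by simpa [pz] using h),
      fun i hi => ?_⟩
    · have : p x < m + r := hp.mapsTo hx
      simp only [Set.mem_Ico, pz]
      omega
    · obtain ⟨x, hx, h⟩ := hp.surjOn (show i.toNat ∈ Set.Iio (m + r) by
        simp only [Set.mem_Ico, Set.mem_Iio] at hi ⊢
        omega)
      refine ⟨x, hx, ?_⟩
      simp only [Set.mem_Ico, pz] at hi ⊢
      omega
  let T : α → Set (Fin 4) := fun x => intervalType l u (pz x)
  have hTr : ∀ x ∈ M.E, ∀ i ∈ T x, ∃ h : (i : ℕ) < r, a ⟨i, h⟩ ≤ p x ∧ p x ≤ b ⟨i, h⟩ := by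
    intro x hx i hi
    have h0 : p x < m + r := hp.mapsTo hx
    simp only [T, intervalType, l, u, pz, Set.mem_ofPred_eq] at hi
    split_ifs at hi with h
    · exact ⟨h, by omega⟩
    · omega
  have hbase : ∀ B ⊆ M.E, M.IsBase B ↔ B.ncard = r ∧ Matchable T B := by
    intro B hBE
    constructor
    · intro h
      refine ⟨hcard B h, ?_⟩
      -- match the elements of the base in increasing order
      have hs : ((hBfin B hBE).toFinset.image p).card = r := by
        rw [Finset.card_image_of_injOn, ← Set.ncard_eq_toFinset_card B (hBfin B hBE), hcard B h]
        simpa using hp.injOn.mono hBE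
      set c := ((hBfin B hBE).toFinset.image p).orderEmbOfFin hs with hc
      have hcB : ∀ i, ∃ x ∈ B, p x = c i := fun i => by
        have := Finset.orderEmbOfFin_mem _ hs i
        rw [Finset.mem_image] at this
        simpa only [Set.Finite.mem_toFinset] using this
      choose x hxB hx using hcB
      have hBx : B = Set.range x := by
        ext y
        constructor
        · intro hy
          have : p y ∈ Set.range c := by
            rw [hc, Finset.range_orderEmbOfFin]
            simpa using ⟨y, hy, rfl⟩
          obtain ⟨i, hi⟩ := this
          exact ⟨i, hp.injOn (hBE (hxB i)) (hBE hy) ((hx i).trans hi)⟩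
        · rintro ⟨i, rfl⟩
          exact hxB i
      have hcount : ∀ k, {y ∈ B | p y < k}.ncard =
          (Finset.univ.filter fun i => c i < k).card := by
        intro k
        have hxinj : Function.Injective x := fun i j hij => c.injective (by rw [← hx, ← hx, hij])
        rw [← Finset.card_image_of_injective _ hxinj, ← Set.ncard_coe_finset]
        congr 1
        ext y
        simp only [Set.mem_ofPred_eq, Finset.coe_image, Finset.coe_filter, Finset.mem_univ,
          true_and, Set.mem_image]
        constructor
        · rintro ⟨hy, hyk⟩
          rw [hBx] at hy
          obtain ⟨i, rfl⟩ := hy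
          exact ⟨i, hx i ▸ hyk, rfl⟩
        · rintro ⟨i, hi, rfl⟩
          exact ⟨hxB i, (hx i).trans_lt hi⟩
      have hBk := (hB B hBE).1 h
      simp_rw [hcount, P.height_eq_card, Q.height_eq_card] at hBk
      have h1 := (forall_le_iff_card_lt_le hamono c.strictMono).2 fun k => (hBk k).2
      have h2 := (forall_le_iff_card_lt_le c.strictMono hbmono).2 fun k => (hBk k).1
      rw [hBx]
      refine matchable_range (c := Fin.castLE hr4) x (Fin.castLE_injective hr4) fun i => ?_
      simp only [T, intervalType, l, u, pz, Set.mem_ofPred_eq, Fin.val_castLE, i.is_lt, dite_true,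
        hx]
      exact ⟨by exact_mod_cast h1 i, by exact_mod_cast h2 i⟩
    · rintro ⟨hBr, f, hf, hfT⟩
      -- all `r` intervals are used, and the representatives compare with both ends
      have hsurj : ∀ i : Fin r, ∃ x ∈ B, (f x : ℕ) = i := by
        have himg : (f '' B).ncard = r := by rw [Set.InjOn.ncard_image hf, hBr]
        have hsub : f '' B ⊆ Set.range (Fin.castLE hr4) := by
          rintro _ ⟨x, hx, rfl⟩
          obtain ⟨h, -⟩ := hTr x (hBE hx) _ (hfT x hx)
          exact ⟨⟨f x, h⟩, rfl⟩
        have heq := Set.eq_of_subset_of_ncard_le hsub (by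
          rw [himg, ← Set.image_univ, Set.ncard_image_of_injective _ (Fin.castLE_injective hr4),
            Set.ncard_univ, Nat.card_fin])
        intro i
        have : Fin.castLE hr4 i ∈ f '' B := heq ▸ ⟨i, rfl⟩
        obtain ⟨x, hx, h⟩ := this
        exact ⟨x, hx, by simp [h]⟩
      choose x hxB hx using hsurj
      have hxbd : ∀ i, a i ≤ p (x i) ∧ p (x i) ≤ b i := fun i => by
        obtain ⟨h, h1⟩ := hTr (x i) (hBE (hxB i)) _ (hfT _ (hxB i))
        have : (⟨f (x i), h⟩ : Fin r) = i := Fin.ext (hx i)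
        rwa [this] at h1
      have hxinj : Function.Injective x := fun i j hij => Fin.ext (by rw [← hx, ← hx, hij])
      have hcount : ∀ k, {y ∈ B | p y < k}.ncard =
          (Finset.univ.filter fun i => p (x i) < k).card := by
        intro k
        rw [← Finset.card_image_of_injective _ hxinj, ← Set.ncard_coe_finset]
        congr 1
        ext y
        simp only [Set.mem_ofPred_eq, Finset.coe_image, Finset.coe_filter, Finset.mem_univ,
          true_and, Set.mem_image]
        constructor
        · rintro ⟨hy, hyk⟩
          obtain ⟨h, -⟩ := hTr y (hBE hy) _ (hfT y hy)
          have : x ⟨f y, h⟩ = y := hf (hxB _) hy (Fin.ext (hx _))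
          exact ⟨⟨f y, h⟩, by rwa [this], this⟩
        · rintro ⟨i, hi, rfl⟩
          exact ⟨hxB i, hi⟩
      rw [hB B hBE]
      intro k
      rw [hcount, P.height_eq_card, Q.height_eq_card]
      constructor <;> refine Finset.card_le_card fun i hi => ?_ <;>
        simp only [Finset.mem_filter, Finset.mem_univ, true_and] at hi ⊢
      · exact (hxbd i).2.trans_lt hi
      · exact (hxbd i).1.trans_lt hi
  have hr0 := (hbase B₀ hB₀.subset_ground).1 hB₀
  refine ⟨m + r, r, pz, l, u, hrank, hbij, hmono a hamono halt, hmono b hbmono hblt, ?_, ?_, ?_, ?_⟩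
  · intro i
    simp only [l, u]
    split_ifs with h
    · exact_mod_cast hab _
    · exact le_rfl
  · intro I hI
    rw [← matchable_comp_iff (T := intervalType l u) (hbij.injOn.mono hI)]
    constructor
    · intro h
      obtain ⟨B, h, hIB⟩ := h.exists_isBase_superset
      exact ((hbase B h.subset_ground).1 h).2.subset hIB
    · intro h
      have hIle : I.ncard ≤ B₀.ncard := by
        obtain ⟨f, hf, hfT⟩ := h
        rw [hr0.1, ← Set.InjOn.ncard_image hf, ← Nat.card_fin r, ← Set.ncard_univ,
          ← Set.ncard_image_of_injective _ (Fin.castLE_injective hr4)]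
        refine Set.ncard_le_ncard ?_ (Set.toFinite _)
        rintro _ ⟨x, hx, rfl⟩
        obtain ⟨h, -⟩ := hTr x (hI hx) _ (hfT x hx)
        exact ⟨⟨f x, h⟩, trivial, rfl⟩
      obtain ⟨B, hIB, hBE, hBc, hBm⟩ := h.exists_superset hr0.2 hfin hI hB₀.subset_ground hIle
      exact ((hbase B hBE).2 ⟨hBc.trans hr0.1, hBm⟩).indep.subset hIB
  · intro i hi
    have := hblt ⟨i, hi⟩
    simp only [l, u, hi, dite_true]
    omega
  · intro i hi
    simp [l, u, not_lt.2 hi]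

/-! ### Interval systems with a bicircular presentation -/

/-- The type function of a system of four sets. -/
def systemType (A : Fin 4 → Set ℤ) (z : ℤ) : Set (Fin 4) := {i | z ∈ A i}

/-- A system of four sets has a bicircular presentation if its partial transversals are those of
some system in which each element is in at most two of the sets. -/
def HasBicircularPresentation (A : Fin 4 → Set ℤ) : Prop :=
  ∃ T : ℤ → Set (Fin 4), (∀ z, (T z).ncard ≤ 2) ∧
    ∀ I, Matchable (systemType A) I ↔ Matchable T I

theorem ncard_le_two_of_forall_triple {S : Set (Fin 4)} (h012 : ¬ (0 ∈ S ∧ 1 ∈ S ∧ 2 ∈ S))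
    (h013 : ¬ (0 ∈ S ∧ 1 ∈ S ∧ 3 ∈ S)) (h023 : ¬ (0 ∈ S ∧ 2 ∈ S ∧ 3 ∈ S))
    (h123 : ¬ (1 ∈ S ∧ 2 ∈ S ∧ 3 ∈ S)) : S.ncard ≤ 2 := by
  classical
  have key : ∀ s : Finset (Fin 4), ¬ (0 ∈ s ∧ 1 ∈ s ∧ 2 ∈ s) → ¬ (0 ∈ s ∧ 1 ∈ s ∧ 3 ∈ s) →
      ¬ (0 ∈ s ∧ 2 ∈ s ∧ 3 ∈ s) → ¬ (1 ∈ s ∧ 2 ∈ s ∧ 3 ∈ s) → s.card ≤ 2 := by decide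
  rw [Set.ncard_eq_toFinset_card']
  apply key <;> simpa only [Set.mem_toFinset]

theorem hasBicircularPresentation_of_forall_triple {A : Fin 4 → Set ℤ}
    (h012 : ∀ z, ¬ (z ∈ A 0 ∧ z ∈ A 1 ∧ z ∈ A 2)) (h013 : ∀ z, ¬ (z ∈ A 0 ∧ z ∈ A 1 ∧ z ∈ A 3))
    (h023 : ∀ z, ¬ (z ∈ A 0 ∧ z ∈ A 2 ∧ z ∈ A 3)) (h123 : ∀ z, ¬ (z ∈ A 1 ∧ z ∈ A 2 ∧ z ∈ A 3)) :
    HasBicircularPresentation A :=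
  ⟨systemType A, fun z => ncard_le_two_of_forall_triple (h012 z) (h013 z) (h023 z) (h123 z),
    fun _ => Iff.rfl⟩

/-- Exchanging a system for one with the same partial transversals that differs by one membership. -/
theorem matchable_systemType_iff {A A' : Fin 4 → Set ℤ} {x : ℤ} {i : Fin 4} (J : Set (Fin 4))
    (hJ : J ⊆ systemType A x) (hi : A' i = insert x (A i)) (hne : ∀ j ≠ i, A' j = A j)
    (hocc : ∀ g : Fin 4 → ℤ, Set.InjOn g J → (∀ j ∈ J, g j ≠ x ∧ g j ∈ A j) →
      ∃ j ∈ J, g j ∈ A i) (I : Set ℤ) :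
    Matchable (systemType A) I ↔ Matchable (systemType A') I := by
  refine matchable_iff_of_insert_type (x := x) (i := i) J hJ ?_ ?_ hocc I
  · ext j
    by_cases hj : j = i
    · subst hj
      simp [systemType, hi]
    · simp [systemType, hne j hj, hj]
  · intro y hy
    ext j
    by_cases hj : j = i
    · subst hj
      simp [systemType, hi, hy]
    · simp [systemType, hne j hj]

theorem HasBicircularPresentation.congr {A A' : Fin 4 → Set ℤ} (h : HasBicircularPresentation A)
    (hA : ∀ I, Matchable (systemType A) I ↔ Matchable (systemType A') I) :
    HasBicircularPresentation A' := by
  obtain ⟨T, hT, h⟩ := h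
  exact ⟨T, hT, fun I => (hA I).symm.trans (h I)⟩

/-- The one-index case of `matchable_systemType_iff`: `x` can be put into `A i` or removed from it
when all other elements of some set `A j` containing `x` are in `A i`. -/
theorem matchable_systemType_iff_of_subset {A A' : Fin 4 → Set ℤ} (x : ℤ) (i j : Fin 4)
    (hj : x ∈ A j) (hi : A' i = insert x (A i)) (hne : ∀ k ≠ i, A' k = A k)
    (hsub : ∀ y ∈ A j, y ≠ x → y ∈ A i) (I : Set ℤ) :
    Matchable (systemType A) I ↔ Matchable (systemType A') I :=
  matchable_systemType_iff {j} (Set.singleton_subset_iff.2 hj) hi hne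
    (fun _ _ hg => ⟨j, rfl, hsub _ (hg j rfl).2 (hg j rfl).1⟩) I

/-- Reversing the order of the labels. -/
theorem HasBicircularPresentation.reverse {A : Fin 4 → Set ℤ}
    (h : HasBicircularPresentation fun i => Neg.neg ⁻¹' A i.rev) : HasBicircularPresentation A := by
  obtain ⟨T, hT, h⟩ := h
  have hrev : ∀ I, Matchable (systemType fun i => Neg.neg ⁻¹' A i.rev) (Neg.neg '' I) ↔
      Matchable (systemType A) I := by
    intro I
    rw [← matchable_comp_iff neg_injective.injOn]
    constructor
    · rintro ⟨f, hf, hfT⟩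
      exact ⟨fun x => (f x).rev, fun x hx y hy hxy => hf hx hy (Fin.rev_injective hxy),
        fun x hx => by simpa [systemType] using hfT x hx⟩
    · rintro ⟨f, hf, hfT⟩
      exact ⟨fun x => (f x).rev, fun x hx y hy hxy => hf hx hy (Fin.rev_injective hxy),
        fun x hx => by simpa [systemType] using hfT x hx⟩
  refine ⟨fun z => T (-z), fun z => hT _, fun I => ?_⟩
  rw [← hrev, h, ← matchable_comp_iff neg_injective.injOn]

/-- Under these conditions on the ends, the only labels of more than two intervals are `u₀` and `l₃`. They can be removed from the second and the third
interval, respectively, once these are extended to `l₀` and `u₃`. -/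
theorem hasBicircularPresentation_of_two_triples {l₀ l₁ l₂ l₃ u₀ u₁ u₂ u₃ : ℤ} (h01 : l₁ = l₀ + 1)
    (h12 : l₁ < l₂) (h2 : l₂ = u₀) (h03 : u₀ < l₃) (h3 : l₃ = u₁) (k12 : u₁ < u₂)
    (k23 : u₃ = u₂ + 1) :
    HasBicircularPresentation
      ![Set.Icc l₀ u₀, Set.Icc l₁ u₁, Set.Icc l₂ u₂, Set.Icc l₃ u₃] := by
  subst h01 h2 h3 k23
  have key : HasBicircularPresentation ![Set.Icc l₀ l₂, Set.Icc l₀ l₃ \ {l₂},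
      Set.Icc l₂ (u₂ + 1) \ {l₃}, Set.Icc l₃ (u₂ + 1)] := by
    apply hasBicircularPresentation_of_forall_triple <;> intro z <;> simp <;> omega
  have key2 : HasBicircularPresentation ![Set.Icc l₀ l₂, Set.Icc l₀ l₃,
      Set.Icc l₂ (u₂ + 1) \ {l₃}, Set.Icc l₃ (u₂ + 1)] := by
    refine key.congr (matchable_systemType_iff_of_subset l₂ 1 0 ?_ ?_ ?_ ?_)
    · simp; omega
    · ext z; simp; omega
    · intro k hk; fin_cases k <;> simp at hk ⊢
    · intro z; simp; omega
  have key3 : HasBicircularPresentation ![Set.Icc l₀ l₂, Set.Icc l₀ l₃,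
      Set.Icc l₂ (u₂ + 1), Set.Icc l₃ (u₂ + 1)] := by
    refine key2.congr (matchable_systemType_iff_of_subset l₃ 2 3 ?_ ?_ ?_ ?_)
    · simp; omega
    · ext z; simp; omega
    · intro k hk; fin_cases k <;> simp at hk ⊢
    · intro z; simp; omega
  have key4 : HasBicircularPresentation ![Set.Icc l₀ l₂, Set.Icc (l₀ + 1) l₃,
      Set.Icc l₂ (u₂ + 1), Set.Icc l₃ (u₂ + 1)] := by
    refine key3.congr fun I => (matchable_systemType_iff_of_subset l₀ 1 0 ?_ ?_ ?_ ?_ I).symm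
    · simp; omega
    · ext z; simp; omega
    · intro k hk; fin_cases k <;> simp at hk ⊢
    · intro z; simp; omega
  refine key4.congr fun I => (matchable_systemType_iff_of_subset (u₂ + 1) 2 3 ?_ ?_ ?_ ?_ I).symm
  · simp; omega
  · ext z; simp; omega
  · intro k hk; fin_cases k <;> simp at hk ⊢
  · intro z; simp; omega

/-- If the first three sets have no common label, then there is a bicircular presentation when the last
interval is disjoint from the third one, or has only the labels `l₃ = u₂` and `u₃`. In the latter case,
the third interval can be extended to `u₃` and then loses `u₂`. -/
theorem hasBicircularPresentation_of_tail {l₀ l₂ l₃ u₀ u₂ u₃ : ℤ} {S : Set ℤ}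
    (hS : ∀ z ∈ S, z ≤ u₂ ∧ ¬ (l₂ ≤ z ∧ z ≤ u₀)) (h02 : u₀ < u₂) (h22 : l₂ ≤ u₂)
    (htail : u₂ < l₃ ∨ (l₃ = u₂ ∧ u₃ = u₂ + 1)) :
    HasBicircularPresentation ![Set.Icc l₀ u₀, S, Set.Icc l₂ u₂, Set.Icc l₃ u₃] := by
  have hS1 : ∀ z ∈ S, z ≤ u₂ := fun z hz => (hS z hz).1
  have hS2 : ∀ z ∈ S, l₂ ≤ z → u₀ < z := fun z hz h => not_le.1 fun h' => (hS z hz).2 ⟨h, h'⟩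
  rcases htail with h | ⟨rfl, rfl⟩
  · apply hasBicircularPresentation_of_forall_triple <;> intro z <;>
      have h1 := hS1 z <;> have h2 := hS2 z <;> simp <;> grind
  have key : HasBicircularPresentation ![Set.Icc l₀ u₀, S, Set.Icc l₂ (l₃ + 1) \ {l₃},
      Set.Icc l₃ (l₃ + 1)] := by
    apply hasBicircularPresentation_of_forall_triple <;> intro z <;>
      have h1 := hS1 z <;> have h2 := hS2 z <;> simp <;> grind
  have key2 : HasBicircularPresentation ![Set.Icc l₀ u₀, S, Set.Icc l₂ (l₃ + 1),
      Set.Icc l₃ (l₃ + 1)] := by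
    refine key.congr (matchable_systemType_iff_of_subset l₃ 2 3 ?_ ?_ ?_ ?_)
    · simp
    · ext z; simp; omega
    · intro k hk; fin_cases k <;> simp at hk ⊢
    · intro z; simp; omega
  refine key2.congr fun I => (matchable_systemType_iff_of_subset (l₃ + 1) 2 3 ?_ ?_ ?_ ?_ I).symm
  · simp
  · ext z; simp; omega
  · intro k hk; fin_cases k <;> simp at hk ⊢
  · intro z; simp; omega

/-- A single label `u₀ = l₂` in the first three intervals can be removed from the second interval
once this is extended to `l₀`. -/
theorem hasBicircularPresentation_of_head {l₀ l₁ l₂ l₃ u₀ u₁ u₂ u₃ : ℤ} (h01 : l₁ = l₀ + 1)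
    (h12 : l₁ < l₂) (h2 : l₂ = u₀) (k01 : u₀ < u₁) (h3 : u₁ < l₃) :
    HasBicircularPresentation
      ![Set.Icc l₀ u₀, Set.Icc l₁ u₁, Set.Icc l₂ u₂, Set.Icc l₃ u₃] := by
  subst h01 h2
  have key : HasBicircularPresentation ![Set.Icc l₀ l₂, Set.Icc l₀ u₁ \ {l₂},
      Set.Icc l₂ u₂, Set.Icc l₃ u₃] := by
    apply hasBicircularPresentation_of_forall_triple <;> intro z <;> simp <;> omega
  have key2 : HasBicircularPresentation ![Set.Icc l₀ l₂, Set.Icc l₀ u₁,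
      Set.Icc l₂ u₂, Set.Icc l₃ u₃] := by
    refine key.congr (matchable_systemType_iff_of_subset l₂ 1 0 ?_ ?_ ?_ ?_)
    · simp; omega
    · ext z; simp; omega
    · intro k hk; fin_cases k <;> simp at hk ⊢
    · intro z; simp; omega
  refine key2.congr fun I => (matchable_systemType_iff_of_subset l₀ 1 0 ?_ ?_ ?_ ?_ I).symm
  · simp; omega
  · ext z; simp; omega
  · intro k hk; fin_cases k <;> simp at hk ⊢
  · intro z; simp; omega

/-- If `u₂ = u₁ + 1`, the second interval can be extended to `u₂`, after which at most two labels in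
the first three intervals can be removed from it. -/
theorem hasBicircularPresentation_of_head_of_tail {l₀ l₁ l₂ l₃ u₀ u₁ u₂ u₃ : ℤ} (h01 : l₀ < l₁)
    (h12 : l₁ < l₂) (h2 : l₂ = u₀ ∨ (l₂ + 1 = u₀ ∧ l₁ = l₀ + 1)) (k01 : u₀ < u₁)
    (k12 : u₂ = u₁ + 1) (htail : u₂ < l₃ ∨ (l₃ = u₂ ∧ u₃ = u₂ + 1)) :
    HasBicircularPresentation
      ![Set.Icc l₀ u₀, Set.Icc l₁ u₁, Set.Icc l₂ u₂, Set.Icc l₃ u₃] := by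
  subst k12
  suffices h : HasBicircularPresentation
      ![Set.Icc l₀ u₀, Set.Icc l₁ (u₁ + 1), Set.Icc l₂ (u₁ + 1), Set.Icc l₃ u₃] by
    refine h.congr fun I =>
      (matchable_systemType_iff_of_subset (u₁ + 1) 1 2 ?_ ?_ ?_ ?_ I).symm
    · simp; omega
    · ext z; simp; omega
    · intro k hk; fin_cases k <;> simp at hk ⊢
    · intro z; simp; omega
  rcases h2 with rfl | ⟨rfl, rfl⟩
  · have key : HasBicircularPresentation ![Set.Icc l₀ l₂, Set.Icc l₁ (u₁ + 1) \ {l₂},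
        Set.Icc l₂ (u₁ + 1), Set.Icc l₃ u₃] := by
      refine hasBicircularPresentation_of_tail ?_ (by omega) (by omega) htail
      intro z; simp; omega
    refine key.congr (matchable_systemType_iff_of_subset l₂ 1 2 ?_ ?_ ?_ ?_)
    · simp; omega
    · ext z; simp; omega
    · intro k hk; fin_cases k <;> simp at hk ⊢
    · intro z; simp; omega
  have key : HasBicircularPresentation ![Set.Icc l₀ (l₂ + 1),
      Set.Icc l₀ (u₁ + 1) \ {l₂, l₂ + 1}, Set.Icc l₂ (u₁ + 1), Set.Icc l₃ u₃] := by
    refine hasBicircularPresentation_of_tail ?_ (by omega) (by omega) htail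
    intro z; simp; omega
  have key2 : HasBicircularPresentation ![Set.Icc l₀ (l₂ + 1),
      Set.Icc l₀ (u₁ + 1) \ {l₂ + 1}, Set.Icc l₂ (u₁ + 1), Set.Icc l₃ u₃] := by
    -- of two labels that represent the first and the third interval, only one can be `l₂ + 1`
    refine key.congr (matchable_systemType_iff (x := l₂) (i := 1) {0, 2} ?_ ?_ ?_ ?_)
    · intro j
      simp only [Set.mem_insert_iff, Set.mem_singleton_iff]
      rintro (rfl | rfl) <;> simp [systemType] <;> omega
    · ext z; simp; omega
    · intro k hk; fin_cases k <;> simp at hk ⊢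
    · intro g hg hgA
      have h0 := hgA 0 (by simp)
      have h2 := hgA 2 (by simp)
      have hne : g 0 ≠ g 2 := fun h => absurd (hg (by simp) (by simp) h) (by decide)
      simp at h0 h2
      by_cases hg0 : g 0 = l₂ + 1
      · exact ⟨2, by simp, by simp; omega⟩
      · exact ⟨0, by simp, by simp; omega⟩
  have key3 : HasBicircularPresentation ![Set.Icc l₀ (l₂ + 1),
      Set.Icc l₀ (u₁ + 1), Set.Icc l₂ (u₁ + 1), Set.Icc l₃ u₃] := by
    refine key2.congr (matchable_systemType_iff_of_subset (l₂ + 1) 1 0 ?_ ?_ ?_ ?_)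
    · simp; omega
    · ext z; simp; omega
    · intro k hk; fin_cases k <;> simp at hk ⊢
    · intro z; simp; omega
  refine key3.congr fun I => (matchable_systemType_iff_of_subset l₀ 1 0 ?_ ?_ ?_ ?_ I).symm
  · simp; omega
  · ext z; simp; omega
  · intro k hk; fin_cases k <;> simp at hk ⊢
  · intro z; simp; omega

/-- The numerical conditions under which four intervals contain the obstruction of rank four that has
a circuit-hyperplane or a parallel pair at the left end. -/
def HasLeftObstruction (l u : Fin 4 → ℤ) : Prop :=
  l 2 ≤ u 0 ∧ u 0 < l 3 ∧ l 3 ≤ u 1 ∧ (l 2 + 1 ≤ u 0 ∨ l 0 + 2 ≤ l 1)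

/-- The numerical conditions under which four intervals, whose last one is disjoint from the first two,
contain an obstruction of rank three after contraction of an element of the last interval. -/
def HasContractedObstruction (l u : Fin 4 → ℤ) : Prop :=
  l 2 ≤ u 0 ∧ u 1 < l 3 ∧
    (l 2 + 2 ≤ u 0 ∨
      l 2 + 1 ≤ u 0 ∧ (l 0 + 2 ≤ l 1 ∨ u 1 + 2 ≤ u 2 ∨ l 3 ≤ u 2 ∧ u 2 + 2 ≤ u 3) ∨
      l 0 + 2 ≤ l 1 ∧ (u 1 + 2 ≤ u 2 ∨ l 3 ≤ u 2 ∧ u 2 + 2 ≤ u 3))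

/-- If `l` lists the left ends of four intervals, `reverseEnds l` lists the right ends of the intervals
that the reflection `z ↦ -z` makes of them, in increasing order; and with left and right exchanged. -/
def reverseEnds (l : Fin 4 → ℤ) (i : Fin 4) : ℤ := -l i.rev

/-- The case that no label of the last interval is in more than two of the intervals. -/
theorem hasBicircularPresentation_of_disjoint {l u : Fin 4 → ℤ} (hl : StrictMono l)
    (hu : StrictMono u) (h : u 1 < l 3) (hno : ¬ HasContractedObstruction l u) :
    HasBicircularPresentation fun i => Set.Icc (l i) (u i) := by
  have hA : (fun i => Set.Icc (l i) (u i)) = ![Set.Icc (l 0) (u 0), Set.Icc (l 1) (u 1),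
      Set.Icc (l 2) (u 2), Set.Icc (l 3) (u 3)] := by
    ext i; fin_cases i <;> rfl
  have l01 : l 0 < l 1 := hl (by decide)
  have l12 : l 1 < l 2 := hl (by decide)
  have l23 : l 2 < l 3 := hl (by decide)
  have u01 : u 0 < u 1 := hu (by decide)
  have u12 : u 1 < u 2 := hu (by decide)
  have u23 : u 2 < u 3 := hu (by decide)
  rw [hA]
  unfold HasContractedObstruction at hno
  by_cases h2 : l 2 ≤ u 0
  swap
  · apply hasBicircularPresentation_of_forall_triple <;> intro z <;> simp <;> omega
  by_cases h1 : l 1 = l 0 + 1 ∧ l 2 = u 0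
  · exact hasBicircularPresentation_of_head h1.1 l12 h1.2 u01 h
  · exact hasBicircularPresentation_of_head_of_tail l01 l12 (by omega) u01 (by omega) (by omega)

/-- Four intervals have a bicircular presentation unless the first and the last one meet, or one of
the obstructions occurs at one of the two ends. -/
theorem hasBicircularPresentation_or_obstruction {l u : Fin 4 → ℤ} (hl : StrictMono l)
    (hu : StrictMono u) : HasBicircularPresentation (fun i => Set.Icc (l i) (u i)) ∨ l 3 ≤ u 0 ∨
      HasLeftObstruction l u ∨ HasLeftObstruction (reverseEnds u) (reverseEnds l) ∨
      HasContractedObstruction l u ∨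
      HasContractedObstruction (reverseEnds u) (reverseEnds l) := by
  by_contra! hcon
  obtain ⟨h, h03, h1, h1', h2, h2'⟩ := hcon
  have hrl : StrictMono (reverseEnds l) := fun i j hij => neg_lt_neg (hl (Fin.rev_lt_rev.2 hij))
  have hru : StrictMono (reverseEnds u) := fun i j hij => neg_lt_neg (hu (Fin.rev_lt_rev.2 hij))
  have h13 : l 3 ≤ u 1 := not_lt.1 fun h' => h (hasBicircularPresentation_of_disjoint hl hu h' h2)
  have h02 : l 2 ≤ u 0 := by
    by_contra h'
    refine h (HasBicircularPresentation.reverse ?_)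
    convert hasBicircularPresentation_of_disjoint hru hrl ?_ h2' using 2 with i
    · ext z
      simp [reverseEnds]
    · change -l 2 < -u 0
      omega
  have l01 : l 0 < l 1 := hl (by decide)
  have l12 : l 1 < l 2 := hl (by decide)
  have u12 : u 1 < u 2 := hu (by decide)
  have u23 : u 2 < u 3 := hu (by decide)
  unfold HasLeftObstruction at h1 h1'
  have hrev : ∀ a : Fin 4 → ℤ, reverseEnds a 0 = -a 3 ∧ reverseEnds a 1 = -a 2 ∧
      reverseEnds a 2 = -a 1 ∧ reverseEnds a 3 = -a 0 := fun a => ⟨rfl, rfl, rfl, rfl⟩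
  obtain ⟨hl0, hl1, hl2, hl3⟩ := hrev l
  obtain ⟨hu0, hu1, hu2, hu3⟩ := hrev u
  rw [hl0, hl1, hu0, hu1, hu2, hu3] at h1'
  have hA : (fun i => Set.Icc (l i) (u i)) = ![Set.Icc (l 0) (u 0), Set.Icc (l 1) (u 1),
      Set.Icc (l 2) (u 2), Set.Icc (l 3) (u 3)] := by
    ext i; fin_cases i <;> rfl
  refine h (hA ▸ hasBicircularPresentation_of_two_triples (by omega) l12 (by omega) (by omega)
    (by omega) u12 (by omega))

variable {α : Type*}

theorem IntervalPresentation.isBicircular {M : Matroid α} {n r : ℕ} {p : α → ℤ}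
    {l u : Fin 4 → ℤ} (h : M.IntervalPresentation n r p l u)
    (hb : HasBicircularPresentation fun i => Set.Icc (l i) (u i)) : M.IsBicircular := by
  obtain ⟨T, hT, hb⟩ := hb
  have hfin : M.E.Finite := Set.Finite.of_finite_image
    ((Set.finite_Ico _ _).subset h.bijOn.mapsTo.image_subset) h.bijOn.injOn
  refine isBicircular_iff.2 ⟨hfin, 3, fun x => T (p x), fun x => hT _, fun I hI => ?_⟩
  rw [matchable_comp_iff (h.bijOn.injOn.mono hI), ← hb, h.indep_iff I hI]
  rfl

theorem IntervalPresentation.ncard_ground {M : Matroid α} {n r : ℕ} {p : α → ℤ}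
    {l u : Fin 4 → ℤ} (h : M.IntervalPresentation n r p l u) : M.E.ncard = n := by
  rw [← Set.InjOn.ncard_image h.bijOn.injOn, h.bijOn.image_eq, ← Finset.coe_Ico,
    Set.ncard_coe_finset, Int.card_Ico]
  simp

/-- Each of the obstructions uses seven labels. -/
theorem IsLatticePath.isBicircular_of_ncard_le_six {M : Matroid α} (hM : M.IsLatticePath)
    (hr : M.eRank ≤ 4) (hE : M.E.ncard ≤ 6) : M.IsBicircular := by
  obtain ⟨n, r, p, l, u, -, h⟩ := hM.exists_intervalPresentation hr
  rw [h.ncard_ground] at hE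
  refine h.isBicircular ((hasBicircularPresentation_or_obstruction h.strictMono_left
    h.strictMono_right).resolve_right fun hob => ?_)
  have l01 : l 0 < l 1 := h.strictMono_left (by decide)
  have l12 : l 1 < l 2 := h.strictMono_left (by decide)
  have l23 : l 2 < l 3 := h.strictMono_left (by decide)
  have u01 : u 0 < u 1 := h.strictMono_right (by decide)
  have u12 : u 1 < u 2 := h.strictMono_right (by decide)
  have u23 : u 2 < u 3 := h.strictMono_right (by decide)
  have hrev : ∀ a : Fin 4 → ℤ, reverseEnds a 0 = -a 3 ∧ reverseEnds a 1 = -a 2 ∧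
      reverseEnds a 2 = -a 1 ∧ reverseEnds a 3 = -a 0 := fun a => ⟨rfl, rfl, rfl, rfl⟩
  obtain ⟨hl0, hl1, hl2, hl3⟩ := hrev l
  obtain ⟨hu0, hu1, hu2, hu3⟩ := hrev u
  have m0 := h.mem_of_lt 0
  have m1 := h.mem_of_lt 1
  have m2 := h.mem_of_lt 2
  have m3 := h.mem_of_lt 3
  have e0 := h.eq_of_le 0
  have e1 := h.eq_of_le 1
  have e2 := h.eq_of_le 2
  have e3 := h.eq_of_le 3
  simp only [HasLeftObstruction, HasContractedObstruction, hl0, hl1, hl2, hl3, hu0, hu1, hu2,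
    hu3] at hob
  simp only [Fin.val_zero, Fin.val_one, Fin.val_two, show ((3 : Fin 4) : ℕ) = 3 from rfl]
    at m0 m1 m2 m3 e0 e1 e2 e3
  obtain hr | hr | hr : 4 ≤ r ∨ r = 3 ∨ r ≤ 2 := by omega
  · have := m0 (by omega)
    have := m3 (by omega)
    omega
  · have := m0 (by omega)
    have := m2 (by omega)
    have := e3 (by omega)
    omega
  · have := e2 (by omega)
    have := e3 (by omega)
    have : u 0 ≤ n := by
      by_cases h0 : 0 < r
      · have := m0 h0; omega
      · have := e0 (by omega); omega
    have : u 1 ≤ n + 1 := by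
      by_cases h0 : 1 < r
      · have := m1 h0; omega
      · have := e1 (by omega); omega
    omega

/-! ### Seven elements that prevent a matroid from being bicircular -/

/-- The elements `x 0, ..., x 6` of `M` are distinct, and the independent sets among them are those with
at most `k` elements that include no member of `𝒟`. Here `k` is the rank and `𝒟` the set of nonspanning
circuits of the restriction of `M` to these elements. -/
def IsSevenPattern (M : Matroid α) (k : ℕ) (𝒟 : Set (Finset (Fin 7))) (x : Fin 7 → α) : Prop :=
  Function.Injective x ∧ Set.range x ⊆ M.E ∧
    ∀ B : Finset (Fin 7), M.Indep (x '' B) ↔ B.card ≤ k ∧ ∀ D ∈ 𝒟, ¬ D ⊆ B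

/-- In a bicircular matroid, seven elements give seven sets of at most two vertices. -/
theorem IsBicircular.exists_finset_type {M : Matroid α} (hM : M.IsBicircular) {k : ℕ}
    {𝒟 : Set (Finset (Fin 7))} {x : Fin 7 → α} (hx : M.IsSevenPattern k 𝒟 x) :
    ∃ (n : ℕ) (T : Fin 7 → Finset (Fin (n + 1))), (∀ i, (T i).card ≤ 2) ∧
      ∀ B : Finset (Fin 7), Matchable (fun i => (T i : Set (Fin (n + 1)))) (B : Set (Fin 7)) ↔
        B.card ≤ k ∧ ∀ D ∈ 𝒟, ¬ D ⊆ B := by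
  classical
  obtain ⟨-, n, T, hT, hI⟩ := isBicircular_iff.1 hM
  refine ⟨n, fun i => (T (x i)).toFinset, fun i => ?_, fun B => ?_⟩
  · rw [← Set.ncard_eq_toFinset_card']
    exact hT _
  · rw [← hx.2.2, hI _ ((Set.image_subset_range _ _).trans hx.2.1),
      ← matchable_comp_iff hx.1.injOn]
    simp

section Counting

variable {ι : Type*} {T : Fin 7 → Finset ι} {k : ℕ}

/-- The sum of the degrees of some vertices. -/
theorem sum_card_filter_mem_le [DecidableEq ι] (T : Fin 7 → Finset ι) (W : Finset ι) :
    ∑ v ∈ W, (Finset.univ.filter fun i => v ∈ T i).card ≤ ∑ i, (T i).card := by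
  simp_rw [Finset.card_filter]
  rw [Finset.sum_comm]
  refine Finset.sum_le_sum fun i _ => ?_
  rw [← Finset.card_filter]
  refine Finset.card_le_card fun v hv => ?_
  exact (Finset.mem_filter.1 hv).2

/-- The elements avoiding a vertex `v` do not span any element at `v`. -/
theorem not_matchable_of_disjoint (hdep : ∀ B : Finset (Fin 7), B.card = k + 1 →
      ¬ Matchable (fun i => (T i : Set ι)) (B : Set (Fin 7)))
    {v : ι} {i : Fin 7} (hi : v ∈ T i) {B : Finset (Fin 7)} (hB : B.card = k)
    (hBv : ∀ j ∈ B, v ∉ T j) : ¬ Matchable (fun i => (T i : Set ι)) (B : Set (Fin 7)) := by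
  rintro ⟨f, hf, hfT⟩
  refine hdep (insert i B) ?_ ?_
  · rw [Finset.card_insert_of_notMem (fun h => hBv i h hi), hB]
  · rw [Finset.coe_insert]
    refine Matchable.insert_of_forall_ne hf hfT hi ?_
    rintro j hj rfl
    exact hBv j hj (hfT j hj)

/-- If the `k`-element subsets of `S` that avoid a vertex `v` are independent, then there are none, and
fewer than `k` elements of `S` avoid `v`. -/
theorem lt_card_filter_of_forall [DecidableEq ι]
    (hdep : ∀ B : Finset (Fin 7), B.card = k + 1 →
      ¬ Matchable (fun i => (T i : Set ι)) (B : Set (Fin 7)))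
    {v : ι} {i : Fin 7} (hi : v ∈ T i) (S : Finset (Fin 7))
    (hS : ∀ B ⊆ S, B.card = k → (∀ j ∈ B, v ∉ T j) →
      Matchable (fun i => (T i : Set ι)) (B : Set (Fin 7))) :
    S.card < k + (Finset.univ.filter fun i => v ∈ T i).card := by
  by_contra! hlt
  have h : k ≤ (S.filter fun j => v ∉ T j).card := by
    have h1 := Finset.card_filter_add_card_filter_not (s := S) fun j => v ∈ T j
    have h2 : (S.filter fun j => v ∈ T j).card ≤ (Finset.univ.filter fun i => v ∈ T i).card :=
      Finset.card_le_card (Finset.filter_subset_filter _ (Finset.subset_univ _))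
    omega
  obtain ⟨B, hBS, hB⟩ := Finset.exists_subset_card_eq h
  have hBv : ∀ j ∈ B, v ∉ T j := fun j hj => (Finset.mem_filter.1 (hBS hj)).2
  exact not_matchable_of_disjoint hdep hi hB hBv
    (hS B (hBS.trans (Finset.filter_subset _ _)) hB hBv)

/-- The vertices that a matching of `B` uses. -/
theorem Matchable.exists_finset_image {B : Finset (Fin 7)}
    (hB : Matchable (fun i => (T i : Set ι)) (B : Set (Fin 7))) :
    ∃ W : Finset ι, W.card = B.card ∧ (∀ v ∈ W, ∃ i ∈ B, v ∈ T i) ∧ ∀ i ∈ B, ∃ v ∈ W, v ∈ T i := by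
  classical
  obtain ⟨f, hf, hfT⟩ := hB
  refine ⟨B.image f, Finset.card_image_of_injOn hf, fun v hv => ?_, fun i hi => ?_⟩
  · obtain ⟨i, hi, rfl⟩ := Finset.mem_image.1 hv
    exact ⟨i, hi, hfT i hi⟩
  · exact ⟨f i, Finset.mem_image_of_mem f hi, hfT i hi⟩

/-- Parallel elements have a common single vertex. -/
theorem exists_eq_singleton_of_not_matchable_pair {a b : Fin 7} (ha : (T a).Nonempty)
    (hb : (T b).Nonempty) (hab : ¬ Matchable (fun i => (T i : Set ι)) {a, b}) :
    ∃ v, T a = {v} ∧ T b = {v} := by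
  have h : ∀ v ∈ T a, ∀ w ∈ T b, v = w := by
    intro v hv w hw
    by_contra hne
    exact hab (Matchable.insert_of_forall_ne (f := fun _ => w) (by simp) (by simpa using hw) hv
      (by simpa using Ne.symm hne))
  obtain ⟨v, hv⟩ := ha
  obtain ⟨w, hw⟩ := hb
  obtain rfl := h v hv w hw
  exact ⟨v, Finset.eq_singleton_iff_unique_mem.2 ⟨hv, fun w hw' => h w hw' v hw⟩,
    Finset.eq_singleton_iff_unique_mem.2 ⟨hw, fun w hw' => (h v hv w hw').symm⟩⟩

end Counting

/-- `U_{3,7}` and `U_{4,7}` are not bicircular: at least `k` vertices are used, and each of them is an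
endpoint of at least `8 - k` of the seven edges, but `k * (8 - k) > 14`. -/
theorem IsSevenPattern.not_isBicircular_of_empty {M : Matroid α} {k : ℕ} {x : Fin 7 → α}
    (hx : M.IsSevenPattern k ∅ x) (hk : k = 3 ∨ k = 4) : ¬ M.IsBicircular := by
  classical
  intro hM
  obtain ⟨n, T, hT2, hT⟩ := hM.exists_finset_type hx
  have hdep : ∀ B : Finset (Fin 7), B.card = k + 1 →
      ¬ Matchable (fun i => (T i : Set (Fin (n + 1)))) (B : Set (Fin 7)) := fun B hB h => by
    have := ((hT B).1 h).1
    omega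
  obtain ⟨B, -, hB⟩ := Finset.exists_subset_card_eq
    (show k ≤ (Finset.univ : Finset (Fin 7)).card by simp; omega)
  obtain ⟨W, hWc, hW, -⟩ := ((hT B).2 ⟨hB.le, by simp⟩).exists_finset_image
  have hcount : ∀ v ∈ W, 8 - k ≤ (Finset.univ.filter fun i => v ∈ T i).card := by
    intro v hv
    obtain ⟨i, -, hi⟩ := hW v hv
    have := lt_card_filter_of_forall hdep hi Finset.univ
      fun B _ hB _ => (hT B).2 ⟨hB.le, by simp⟩
    simp only [Finset.card_univ, Fintype.card_fin] at this
    omega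
  have h1 := (Finset.sum_le_sum hcount).trans ((sum_card_filter_mem_le T W).trans
    (Finset.sum_le_sum fun i _ => hT2 i))
  simp only [Finset.sum_const, hWc, hB, Finset.card_univ, Fintype.card_fin, smul_eq_mul] at h1
  rcases hk with rfl | rfl <;> omega

/-- With a circuit-hyperplane `{0, 1, 2, 3}`, a vertex has degree three at least, and degree three
only if its edges are `4, 5, 6`. No two vertices have these same three edges, since these would
be three independent edges on two vertices. -/
theorem IsSevenPattern.not_isBicircular_of_hyperplane {M : Matroid α} {x : Fin 7 → α}
    (hx : M.IsSevenPattern 4 {{0, 1, 2, 3}} x) : ¬ M.IsBicircular := by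
  classical
  intro hM
  obtain ⟨n, T, hT2, hT⟩ := hM.exists_finset_type hx
  simp only [Set.mem_singleton_iff, forall_eq] at hT
  have hdep : ∀ B : Finset (Fin 7), B.card = 4 + 1 →
      ¬ Matchable (fun i => (T i : Set (Fin (n + 1)))) (B : Set (Fin 7)) := fun B hB h => by
    have := ((hT B).1 h).1
    omega
  obtain ⟨W, hWc, hW, -⟩ := ((hT {0, 4, 5, 6}).2 (by decide)).exists_finset_image
  have hcount : ∀ v ∈ W, 3 ≤ (Finset.univ.filter fun i => v ∈ T i).card ∧
      ((Finset.univ.filter fun i => v ∈ T i).card = 3 → v ∈ T 4 ∧ v ∈ T 5 ∧ v ∈ T 6) := by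
    intro v hv
    obtain ⟨i, -, hi⟩ := hW v hv
    have h1 := fun j (hj : j ∈ ({0, 1, 2, 3} : Finset (Fin 7))) =>
      lt_card_filter_of_forall hdep hi (Finset.univ.erase j)
        fun B hBj hB _ => (hT B).2 ⟨hB.le, fun h => Finset.notMem_erase _ _ (hBj (h hj))⟩
    have h2 := h1 0 (by decide)
    simp only [Finset.mem_univ, Finset.card_erase_of_mem, Finset.card_univ,
      Fintype.card_fin] at h2
    refine ⟨by omega, fun h3 => ?_⟩
    have hmem : ∀ j, j ∉ ({0, 1, 2, 3} : Finset (Fin 7)) → v ∈ T j := by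
      intro j hj
      by_contra hvj
      -- otherwise four elements, including `j`, avoid `v`
      have hc : (Finset.univ.filter fun i => v ∉ T i).card = 4 := by
        have := Finset.card_filter_add_card_filter_not (s := (Finset.univ : Finset (Fin 7)))
          fun j => v ∈ T j
        simp only [Finset.card_univ, Fintype.card_fin] at this
        omega
      refine not_matchable_of_disjoint hdep hi hc (fun j hj => (Finset.mem_filter.1 hj).2)
        ((hT _).2 ⟨hc.le, fun hsub => hj ?_⟩)
      rw [Finset.eq_of_subset_of_card_le hsub (by rw [hc]; decide)]
      simpa using hvj
    exact ⟨hmem 4 (by decide), hmem 5 (by decide), hmem 6 (by decide)⟩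
  have hone : (W.filter fun v => (Finset.univ.filter fun i => v ∈ T i).card = 3).card ≤ 1 := by
    refine Finset.card_le_one.2 fun v hv w hw => ?_
    rw [Finset.mem_filter] at hv hw
    by_contra hne
    have hv3 := (hcount v hv.1).2 hv.2
    have hw3 := (hcount w hw.1).2 hw.2
    have hsub : ∀ i, v ∈ T i → w ∈ T i → T i ⊆ {v, w} := by
      intro i hvi hwi
      refine (Finset.eq_of_subset_of_card_le (t := T i) (s := {v, w}) ?_ ?_).superset
      · simp [Finset.insert_subset_iff, hvi, hwi]
      · rw [Finset.card_pair hne]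
        exact hT2 i
    have hm := (hT {4, 5, 6}).2 (by decide)
    have := hm.card_le (W := {v, w}) (by
      intro i hi
      simp only [Finset.mem_insert, Finset.mem_singleton] at hi
      rw [Finset.coe_subset]
      rcases hi with rfl | rfl | rfl
      · exact hsub _ hv3.1 hw3.1
      · exact hsub _ hv3.2.1 hw3.2.1
      · exact hsub _ hv3.2.2 hw3.2.2)
    rw [Finset.card_pair hne] at this
    revert this
    decide
  have hlow : ∀ v ∈ W, 4 ≤ (Finset.univ.filter fun i => v ∈ T i).card +
      (if (Finset.univ.filter fun i => v ∈ T i).card = 3 then 1 else 0) := by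
    intro v hv
    have := (hcount v hv).1
    split_ifs <;> omega
  have h1 := Finset.sum_le_sum hlow
  rw [Finset.sum_add_distrib, ← Finset.card_filter] at h1
  have h2 := (sum_card_filter_mem_le T W).trans (Finset.sum_le_sum fun i _ => hT2 i)
  have h4 : W.card = 4 := hWc.trans (by decide)
  simp only [Finset.sum_const, h4, Finset.card_univ, Fintype.card_fin, smul_eq_mul] at h1 h2
  omega

/-- Two parallel edges are loops at the same vertex `v`, so that there are at most `12` pairs of an
edge and an endpoint. But the degree of `v` is at least `8 - k`, and the other vertices have degree
`7 - k` at least. -/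
theorem IsSevenPattern.not_isBicircular_of_pair {M : Matroid α} {k : ℕ} {x : Fin 7 → α}
    {a b : Fin 7} (hab : a ≠ b) (hx : M.IsSevenPattern k {{a, b}} x) (hk : k = 3 ∨ k = 4) :
    ¬ M.IsBicircular := by
  classical
  intro hM
  obtain ⟨n, T, hT2, hT⟩ := hM.exists_finset_type hx
  simp only [Set.mem_singleton_iff, forall_eq] at hT
  have hdep : ∀ B : Finset (Fin 7), B.card = k + 1 →
      ¬ Matchable (fun i => (T i : Set (Fin (n + 1)))) (B : Set (Fin 7)) := fun B hB h => by
    have := ((hT B).1 h).1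
    omega
  have hne : ∀ i, (T i).Nonempty := fun i => by
    obtain ⟨f, -, hf⟩ := (hT {i}).2 ⟨by simp; omega, fun h => hab (by
      have h1 := h (show a ∈ {a, b} by simp)
      have h2 := h (show b ∈ {a, b} by simp)
      simp only [Finset.mem_singleton] at h1 h2
      rw [h1, h2])⟩
    exact ⟨_, hf i (by simp)⟩
  obtain ⟨v, hav, hbv⟩ := exists_eq_singleton_of_not_matchable_pair (hne a) (hne b) (by
    have := mt (hT {a, b}).1 (fun h => h.2 subset_rfl)
    rwa [Finset.coe_pair] at this)
  obtain ⟨B, haB, hBb, hB⟩ := Finset.exists_subsuperset_card_eq (n := k)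
    (show {a} ⊆ Finset.univ.erase b by simpa using hab) (by simp; omega) (by simp; omega)
  obtain ⟨W, hWc, hW, hWB⟩ := ((hT B).2 ⟨hB.le, fun h =>
    Finset.notMem_erase b _ (hBb (h (by simp)))⟩).exists_finset_image
  have hvW : v ∈ W := by
    obtain ⟨w, hw, hwa⟩ := hWB a (haB (by simp))
    rw [hav, Finset.mem_singleton] at hwa
    exact hwa ▸ hw
  have hcount : ∀ w ∈ W, 7 - k + (if v = w then 1 else 0) ≤
      (Finset.univ.filter fun i => w ∈ T i).card := by
    intro w hw
    obtain ⟨i, -, hi⟩ := hW w hw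
    split_ifs with hvw
    · subst hvw
      have := lt_card_filter_of_forall hdep hi Finset.univ fun B _ hB hBv =>
        (hT B).2 ⟨hB.le, fun h => hBv a (h (by simp)) (by simp [hav])⟩
      simp only [Finset.card_univ, Fintype.card_fin] at this
      omega
    · have := lt_card_filter_of_forall hdep hi (Finset.univ.erase a) fun B hBa hB _ =>
        (hT B).2 ⟨hB.le, fun h => Finset.notMem_erase a _ (hBa (h (by simp)))⟩
      simp only [Finset.mem_univ, Finset.card_erase_of_mem, Finset.card_univ,
        Fintype.card_fin] at this
      omega
  have h1 := (Finset.sum_le_sum hcount).trans (sum_card_filter_mem_le T W)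
  rw [Finset.sum_add_distrib, Finset.sum_ite_eq, if_pos hvW] at h1
  have h2 : ∀ i ∈ Finset.univ, (T i).card + (if i ∈ ({a, b} : Finset _) then 1 else 0) ≤ 2 := by
    intro i _
    have := hT2 i
    split_ifs with hi
    · simp only [Finset.mem_insert, Finset.mem_singleton] at hi
      rcases hi with rfl | rfl
      · simp [hav]
      · simp [hbv]
    · omega
  have h3 := Finset.sum_le_sum h2
  rw [Finset.sum_add_distrib, ← Finset.card_filter, Finset.filter_mem_eq_inter,
    Finset.univ_inter, Finset.card_pair hab] at h3
  simp only [Finset.sum_const, hWc, hB, Finset.card_univ, Fintype.card_fin, smul_eq_mul] at h1 h3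
  rcases hk with rfl | rfl <;> omega

/-- In rank three with two parallel pairs, the loops leave at most `10` pairs of an edge and an
endpoint. But the two vertices with loops have degree at least four, and a third vertex has degree
at least three. -/
theorem IsSevenPattern.not_isBicircular_of_two_pairs {M : Matroid α} {x : Fin 7 → α}
    (hx : M.IsSevenPattern 3 {{0, 1}, {5, 6}} x) : ¬ M.IsBicircular := by
  classical
  intro hM
  obtain ⟨n, T, hT2, hT⟩ := hM.exists_finset_type hx
  simp only [Set.mem_insert_iff, Set.mem_singleton_iff, forall_eq_or_imp, forall_eq] at hT
  have hdep : ∀ B : Finset (Fin 7), B.card = 3 + 1 →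
      ¬ Matchable (fun i => (T i : Set (Fin (n + 1)))) (B : Set (Fin 7)) := fun B hB h => by
    have := ((hT B).1 h).1
    omega
  have hne : ∀ i, (T i).Nonempty := fun i => by
    obtain ⟨f, -, hf⟩ := (hT {i}).2 (by revert i; decide)
    exact ⟨_, hf i (by simp)⟩
  obtain ⟨v, h0, h1⟩ := exists_eq_singleton_of_not_matchable_pair (hne 0) (hne 1) (by
    have := mt (hT {0, 1}).1 (by decide)
    rwa [Finset.coe_pair] at this)
  obtain ⟨w, h5, h6⟩ := exists_eq_singleton_of_not_matchable_pair (hne 5) (hne 6) (by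
    have := mt (hT {5, 6}).1 (by decide)
    rwa [Finset.coe_pair] at this)
  obtain ⟨W, hWc, hW, hWB⟩ := ((hT {0, 2, 5}).2 (by decide)).exists_finset_image
  have hvW : v ∈ W := by
    obtain ⟨z, hz, hz0⟩ := hWB 0 (by decide)
    rw [h0, Finset.mem_singleton] at hz0
    exact hz0 ▸ hz
  have hwW : w ∈ W := by
    obtain ⟨z, hz, hz5⟩ := hWB 5 (by decide)
    rw [h5, Finset.mem_singleton] at hz5
    exact hz5 ▸ hz
  have hcount : ∀ z ∈ W, 3 + (if z ∈ ({v, w} : Finset _) then 1 else 0) ≤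
      (Finset.univ.filter fun i => z ∈ T i).card := by
    intro z hz
    obtain ⟨i, -, hi⟩ := hW z hz
    split_ifs with hzvw
    · simp only [Finset.mem_insert, Finset.mem_singleton] at hzvw
      rcases hzvw with rfl | rfl
      · have := lt_card_filter_of_forall hdep hi (Finset.univ.erase 5) fun B hB5 hB hBv =>
          (hT B).2 ⟨hB.le, fun h => hBv 0 (h (by decide)) (by simp [h0]),
            fun h => Finset.notMem_erase _ _ (hB5 (h (by decide)))⟩
        simp only [Finset.mem_univ, Finset.card_erase_of_mem, Finset.card_univ,
          Fintype.card_fin] at this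
        omega
      · have := lt_card_filter_of_forall hdep hi (Finset.univ.erase 0) fun B hB0 hB hBv =>
          (hT B).2 ⟨hB.le, fun h => Finset.notMem_erase _ _ (hB0 (h (by decide))),
            fun h => hBv 5 (h (by decide)) (by simp [h5])⟩
        simp only [Finset.mem_univ, Finset.card_erase_of_mem, Finset.card_univ,
          Fintype.card_fin] at this
        omega
    · have := lt_card_filter_of_forall hdep hi {0, 2, 3, 4, 5} fun B hBS hB _ =>
        (hT B).2 ⟨hB.le, fun h => absurd (hBS (h (show (1 : Fin 7) ∈ _ by decide))) (by decide),
          fun h => absurd (hBS (h (show (6 : Fin 7) ∈ _ by decide))) (by decide)⟩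
      rw [show ({0, 2, 3, 4, 5} : Finset (Fin 7)).card = 5 from rfl] at this
      omega
  have hvw : v ≠ w := by
    rintro rfl
    have := ((hT {0, 5}).2 (by decide)).card_le (W := {v}) (by
      intro i hi
      simp only [Finset.mem_insert, Finset.mem_singleton] at hi
      rcases hi with rfl | rfl
      · rw [h0]
      · rw [h5])
    revert this
    simp
  have hs1 := (Finset.sum_le_sum hcount).trans (sum_card_filter_mem_le T W)
  rw [Finset.sum_add_distrib, ← Finset.card_filter, Finset.filter_mem_eq_inter,
    Finset.inter_eq_right.2 (by simp [Finset.insert_subset_iff, hvW, hwW]),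
    Finset.card_pair hvw] at hs1
  have h2 : ∀ i ∈ Finset.univ, (T i).card + (if i ∈ ({0, 1, 5, 6} : Finset _) then 1 else 0) ≤
      2 := by
    intro i _
    have := hT2 i
    split_ifs with hi
    · simp only [Finset.mem_insert, Finset.mem_singleton] at hi
      rcases hi with rfl | rfl | rfl | rfl <;> simp [h0, h1, h5, h6]
    · omega
  have hs2 := Finset.sum_le_sum h2
  rw [Finset.sum_add_distrib, ← Finset.card_filter, Finset.filter_mem_eq_inter,
    Finset.univ_inter] at hs2
  have h3 : W.card = 3 := hWc.trans (by decide)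
  rw [show ({0, 1, 5, 6} : Finset (Fin 7)).card = 4 from rfl] at hs2
  simp only [Finset.sum_const, h3, Finset.card_univ, Fintype.card_fin, smul_eq_mul] at hs1 hs2
  omega

/-! ### Finding the seven elements in an interval presentation -/

/-- To show that independence means having at most `k` elements and including no member of `𝒟`, it is
enough to consider sets of size `k`, if all smaller sets without members of `𝒟` can be enlarged. -/
theorem iff_card_le_and_forall_not_subset {P : Finset (Fin 7) → Prop} {k : ℕ}
    {𝒟 : Set (Finset (Fin 7))} (hmono : ∀ B C, B ⊆ C → P C → P B) (hcard : ∀ B, P B → B.card ≤ k)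
    (hD : ∀ D ∈ 𝒟, ¬ P D) (hext : ∀ B : Finset (Fin 7), B.card < k → (∀ D ∈ 𝒟, ¬ D ⊆ B) →
      ∃ i ∉ B, ∀ D ∈ 𝒟, ¬ D ⊆ insert i B)
    (hfull : ∀ B : Finset (Fin 7), B.card = k → (∀ D ∈ 𝒟, ¬ D ⊆ B) → P B) (B : Finset (Fin 7)) :
    P B ↔ B.card ≤ k ∧ ∀ D ∈ 𝒟, ¬ D ⊆ B := by
  refine ⟨fun h => ⟨hcard B h, fun D hDm hDB => hD D hDm (hmono _ _ hDB h)⟩, ?_⟩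
  rintro ⟨hB, hBD⟩
  induction hn : k - B.card generalizing B with
  | zero => exact hfull B (by omega) hBD
  | succ m ih =>
    obtain ⟨i, hi, hiD⟩ := hext B (by omega) hBD
    have hc := Finset.card_insert_of_notMem hi
    exact hmono _ _ (Finset.subset_insert i B) (ih _ (by omega) hiD (by omega))

theorem exists_lt_of_card_eq_four {B : Finset (Fin 7)} (hB : B.card = 4) :
    ∃ a b c d, a < b ∧ b < c ∧ c < d ∧ B = {a, b, c, d} := by
  refine ⟨B.orderEmbOfFin hB 0, B.orderEmbOfFin hB 1, B.orderEmbOfFin hB 2,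
    B.orderEmbOfFin hB 3, by simp, by simp, by simp, ?_⟩
  rw [← Finset.coe_inj, ← Finset.range_orderEmbOfFin B hB]
  ext i
  simp only [Set.mem_range, Finset.coe_insert, Finset.coe_singleton, Set.mem_insert_iff,
    Set.mem_singleton_iff]
  constructor
  · rintro ⟨j, rfl⟩
    fin_cases j <;> simp
  · rintro (rfl | rfl | rfl | rfl)
    exacts [⟨0, rfl⟩, ⟨1, rfl⟩, ⟨2, rfl⟩, ⟨3, rfl⟩]

theorem exists_lt_of_card_eq_three {B : Finset (Fin 7)} (hB : B.card = 3) :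
    ∃ a b c, a < b ∧ b < c ∧ B = {a, b, c} := by
  refine ⟨B.orderEmbOfFin hB 0, B.orderEmbOfFin hB 1, B.orderEmbOfFin hB 2, by simp, by simp, ?_⟩
  rw [← Finset.coe_inj, ← Finset.range_orderEmbOfFin B hB]
  ext i
  simp only [Set.mem_range, Finset.coe_insert, Finset.coe_singleton, Set.mem_insert_iff,
    Set.mem_singleton_iff]
  constructor
  · rintro ⟨j, rfl⟩
    fin_cases j <;> simp
  · rintro (rfl | rfl | rfl)
    exacts [⟨0, rfl⟩, ⟨1, rfl⟩, ⟨2, rfl⟩]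

theorem matchable_intervalType {l u : Fin 4 → ℤ} {I : Set ℤ} (s : Fin 4 → ℤ) (hI : I ⊆ Set.range s)
    (hs : ∀ i, l i ≤ s i ∧ s i ≤ u i) : Matchable (intervalType l u) I :=
  (matchable_range s Function.injective_id hs).subset hI

theorem not_matchable_of_card_lt {T : ℤ → Set (Fin 4)} {I : Set ℤ} (S : Finset ℤ) (hS : ↑S ⊆ I)
    (W : Finset (Fin 4)) (hW : ∀ z ∈ S, ∀ i ∈ T z, i ∈ W) (hlt : W.card < S.card) :
    ¬ Matchable T I := fun h =>
  ((h.subset hS).card_le hW).not_gt hlt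

theorem two_le_of_not_subset {a b : Fin 7} (hab : a < b) {s : Finset (Fin 7)}
    (h : ¬ {0, 1} ⊆ insert a (insert b s)) : 2 ≤ b := by
  by_contra hb
  refine h ?_
  rw [show a = 0 by omega, show b = 1 by omega]
  simp [Finset.insert_subset_iff]

theorem le_four_of_not_subset {a b c : Fin 7} (hbc : b < c)
    (h : ¬ {5, 6} ⊆ ({a, b, c} : Finset (Fin 7))) : b ≤ 4 := by
  by_contra hb
  refine h ?_
  rw [show b = 5 by omega, show c = 6 by omega]
  simp

namespace IntervalPresentation

variable {M : Matroid α} {n r : ℕ} {p : α → ℤ} {l u : Fin 4 → ℤ}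

/-- Two labels in the first interval only are parallel. -/
theorem not_matchable_pair (h : M.IntervalPresentation n r p l u) (hl : l 0 + 2 ≤ l 1) :
    ¬ Matchable (intervalType l u) {l 0, l 0 + 1} := by
  refine not_matchable_of_card_lt {l 0, l 0 + 1} (by simp) {0} ?_ (by simp)
  rintro z hz i ⟨hi, -⟩
  have hz1 : z < l 1 := by
    simp only [Finset.mem_insert, Finset.mem_singleton] at hz
    omega
  have := h.strictMono_left.lt_iff_lt.1 (hi.trans_lt hz1)
  rw [Finset.mem_singleton]
  omega

/-- Three labels in the last two intervals only are dependent. -/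
theorem not_matchable_triple (h : M.IntervalPresentation n r p l u) {x y z : ℤ} (hx : u 1 < x)
    (hy : u 1 < y) (hz : u 1 < z) (hxy : x ≠ y) (hxz : x ≠ z) (hyz : y ≠ z) {I : Set ℤ}
    (hI : {x, y, z} ⊆ I) : ¬ Matchable (intervalType l u) I := by
  refine not_matchable_of_card_lt {x, y, z} (by simpa using hI) {2, 3} ?_ ?_
  · rintro w hw i ⟨-, hi⟩
    have hw1 : u 1 < w := by
      simp only [Finset.mem_insert, Finset.mem_singleton] at hw
      omega
    have := h.strictMono_right.lt_iff_lt.1 (hw1.trans_le hi)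
    simp only [Finset.mem_insert, Finset.mem_singleton]
    omega
  · rw [show ({x, y, z} : Finset ℤ).card = 3 from Finset.card_eq_three.2 ⟨x, y, z, hxy, hxz, hyz, rfl⟩]
    decide

theorem exists_elements (h : M.IntervalPresentation n r p l u) {t : Fin 7 → ℤ}
    (ht : StrictMono t) (h0 : 0 ≤ t 0) (h6 : t 6 < n) :
    ∃ x : Fin 7 → α, Function.Injective x ∧ Set.range x ⊆ M.E ∧ ∀ i, p (x i) = t i := by
  have hex : ∀ i, ∃ x ∈ M.E, p x = t i := fun i => h.bijOn.surjOn
    ⟨h0.trans (ht.monotone (Fin.zero_le i)), (ht.monotone (Fin.le_last i)).trans_lt h6⟩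
  choose x hxE hx using hex
  exact ⟨x, fun i j hij => ht.injective (by rw [← hx, ← hx, hij]),
    Set.range_subset_iff.2 hxE, hx⟩

/-- Seven increasing labels `t` give seven elements as wanted if every set `a < b < c < d` without members
of `𝒟` is a system of representatives of the four intervals, in this order. -/
theorem exists_isSevenPattern_four (h : M.IntervalPresentation n r p l u) {t : Fin 7 → ℤ}
    (ht : StrictMono t) (h0 : 0 ≤ t 0) (h6 : t 6 < n) {𝒟 : Set (Finset (Fin 7))}
    (hD : ∀ D ∈ 𝒟, ¬ Matchable (intervalType l u) (t '' D))
    (hext : ∀ B : Finset (Fin 7), B.card < 4 → (∀ D ∈ 𝒟, ¬ D ⊆ B) →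
      ∃ i ∉ B, ∀ D ∈ 𝒟, ¬ D ⊆ insert i B)
    (hfull : ∀ a b c d, a < b → b < c → c < d → (∀ D ∈ 𝒟, ¬ D ⊆ {a, b, c, d}) →
      (l 0 ≤ t a ∧ t a ≤ u 0) ∧ (l 1 ≤ t b ∧ t b ≤ u 1) ∧ (l 2 ≤ t c ∧ t c ≤ u 2) ∧
        l 3 ≤ t d ∧ t d ≤ u 3) :
    ∃ x, M.IsSevenPattern 4 𝒟 x := by
  obtain ⟨x, hxinj, hxE, hx⟩ := h.exists_elements ht h0 h6
  refine ⟨x, hxinj, hxE, fun B => ?_⟩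
  have himg : p '' (x '' B) = t '' B := by
    rw [Set.image_image]
    simp_rw [hx]
  rw [h.indep_iff _ ((Set.image_subset_range _ _).trans hxE), himg]
  refine iff_card_le_and_forall_not_subset (P := fun B => Matchable (intervalType l u) (t '' B))
    ?_ ?_ hD hext ?_ B
  · exact fun B C hBC hC => hC.subset (Set.image_mono (Finset.coe_subset.2 hBC))
  · intro B hB
    have := hB.encard_le
    rw [ht.injective.injOn.encard_image, Set.encard_coe_eq_coe_finsetCard] at this
    simpa using this
  · intro B hB hBD
    obtain ⟨a, b, c, d, hab, hbc, hcd, rfl⟩ := exists_lt_of_card_eq_four hB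
    obtain ⟨ha, hb, hc, hd⟩ := hfull a b c d hab hbc hcd hBD
    refine matchable_intervalType ![t a, t b, t c, t d] ?_ ?_
    · rintro _ ⟨i, hi, rfl⟩
      simp only [Finset.coe_insert, Finset.coe_singleton, Set.mem_insert_iff,
        Set.mem_singleton_iff] at hi
      rcases hi with rfl | rfl | rfl | rfl
      exacts [⟨0, rfl⟩, ⟨1, rfl⟩, ⟨2, rfl⟩, ⟨3, rfl⟩]
    · intro i
      fin_cases i
      exacts [ha, hb, hc, hd]

/-- The version of `exists_isSevenPattern_four` for the contraction of the element with label `z`. -/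
theorem exists_isSevenPattern_contract (h : M.IntervalPresentation n r p l u) {t : Fin 7 → ℤ}
    (ht : StrictMono t) (h0 : 0 ≤ t 0) (h6 : t 6 < n) {z : ℤ} (hz0 : 0 ≤ z) (hzn : z < n)
    (hzt : ∀ i, t i ≠ z) (hz : Matchable (intervalType l u) {z}) {𝒟 : Set (Finset (Fin 7))}
    (hD : ∀ D ∈ 𝒟, ¬ Matchable (intervalType l u) (insert z (t '' D)))
    (hext : ∀ B : Finset (Fin 7), B.card < 3 → (∀ D ∈ 𝒟, ¬ D ⊆ B) →
      ∃ i ∉ B, ∀ D ∈ 𝒟, ¬ D ⊆ insert i B)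
    (hfull : ∀ a b c, a < b → b < c → (∀ D ∈ 𝒟, ¬ D ⊆ {a, b, c}) →
      ∃ s : Fin 4 → ℤ, (∀ i, l i ≤ s i ∧ s i ≤ u i) ∧ {z, t a, t b, t c} ⊆ Set.range s) :
    ∃ e ∈ M.E, ∃ x, (M ／ {e}).IsSevenPattern 3 𝒟 x := by
  obtain ⟨x, hxinj, hxE, hx⟩ := h.exists_elements ht h0 h6
  obtain ⟨e, heE, he⟩ := h.bijOn.surjOn ⟨hz0, hzn⟩
  have hex : ∀ i, x i ≠ e := fun i hi => hzt i (by rw [← hx, hi, he])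
  have hnl : M.IsNonloop e := by
    rw [← indep_singleton, h.indep_iff _ (by simpa using heE), Set.image_singleton, he]
    exact hz
  refine ⟨e, heE, x, hxinj, ?_, fun B => ?_⟩
  · rintro _ ⟨i, rfl⟩
    exact ⟨hxE ⟨i, rfl⟩, hex i⟩
  have himg : p '' (insert e (x '' B)) = insert z (t '' B) := by
    rw [Set.image_insert_eq, Set.image_image, he]
    simp_rw [hx]
  have heB : e ∉ x '' B := by
    rintro ⟨i, -, hi⟩
    exact hex i hi
  rw [hnl.contractElem_indep_iff, and_iff_right heB, h.indep_iff _ (Set.insert_subset heE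
    ((Set.image_subset_range _ _).trans hxE)), himg]
  refine iff_card_le_and_forall_not_subset
    (P := fun B => Matchable (intervalType l u) (insert z (t '' B))) ?_ ?_ hD hext ?_ B
  · exact fun B C hBC hC => hC.subset
      (Set.insert_subset_insert (Set.image_mono (Finset.coe_subset.2 hBC)))
  · intro B hB
    have := hB.encard_le
    rw [Set.encard_insert_of_notMem (by rintro ⟨i, -, hi⟩; exact hzt i hi),
      ht.injective.injOn.encard_image, Set.encard_coe_eq_coe_finsetCard] at this
    have h4 : B.card + 1 ≤ 4 := by
      rw [ENat.card_eq_coe_fintype_card, Fintype.card_fin] at this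
      exact_mod_cast this
    omega
  · intro B hB hBD
    obtain ⟨a, b, c, hab, hbc, rfl⟩ := exists_lt_of_card_eq_three hB
    obtain ⟨s, hs, hsub⟩ := hfull a b c hab hbc hBD
    refine matchable_intervalType s ?_ hs
    simpa [Set.image_insert_eq] using hsub

/-- If the first and the last interval meet, then there is a restriction to `U_{4,7}`. -/
theorem exists_isSevenPattern_empty (h : M.IntervalPresentation n 4 p l u) (h30 : l 3 ≤ u 0) :
    ∃ x, M.IsSevenPattern 4 ∅ x := by
  have l01 : l 0 < l 1 := h.strictMono_left (by decide)
  have l12 : l 1 < l 2 := h.strictMono_left (by decide)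
  have l23 : l 2 < l 3 := h.strictMono_left (by decide)
  have u01 : u 0 < u 1 := h.strictMono_right (by decide)
  have u12 : u 1 < u 2 := h.strictMono_right (by decide)
  have u23 : u 2 < u 3 := h.strictMono_right (by decide)
  have m0 := (h.mem_of_lt 0 (by decide)).1
  have m3 := (h.mem_of_lt 3 (by decide)).2
  have ht : StrictMono ![l 0, l 1, l 2, l 3, u 1, u 2, u 3] := by
    rw [Fin.strictMono_iff_lt_succ]
    intro i
    fin_cases i <;> simp <;> omega
  refine h.exists_isSevenPattern_four ht (by simpa) (by simpa) (by simp) ?_ ?_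
  · simp only [Set.mem_empty_iff_false, false_imp_iff, implies_true, and_true]
    decide +kernel
  · intro a b c d hab hbc hcd _
    have a0 := ht.monotone (show 0 ≤ a by omega)
    have b1 := ht.monotone (show 1 ≤ b by omega)
    have c2 := ht.monotone (show 2 ≤ c by omega)
    have d3 := ht.monotone (show 3 ≤ d by omega)
    have a3 := ht.monotone (show a ≤ 3 by omega)
    have b4 := ht.monotone (show b ≤ 4 by omega)
    have c5 := ht.monotone (show c ≤ 5 by omega)
    have d6 := ht.monotone (show d ≤ 6 by omega)
    exact ⟨⟨a0, a3.trans h30⟩, ⟨b1, b4⟩, ⟨c2, c5⟩, d3, d6⟩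

/-- Two common labels of the first three intervals lead to a circuit-hyperplane, as the first three
intervals contain `l 0, l 1, l 2, u 0` and the last one does not; two labels in the first interval only
lead to a parallel pair. -/
theorem exists_isSevenPattern_of_hasLeftObstruction (h : M.IntervalPresentation n 4 p l u)
    (hob : HasLeftObstruction l u) :
    (∃ x, M.IsSevenPattern 4 {{0, 1, 2, 3}} x) ∨ ∃ x, M.IsSevenPattern 4 {{0, 1}} x := by
  obtain ⟨h20, h03, h31, hob⟩ := hob
  have l01 : l 0 < l 1 := h.strictMono_left (by decide)
  have l12 : l 1 < l 2 := h.strictMono_left (by decide)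
  have l23 : l 2 < l 3 := h.strictMono_left (by decide)
  have u01 : u 0 < u 1 := h.strictMono_right (by decide)
  have u12 : u 1 < u 2 := h.strictMono_right (by decide)
  have u23 : u 2 < u 3 := h.strictMono_right (by decide)
  have m0 := (h.mem_of_lt 0 (by decide)).1
  have m3 := (h.mem_of_lt 3 (by decide)).2
  rcases hob with hob | hob
  · left
    have ht : StrictMono ![l 0, l 1, l 2, u 0, l 3, u 2, u 3] := by
      rw [Fin.strictMono_iff_lt_succ]
      intro i
      fin_cases i <;> simp <;> omega
    refine h.exists_isSevenPattern_four ht (by simpa) (by simpa) ?_ ?_ ?_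
    · simp only [Set.mem_singleton_iff, forall_eq]
      refine not_matchable_of_card_lt {l 0, l 1, l 2, u 0} ?_ {0, 1, 2} ?_ ?_
      · simp [Set.image_insert_eq]
      · rintro z hz i ⟨hi, -⟩
        have hz3 : z < l 3 := by
          simp only [Finset.mem_insert, Finset.mem_singleton] at hz
          omega
        have := h.strictMono_left.lt_iff_lt.1 (hi.trans_lt hz3)
        simp only [Finset.mem_insert, Finset.mem_singleton]
        omega
      · have h3 : ({l 1, l 2, u 0} : Finset ℤ).card = 3 :=
          Finset.card_eq_three.2 ⟨l 1, l 2, u 0, by omega, by omega, by omega, rfl⟩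
        have h4 : ({l 0, l 1, l 2, u 0} : Finset ℤ).card = 4 := by
          rw [Finset.card_insert_of_notMem, h3]
          simp only [Finset.mem_insert, Finset.mem_singleton]
          omega
        rw [h4]
        decide
    · simp only [Set.mem_singleton_iff, forall_eq]
      decide +kernel
    · intro a b c d hab hbc hcd hD
      have h4 : 4 ≤ d := by
        by_contra hd
        refine hD {0, 1, 2, 3} rfl ?_
        rw [show a = 0 by omega, show b = 1 by omega, show c = 2 by omega, show d = 3 by omega]
      have a0 := ht.monotone (show 0 ≤ a by omega)
      have b1 := ht.monotone (show 1 ≤ b by omega)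
      have c2 := ht.monotone (show 2 ≤ c by omega)
      have d4 := ht.monotone (show 4 ≤ d by omega)
      have a3 := ht.monotone (show a ≤ 3 by omega)
      have b4 := ht.monotone (show b ≤ 4 by omega)
      have c5 := ht.monotone (show c ≤ 5 by omega)
      have d6 := ht.monotone (show d ≤ 6 by omega)
      exact ⟨⟨a0, a3⟩, ⟨b1, b4.trans h31⟩, ⟨c2, c5⟩, d4, d6⟩
  · right
    have ht : StrictMono ![l 0, l 0 + 1, l 1, l 2, l 3, u 2, u 3] := by
      rw [Fin.strictMono_iff_lt_succ]
      intro i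
      fin_cases i <;> simp <;> omega
    refine h.exists_isSevenPattern_four ht (by simpa) (by simpa) ?_ ?_ ?_
    · simp only [Set.mem_singleton_iff, forall_eq]
      exact fun hm => h.not_matchable_pair hob (hm.subset (by simp [Set.image_insert_eq]))
    · simp only [Set.mem_singleton_iff, forall_eq]
      decide +kernel
    · intro a b c d hab hbc hcd hD
      have h2 := two_le_of_not_subset hab (hD _ rfl)
      have a0 := ht.monotone (show 0 ≤ a by omega)
      have b2 := ht.monotone (show 2 ≤ b by omega)
      have c3 := ht.monotone (show 3 ≤ c by omega)
      have d4 := ht.monotone (show 4 ≤ d by omega)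
      have a3 := ht.monotone (show a ≤ 3 by omega)
      have b4 := ht.monotone (show b ≤ 4 by omega)
      have c5 := ht.monotone (show c ≤ 5 by omega)
      have d6 := ht.monotone (show d ≤ 6 by omega)
      exact ⟨⟨a0, a3.trans h20⟩, ⟨b2, b4.trans h31⟩, ⟨c3, c5⟩, d4, d6⟩

/-- Contraction of the label `u 3`, which represents the last interval, so that the other three intervals
have to be represented by the three remaining labels. -/
theorem exists_isSevenPattern_contract_last (h : M.IntervalPresentation n 4 p l u)
    {t : Fin 7 → ℤ} (ht : StrictMono t) (h0 : l 0 ≤ t 0) (h6 : t 6 ≤ u 2)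
    {𝒟 : Set (Finset (Fin 7))}
    (hD : ∀ D ∈ 𝒟, ¬ Matchable (intervalType l u) (insert (u 3) (t '' D)))
    (hext : ∀ B : Finset (Fin 7), B.card < 3 → (∀ D ∈ 𝒟, ¬ D ⊆ B) →
      ∃ i ∉ B, ∀ D ∈ 𝒟, ¬ D ⊆ insert i B)
    (hfull : ∀ a b c, a < b → b < c → (∀ D ∈ 𝒟, ¬ D ⊆ {a, b, c}) →
      (l 0 ≤ t a ∧ t a ≤ u 0) ∧ (l 1 ≤ t b ∧ t b ≤ u 1) ∧ l 2 ≤ t c ∧ t c ≤ u 2) :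
    ∃ e ∈ M.E, ∃ x, (M ／ {e}).IsSevenPattern 3 𝒟 x := by
  have u23 : u 2 < u 3 := h.strictMono_right (by decide)
  have hl3 := h.le 3
  have m0 := (h.mem_of_lt 0 (by decide)).1
  have m3 := (h.mem_of_lt 3 (by decide)).2
  refine h.exists_isSevenPattern_contract ht (m0.trans h0) (by omega) (z := u 3) ?_ m3 ?_ ?_ hD
    hext ?_
  · have := ht.monotone (show (0 : Fin 7) ≤ 6 by decide)
    omega
  · intro i
    have := ht.monotone (show i ≤ 6 by omega)
    omega
  · exact ⟨fun _ => 3, by simp, fun x hx => by rw [hx]; exact ⟨hl3, le_rfl⟩⟩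
  · intro a b c hab hbc hcD
    obtain ⟨ha, hb, hc⟩ := hfull a b c hab hbc hcD
    refine ⟨![t a, t b, t c, u 3], ?_, ?_⟩
    · intro i
      fin_cases i
      exacts [ha, hb, hc, ⟨hl3, le_rfl⟩]
    · simp only [Set.insert_subset_iff, Set.singleton_subset_iff]
      exact ⟨⟨3, rfl⟩, ⟨0, rfl⟩, ⟨1, rfl⟩, ⟨2, rfl⟩⟩

/-- If `u 2 = l 3` and the element with this label is contracted, then the labels `u 2 + 1` and `u 2 + 2`,
which are in the last interval only, become parallel. The contracted label represents the last interval,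
or the third one when one of these two labels represents the last one. -/
theorem exists_isSevenPattern_contract_overlap (h : M.IntervalPresentation n 4 p l u)
    (h32 : l 3 = u 2) (h13 : u 2 + 2 ≤ u 3) {t : Fin 7 → ℤ} (ht : StrictMono t)
    (h0 : l 0 ≤ t 0) (h4 : t 4 < u 2) (h5 : t 5 = u 2 + 1) (h6 : t 6 = u 2 + 2)
    {𝒟 : Set (Finset (Fin 7))}
    (hD : ∀ D ∈ 𝒟, ¬ Matchable (intervalType l u) (insert (u 2) (t '' D)))
    (hext : ∀ B : Finset (Fin 7), B.card < 3 → (∀ D ∈ 𝒟, ¬ D ⊆ B) →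
      ∃ i ∉ B, ∀ D ∈ 𝒟, ¬ D ⊆ insert i B) (hD56 : {5, 6} ∈ 𝒟)
    (hfull : ∀ a b, a < b → b ≤ 4 → (∀ D ∈ 𝒟, ¬ D ⊆ {a, b}) →
      (l 0 ≤ t a ∧ t a ≤ u 0) ∧ l 1 ≤ t b ∧ t b ≤ u 1)
    (hthird : ∀ a b c, a < b → b < c → c ≤ 4 → (∀ D ∈ 𝒟, ¬ D ⊆ {a, b}) → l 2 ≤ t c) :
    ∃ e ∈ M.E, ∃ x, (M ／ {e}).IsSevenPattern 3 𝒟 x := by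
  have l23 : l 2 < l 3 := h.strictMono_left (by decide)
  have m0 := (h.mem_of_lt 0 (by decide)).1
  have m3 := (h.mem_of_lt 3 (by decide)).2
  have h04 := ht.monotone (show (0 : Fin 7) ≤ 4 by decide)
  have hu23 : u 2 ≤ u 3 := by omega
  refine h.exists_isSevenPattern_contract ht (m0.trans h0) (by omega) (z := u 2) (by omega)
    (by omega) ?_ ?_ hD hext ?_
  · intro i
    obtain hi | hi : i ≤ 4 ∨ 5 ≤ i := by omega
    · have := ht.monotone hi
      omega
    · have := ht.monotone hi
      omega
  · exact ⟨fun _ => 3, by simp, fun x hx => by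
      rw [hx]
      exact ⟨h32.le, hu23⟩⟩
  · intro a b c hab hbc hcD
    have hcD' : ∀ D ∈ 𝒟, ¬ D ⊆ {a, b} := fun D hDm hsub => hcD D hDm (hsub.trans (by simp))
    have hb4 : b ≤ 4 := by
      by_contra hb
      refine hcD _ hD56 ?_
      rw [show b = 5 by omega, show c = 6 by omega]
      simp
    obtain ⟨ha, hb⟩ := hfull a b hab hb4 hcD'
    obtain hc | hc : c ≤ 4 ∨ 5 ≤ c := by omega
    · have hc2 := hthird a b c hab hbc hc hcD'
      have hc4 := ht.monotone hc
      refine ⟨![t a, t b, t c, u 2], ?_, ?_⟩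
      · intro i
        fin_cases i
        exacts [ha, hb, ⟨hc2, hc4.trans h4.le⟩, ⟨h32.le, hu23⟩]
      · simp only [Set.insert_subset_iff, Set.singleton_subset_iff]
        exact ⟨⟨3, rfl⟩, ⟨0, rfl⟩, ⟨1, rfl⟩, ⟨2, rfl⟩⟩
    · have hc5 := ht.monotone hc
      have hc6 := ht.monotone (show c ≤ 6 by omega)
      have hc3 : l 3 ≤ t c := by omega
      have hcu : t c ≤ u 3 := by omega
      have hl2 : l 2 ≤ u 2 := by omega
      refine ⟨![t a, t b, u 2, t c], ?_, ?_⟩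
      · intro i
        fin_cases i
        exacts [ha, hb, ⟨hl2, le_rfl⟩, ⟨hc3, hcu⟩]
      · simp only [Set.insert_subset_iff, Set.singleton_subset_iff]
        exact ⟨⟨2, rfl⟩, ⟨0, rfl⟩, ⟨1, rfl⟩, ⟨3, rfl⟩⟩

/-- The obstructions of rank three. Contraction of `u 3` or `u 2` leaves `U_{3,7}` if the first three
intervals have three common labels. Otherwise it leaves a parallel pair at the left end, one at the right
end, or both; a single pair is enough if the first three intervals have two common labels. -/
theorem exists_contract_not_isBicircular (h : M.IntervalPresentation n 4 p l u)
    (hob : HasContractedObstruction l u) : ∃ e ∈ M.E, ¬ (M ／ {e}).IsBicircular := by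
  obtain ⟨h20, h13, hob⟩ := hob
  have l01 : l 0 < l 1 := h.strictMono_left (by decide)
  have l12 : l 1 < l 2 := h.strictMono_left (by decide)
  have u01 : u 0 < u 1 := h.strictMono_right (by decide)
  have u12 : u 1 < u 2 := h.strictMono_right (by decide)
  have u23 : u 2 < u 3 := h.strictMono_right (by decide)
  by_cases hk3 : l 2 + 2 ≤ u 0
  · have ht : StrictMono ![l 0, l 1, l 2, l 2 + 1, u 0, u 1, u 2] := by
      rw [Fin.strictMono_iff_lt_succ]
      intro i
      fin_cases i <;> simp <;> omega
    obtain ⟨e, he, x, hx⟩ := h.exists_isSevenPattern_contract_last ht le_rfl le_rfl (𝒟 := ∅)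
      (by simp) (by
        simp only [Set.mem_empty_iff_false, false_imp_iff, implies_true, and_true]
        decide +kernel) (by
        intro a b c hab hbc _
        have a0 := ht.monotone (show 0 ≤ a by omega)
        have b1 := ht.monotone (show 1 ≤ b by omega)
        have c2 := ht.monotone (show 2 ≤ c by omega)
        have a4 := ht.monotone (show a ≤ 4 by omega)
        have b5 := ht.monotone (show b ≤ 5 by omega)
        have c6 := ht.monotone (show c ≤ 6 by omega)
        exact ⟨⟨a0, a4⟩, ⟨b1, b5⟩, c2, c6⟩)
    exact ⟨e, he, hx.not_isBicircular_of_empty (Or.inl rfl)⟩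
  by_cases hk2 : l 2 + 1 ≤ u 0 ∧ l 0 + 2 ≤ l 1
  · have ht : StrictMono ![l 0, l 0 + 1, l 1, l 2, u 0, u 1, u 2] := by
      rw [Fin.strictMono_iff_lt_succ]
      intro i
      fin_cases i <;> simp <;> omega
    obtain ⟨e, he, x, hx⟩ := h.exists_isSevenPattern_contract_last ht le_rfl le_rfl
      (𝒟 := {{0, 1}}) (by
        simp only [Set.mem_singleton_iff, forall_eq]
        exact fun hm => h.not_matchable_pair hk2.2 (hm.subset (by simp [Set.image_insert_eq])))
      (by
        simp only [Set.mem_singleton_iff, forall_eq]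
        decide +kernel) (by
        intro a b c hab hbc hD
        have h2 := two_le_of_not_subset hab (hD _ rfl)
        have a0 := ht.monotone (show 0 ≤ a by omega)
        have b2 := ht.monotone (show 2 ≤ b by omega)
        have c3 := ht.monotone (show 3 ≤ c by omega)
        have a4 := ht.monotone (show a ≤ 4 by omega)
        have b5 := ht.monotone (show b ≤ 5 by omega)
        have c6 := ht.monotone (show c ≤ 6 by omega)
        exact ⟨⟨a0, a4⟩, ⟨b2, b5⟩, c3, c6⟩)
    exact ⟨e, he, hx.not_isBicircular_of_pair (by decide) (Or.inl rfl)⟩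
  by_cases htail : u 1 + 2 ≤ u 2
  · -- the labels `u 1 + 1` and `u 2` become parallel
    have hpair : ∀ {I : Set ℤ}, {u 1 + 1, u 2} ⊆ I →
        ¬ Matchable (intervalType l u) (insert (u 3) I) := fun hI =>
      h.not_matchable_triple (x := u 1 + 1) (y := u 2) (z := u 3) (by omega) (by omega) (by omega)
        (by omega) (by omega) (by omega) (Set.insert_subset (Or.inr (hI (by simp)))
          (Set.insert_subset (Or.inr (hI (by simp))) (by simp)))
    by_cases hk : l 2 + 1 ≤ u 0
    · have ht : StrictMono ![l 0, l 1, l 2, u 0, u 1, u 1 + 1, u 2] := by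
        rw [Fin.strictMono_iff_lt_succ]
        intro i
        fin_cases i <;> simp <;> omega
      obtain ⟨e, he, x, hx⟩ := h.exists_isSevenPattern_contract_last ht le_rfl le_rfl
        (𝒟 := {{5, 6}}) (by
          simp only [Set.mem_singleton_iff, forall_eq]
          exact hpair (by simp [Set.image_insert_eq]))
        (by
          simp only [Set.mem_singleton_iff, forall_eq]
          decide +kernel) (by
          intro a b c hab hbc hD
          have h4 := le_four_of_not_subset hbc (hD _ rfl)
          have a0 := ht.monotone (show 0 ≤ a by omega)
          have b1 := ht.monotone (show 1 ≤ b by omega)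
          have c2 := ht.monotone (show 2 ≤ c by omega)
          have a3 := ht.monotone (show a ≤ 3 by omega)
          have b4 := ht.monotone (show b ≤ 4 by omega)
          have c6 := ht.monotone (show c ≤ 6 by omega)
          exact ⟨⟨a0, a3⟩, ⟨b1, b4⟩, c2, c6⟩)
      exact ⟨e, he, hx.not_isBicircular_of_pair (by decide) (Or.inl rfl)⟩
    · have hl : l 0 + 2 ≤ l 1 := by omega
      have ht : StrictMono ![l 0, l 0 + 1, l 1, l 2, u 1, u 1 + 1, u 2] := by
        rw [Fin.strictMono_iff_lt_succ]
        intro i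
        fin_cases i <;> simp <;> omega
      obtain ⟨e, he, x, hx⟩ := h.exists_isSevenPattern_contract_last ht le_rfl le_rfl
        (𝒟 := {{0, 1}, {5, 6}}) (by
          simp only [Set.mem_insert_iff, Set.mem_singleton_iff, forall_eq_or_imp, forall_eq]
          exact ⟨fun hm => h.not_matchable_pair hl (hm.subset (by simp [Set.image_insert_eq])),
            hpair (by simp [Set.image_insert_eq])⟩)
        (by
          simp only [Set.mem_insert_iff, Set.mem_singleton_iff, forall_eq_or_imp, forall_eq]
          decide +kernel) (by
          intro a b c hab hbc hD
          have h2 := two_le_of_not_subset hab (hD _ (by simp))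
          have h4 := le_four_of_not_subset hbc (hD _ (by simp))
          have a0 := ht.monotone (show 0 ≤ a by omega)
          have b2 := ht.monotone (show 2 ≤ b by omega)
          have c3 := ht.monotone (show 3 ≤ c by omega)
          have a3 := ht.monotone (show a ≤ 3 by omega)
          have b4 := ht.monotone (show b ≤ 4 by omega)
          have c6 := ht.monotone (show c ≤ 6 by omega)
          exact ⟨⟨a0, a3.trans h20⟩, ⟨b2, b4⟩, c3, c6⟩)
      exact ⟨e, he, hx.not_isBicircular_of_two_pairs⟩
  -- now the parallel pair at the right end arises from contraction of `u 2`
  have h32 : l 3 = u 2 := by omega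
  have h23 : u 2 + 2 ≤ u 3 := by omega
  have hpair : ∀ {I : Set ℤ}, {u 2 + 1, u 2 + 2} ⊆ I →
      ¬ Matchable (intervalType l u) (insert (u 2) I) := fun hI =>
    h.not_matchable_triple (x := u 2) (y := u 2 + 1) (z := u 2 + 2) (by omega) (by omega)
      (by omega) (by omega) (by omega) (by omega) (Set.insert_subset (by simp)
        (Set.insert_subset (Or.inr (hI (by simp)))
          (Set.singleton_subset_iff.2 (Or.inr (hI (by simp))))))
  by_cases hk : l 2 + 1 ≤ u 0
  · have ht : StrictMono ![l 0, l 1, l 2, u 0, u 1, u 2 + 1, u 2 + 2] := by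
      rw [Fin.strictMono_iff_lt_succ]
      intro i
      fin_cases i <;> simp <;> omega
    obtain ⟨e, he, x, hx⟩ := h.exists_isSevenPattern_contract_overlap h32 h23 ht le_rfl u12 rfl rfl
      (𝒟 := {{5, 6}}) (by
        simp only [Set.mem_singleton_iff, forall_eq]
        exact hpair (by simp [Set.image_insert_eq]))
      (by
        simp only [Set.mem_singleton_iff, forall_eq]
        decide +kernel) rfl (by
        intro a b hab hb4 _
        have a0 := ht.monotone (show 0 ≤ a by omega)
        have b1 := ht.monotone (show 1 ≤ b by omega)
        have a3 := ht.monotone (show a ≤ 3 by omega)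
        have b4 := ht.monotone hb4
        exact ⟨⟨a0, a3⟩, b1, b4⟩)
      (fun a b c hab hbc _ _ => ht.monotone (show 2 ≤ c by omega))
    exact ⟨e, he, hx.not_isBicircular_of_pair (by decide) (Or.inl rfl)⟩
  · have hl : l 0 + 2 ≤ l 1 := by omega
    have ht : StrictMono ![l 0, l 0 + 1, l 1, l 2, u 1, u 2 + 1, u 2 + 2] := by
      rw [Fin.strictMono_iff_lt_succ]
      intro i
      fin_cases i <;> simp <;> omega
    obtain ⟨e, he, x, hx⟩ := h.exists_isSevenPattern_contract_overlap h32 h23 ht le_rfl u12 rfl rfl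
      (𝒟 := {{0, 1}, {5, 6}}) (by
        simp only [Set.mem_insert_iff, Set.mem_singleton_iff, forall_eq_or_imp, forall_eq]
        exact ⟨fun hm => h.not_matchable_pair hl (hm.subset (by simp [Set.image_insert_eq])),
          hpair (by simp [Set.image_insert_eq])⟩)
      (by
        simp only [Set.mem_insert_iff, Set.mem_singleton_iff, forall_eq_or_imp, forall_eq]
        decide +kernel) (by simp) (by
        intro a b hab hb4 hD
        have h2 := two_le_of_not_subset (s := ∅) hab (hD _ (by simp))
        have a0 := ht.monotone (show 0 ≤ a by omega)
        have b2 := ht.monotone (show 2 ≤ b by omega)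
        have a3 := ht.monotone (show a ≤ 3 by omega)
        have b4 := ht.monotone hb4
        exact ⟨⟨a0, a3.trans h20⟩, b2, b4⟩)
      (fun a b c hab hbc _ hD => ht.monotone (show 3 ≤ c by
        have h2 := two_le_of_not_subset (s := ∅) hab (hD _ (by simp))
        omega))
    exact ⟨e, he, hx.not_isBicircular_of_two_pairs⟩

end IntervalPresentation

theorem matchable_intervalType_reverse {l u : Fin 4 → ℤ} (c : ℤ) {I : Set ℤ} :
    Matchable (intervalType (fun i => c - u i.rev) fun i => c - l i.rev) ((fun z => c - z) '' I) ↔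
      Matchable (intervalType l u) I := by
  rw [← matchable_comp_iff fun x _ y _ hxy => sub_right_injective hxy]
  constructor
  · rintro ⟨f, hf, hfT⟩
    refine ⟨fun x => (f x).rev, fun x hx y hy hxy => hf hx hy (Fin.rev_injective hxy),
        fun x hx => ?_⟩
    obtain ⟨h1, h2⟩ := hfT x hx
    exact ⟨(sub_le_sub_iff_left c).1 h2, (sub_le_sub_iff_left c).1 h1⟩
  · rintro ⟨f, hf, hfT⟩
    refine ⟨fun x => (f x).rev, fun x hx y hy hxy => hf hx hy (Fin.rev_injective hxy),
        fun x hx => ?_⟩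
    obtain ⟨h1, h2⟩ := hfT x hx
    exact ⟨(sub_le_sub_iff_left c).2 (by simpa using h2),
      (sub_le_sub_iff_left c).2 (by simpa using h1)⟩

/-- Reversal of the order of the labels, with `0` and `n - 1` exchanged. -/
theorem IntervalPresentation.reverse {M : Matroid α} {n : ℕ} {p : α → ℤ} {l u : Fin 4 → ℤ}
    (h : M.IntervalPresentation n 4 p l u) :
    M.IntervalPresentation n 4 (fun x => n - 1 - p x) (fun i => n - 1 - u i.rev)
      fun i => n - 1 - l i.rev where
  bijOn := by
    refine ⟨fun x hx => ?_, fun x hx y hy hxy => h.bijOn.injOn hx hy (by simpa using hxy),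
      fun z hz => ?_⟩
    · have := h.bijOn.mapsTo hx
      simp only [Set.mem_Ico] at this ⊢
      omega
    · simp only [Set.mem_Ico] at hz
      obtain ⟨x, hx, hxz⟩ := h.bijOn.surjOn (show (n : ℤ) - 1 - z ∈ Set.Ico (0 : ℤ) n by
        simp only [Set.mem_Ico]
        omega)
      exact ⟨x, hx, by simp [hxz]⟩
  strictMono_left i j hij := by
    have := h.strictMono_right (Fin.rev_lt_rev.2 hij)
    dsimp only
    omega
  strictMono_right i j hij := by
    have := h.strictMono_left (Fin.rev_lt_rev.2 hij)
    dsimp only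
    omega
  le i := sub_le_sub_left (h.le i.rev) _
  indep_iff I hI := by
    rw [h.indep_iff I hI, ← matchable_intervalType_reverse (n - 1), Set.image_image]
  mem_of_lt i _ := by
    have := h.mem_of_lt i.rev (Fin.is_lt _)
    omega
  eq_of_le i hi := absurd i.is_lt hi.not_gt

/-! ### Truncations of direct sums of uniform matroids -/

variable {β : Type*}

theorem uniform_indep_iff {r n : ℕ} {I : Set (Fin n)} : (uniform r n).Indep I ↔ I.ncard ≤ r := by
  simp [uniform]

theorem uniform_ground (r n : ℕ) : (uniform r n).E = Set.univ := rfl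

theorem Indep.isBase_of_eRank_le_encard {M : Matroid α} {I : Set α} {k : ℕ} (hM : M.eRank = k)
    (hI : M.Indep I) (h : (k : ℕ∞) ≤ I.encard) : M.IsBase I := by
  obtain ⟨B, hB, hIB⟩ := hI.exists_isBase_superset
  have hcard := hB.encard_eq_eRank.trans hM
  have hfin : B.Finite := Set.finite_of_encard_eq_coe hcard
  rwa [hfin.eq_of_subset_of_encard_le' hIB (hcard.trans_le h)]

theorem eRank_uniform {r n : ℕ} (h : r ≤ n) : (uniform r n).eRank = r := by
  obtain ⟨I, -, hI⟩ := Set.exists_subset_encard_eq (s := (Set.univ : Set (Fin n))) (k := r)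
    (by simpa using h)
  obtain ⟨B, hB⟩ := (uniform r n).exists_isBase
  rw [← hB.encard_eq_eRank]
  have hBr := uniform_indep_iff.1 hB.indep
  refine le_antisymm ?_ ?_
  · rw [← (Set.toFinite B).cast_ncard_eq]
    exact_mod_cast hBr
  · have hind : (uniform r n).Indep I := by
      rw [uniform_indep_iff, Set.ncard, hI]
      simp
    rw [hB.encard_eq_eRank, ← hI]
    exact hind.encard_le_eRank

theorem eRank_sum (M : Matroid α) (N : Matroid β) : (M.sum N).eRank = M.eRank + N.eRank := by
  obtain ⟨B, hB⟩ := M.exists_isBase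
  obtain ⟨C, hC⟩ := N.exists_isBase
  have hBC : (M.sum N).IsBase (Sum.inl '' B ∪ Sum.inr '' C) := by
    rw [sum_isBase_iff]
    simpa [Set.preimage_union, Set.preimage_image_eq, Sum.inl_injective, Sum.inr_injective] using
      ⟨hB, hC⟩
  rw [← hBC.encard_eq_eRank, Set.encard_union_eq (by
    rw [Set.disjoint_left]
    rintro _ ⟨x, -, rfl⟩
    simp), Sum.inl_injective.encard_image, Sum.inr_injective.encard_image,
    hB.encard_eq_eRank, hC.encard_eq_eRank]

theorem truncation_ground (M : Matroid α) : M.truncation.E = M.E := by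
  ext x
  simp [truncation, freeExtension]

theorem truncation_indep_iff {M : Matroid α} {k : ℕ} (hM : M.eRank = (k + 1 : ℕ)) {I : Set α} :
    M.truncation.Indep I ↔ M.Indep I ∧ I.encard ≤ k := by
  have hbase : ∀ J, M.Indep J → (M.IsBase J ↔ ¬ J.encard ≤ k) := by
    intro J hJ
    constructor
    · intro h
      rw [h.encard_eq_eRank, hM]
      exact_mod_cast (Nat.lt_succ_self k).not_ge
    · intro h
      refine hJ.isBase_of_eRank_le_encard hM ?_
      rw [not_le] at h
      exact_mod_cast Order.add_one_le_of_lt h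
  have hext : ∀ J, M.freeExtension.Indep J ↔ M.FreeExtensionIndep J := fun _ => Iff.rfl
  have hnone : M.freeExtension.IsNonloop none := by
    rw [← indep_singleton, hext, FreeExtensionIndep, show some ⁻¹' ({none} : Set (Option α)) = ∅ by
      ext; simp, hbase _ M.empty_indep]
    simp
  rw [truncation, comap_indep_iff, hnone.contractElem_indep_iff, hext, FreeExtensionIndep,
    preimage_some_insert_none, Set.preimage_image_eq _ (Option.some_injective _)]
  simp only [Set.mem_image, reduceCtorEq, and_false, exists_false, not_false_eq_true,
    Set.mem_insert_iff, or_false, forall_const, true_and, (Option.some_injective _).injOn, and_true]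
  exact and_congr_right fun h => by rw [hbase I h, not_not]

theorem eRank_truncation {M : Matroid α} {k : ℕ} (hM : M.eRank = (k + 1 : ℕ)) :
    M.truncation.eRank = k := by
  obtain ⟨B, hB⟩ := M.truncation.exists_isBase
  have hBi := (truncation_indep_iff hM).1 hB.indep
  rw [← hB.encard_eq_eRank]
  refine le_antisymm hBi.2 ?_
  obtain ⟨C, hC⟩ := M.exists_isBase
  obtain ⟨I, hIC, hI⟩ := Set.exists_subset_encard_eq (s := C) (k := k) (by
    rw [hC.encard_eq_eRank, hM]
    exact_mod_cast Nat.le_succ k)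
  rw [hB.encard_eq_eRank, ← hI]
  exact ((truncation_indep_iff hM).2 ⟨hC.indep.subset hIC, hI.le⟩).encard_le_eRank

/-- Truncation to rank `n` keeps the independent sets with at most `n` elements. -/
theorem truncation_iterate (n k : ℕ) {M : Matroid α} (hM : M.eRank = (n + k : ℕ)) :
    (truncation^[k] M).E = M.E ∧
      ∀ I, (truncation^[k] M).Indep I ↔ M.Indep I ∧ I.encard ≤ n := by
  induction k generalizing M with
  | zero =>
    refine ⟨rfl, fun I => ⟨fun h => ⟨h, ?_⟩, fun h => h.1⟩⟩
    rw [← Nat.add_zero n, ← hM]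
    exact Indep.encard_le_eRank h
  | succ k ih =>
    obtain ⟨h1, h2⟩ := ih (eRank_truncation hM)
    rw [Function.iterate_succ_apply]
    refine ⟨h1.trans M.truncation_ground, fun I => ?_⟩
    rw [h2, truncation_indep_iff hM, and_assoc]
    refine and_congr_right fun _ => and_iff_right_of_imp fun h => h.trans ?_
    exact_mod_cast Nat.le_add_right n k

theorem truncationTo_ground {n k : ℕ} {M : Matroid α} (hM : M.eRank = (n + k : ℕ)) :
    (M.truncationTo n).E = M.E := by
  rw [truncationTo, hM, ENat.toNat_natCast, Nat.add_sub_cancel_left]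
  exact (truncation_iterate n k hM).1

theorem truncationTo_indep_iff {n k : ℕ} {M : Matroid α} (hM : M.eRank = (n + k : ℕ))
    {I : Set α} : (M.truncationTo n).Indep I ↔ M.Indep I ∧ I.encard ≤ n := by
  rw [truncationTo, hM, ENat.toNat_natCast, Nat.add_sub_cancel_left]
  exact (truncation_iterate n k hM).2 I

theorem sum_uniform_indep_iff {a b c d : ℕ} (B : Finset (Fin (b + d))) :
    ((uniform a b).sum (uniform c d)).Indep (finSumFinEquiv.symm '' B) ↔
      (Finset.univ.filter fun j => Fin.castAdd d j ∈ B).card ≤ a ∧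
        (Finset.univ.filter fun j => Fin.natAdd b j ∈ B).card ≤ c := by
  rw [sum_indep_iff, uniform_indep_iff, uniform_indep_iff, ← Set.ncard_coe_finset,
    ← Set.ncard_coe_finset]
  congr! 3
  · ext j
    simp [Equiv.image_symm_eq_preimage]
  · ext j
    simp [Equiv.image_symm_eq_preimage]

/-- A truncated direct sum of two uniform matroids with seven elements, the elements of the first
summand being listed before those of the second one. -/
theorem isSevenPattern_truncationTo_sum {a b c d k : ℕ} (hab : a ≤ b) (hcd : c ≤ d)
    (hk : a + c = 4 + k) (h7 : b + d = 7) {𝒟 : Set (Finset (Fin 7))}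
    (hD : ∀ B : Finset (Fin (b + d)),
      (((Finset.univ.filter fun j => Fin.castAdd d j ∈ B).card ≤ a ∧
        (Finset.univ.filter fun j => Fin.natAdd b j ∈ B).card ≤ c) ∧ B.card ≤ 4) ↔
        B.card ≤ 4 ∧ ∀ D ∈ 𝒟, ¬ D ⊆ B.map (finCongr h7).toEmbedding) :
    ∃ y, (truncationTo 4 ((uniform a b).sum (uniform c d))).IsSevenPattern 4 𝒟 y ∧
      Set.range y = (truncationTo 4 ((uniform a b).sum (uniform c d))).E := by
  have hrank : ((uniform a b).sum (uniform c d)).eRank = (4 + k : ℕ) := by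
    rw [eRank_sum, eRank_uniform hab, eRank_uniform hcd, ← hk]
    rfl
  have hE : (truncationTo 4 ((uniform a b).sum (uniform c d))).E = Set.univ := by
    rw [truncationTo_ground hrank, sum_ground, uniform_ground, uniform_ground, Set.image_univ,
      Set.image_univ, Set.range_inl_union_range_inr]
  let σ : Fin 7 ≃ Fin b ⊕ Fin d := (finCongr h7.symm).trans finSumFinEquiv.symm
  refine ⟨σ, ⟨σ.injective, by simp [hE], fun B => ?_⟩, by rw [hE, σ.surjective.range_eq]⟩
  have himg : σ '' B = finSumFinEquiv.symm '' (B.map (finCongr h7.symm).toEmbedding : Finset _) := by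
    rw [Finset.coe_map, Set.image_image]
    rfl
  rw [truncationTo_indep_iff hrank, himg, finSumFinEquiv.symm.injective.encard_image,
    Set.encard_coe_eq_coe_finsetCard, sum_uniform_indep_iff]
  have := hD (B.map (finCongr h7.symm).toEmbedding)
  rw [Finset.map_map, show (finCongr h7.symm).toEmbedding.trans (finCongr h7).toEmbedding =
    Function.Embedding.refl _ from rfl, Finset.map_refl, Finset.card_map] at this
  rw [← this, Finset.card_map]
  norm_cast

theorem isSevenPattern_uniform : (uniform 4 7).IsSevenPattern 4 ∅ id := by
  refine ⟨Function.injective_id, fun _ _ => Set.mem_univ _, fun B => ?_⟩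
  rw [Set.image_id, uniform_indep_iff, Set.ncard_coe_finset]
  simp

/-- The summand `U_{3,4}` becomes a circuit-hyperplane. -/
theorem exists_isSevenPattern_hyperplane :
    ∃ y, (truncationTo 4 ((uniform 3 4).sum (uniform 3 3))).IsSevenPattern 4 {{0, 1, 2, 3}} y ∧
      Set.range y = (truncationTo 4 ((uniform 3 4).sum (uniform 3 3))).E := by
  refine isSevenPattern_truncationTo_sum (k := 2) (by decide) (by decide) (by decide) rfl ?_
  simp only [Set.mem_singleton_iff, forall_eq]
  decide +kernel

/-- The summand `U_{1,2}` becomes a parallel pair. -/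
theorem exists_isSevenPattern_pair :
    ∃ y, (truncationTo 4 ((uniform 1 2).sum (uniform 4 5))).IsSevenPattern 4 {{0, 1}} y ∧
      Set.range y = (truncationTo 4 ((uniform 1 2).sum (uniform 4 5))).E := by
  refine isSevenPattern_truncationTo_sum (k := 1) (by decide) (by decide) (by decide) rfl ?_
  simp only [Set.mem_singleton_iff, forall_eq]
  decide +kernel

/-- Seven elements and the pattern that they form determine the matroid. -/
theorem isIsomorphic_iff_exists_isSevenPattern {M : Matroid α} {N : Matroid β} {k : ℕ}
    {𝒟 : Set (Finset (Fin 7))} {y : Fin 7 → β} (hy : N.IsSevenPattern k 𝒟 y)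
    (hyE : Set.range y = N.E) :
    M.IsIsomorphic N ↔ ∃ x, M.IsSevenPattern k 𝒟 x ∧ Set.range x = M.E := by
  have hymem : ∀ i, y i ∈ N.E := fun i => hyE ▸ ⟨i, rfl⟩
  constructor
  · rintro ⟨e, he⟩
    have hex : ∀ i, (e (e.symm ⟨y i, hymem i⟩)).1 = y i := fun i => by simp
    refine ⟨fun i => (e.symm ⟨y i, hymem i⟩).1, ⟨fun i j hij => ?_, ?_, fun B => ?_⟩, ?_⟩
    · have := e.symm.injective (Subtype.ext hij)
      exact hy.1 (congrArg Subtype.val this)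
    · rintro _ ⟨i, rfl⟩
      exact Subtype.coe_prop _
    · have := he ((fun i => e.symm ⟨y i, hymem i⟩) '' B)
      simp only [Set.image_image, Equiv.apply_symm_apply] at this
      rw [this]
      exact hy.2.2 B
    · refine Set.Subset.antisymm (by rintro _ ⟨i, rfl⟩; exact Subtype.coe_prop _) fun a ha => ?_
      obtain ⟨i, hi⟩ : (e ⟨a, ha⟩).1 ∈ Set.range y := by
        rw [hyE]
        exact Subtype.coe_prop _
      exact ⟨i, by simp [hi]⟩
  · rintro ⟨x, hx, hxE⟩
    let ex : Fin 7 ≃ M.E := (Equiv.ofInjective x hx.1).trans (Equiv.setCongr hxE)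
    let ey : Fin 7 ≃ N.E := (Equiv.ofInjective y hy.1).trans (Equiv.setCongr hyE)
    refine ⟨ex.symm.trans ey, fun I => ?_⟩
    classical
    have hI : I = ex '' ((ex ⁻¹' I).toFinset : Finset (Fin 7)) := by simp
    generalize (ex ⁻¹' I).toFinset = B at hI
    subst hI
    have h1 : Subtype.val '' (ex '' B) = x '' B := by
      rw [Set.image_image]
      rfl
    have h2 : Subtype.val '' ((ex.symm.trans ey) '' (ex '' B)) = y '' B := by
      simp only [Set.image_image, Equiv.trans_apply, Equiv.symm_apply_apply]
      rfl
    rw [h1, h2, hx.2.2, hy.2.2]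

/-! ### Excluded minors of rank four -/

theorem IsSevenPattern.restrict {M : Matroid α} {k : ℕ} {𝒟 : Set (Finset (Fin 7))}
    {x : Fin 7 → α} (hx : M.IsSevenPattern k 𝒟 x) :
    (M ↾ Set.range x).IsSevenPattern k 𝒟 x := by
  refine ⟨hx.1, subset_rfl, fun B => ?_⟩
  rw [restrict_indep_iff, and_iff_left (Set.image_subset_range _ _), hx.2.2]

/-- The alternatives for a lattice path matroid of rank four that is not bicircular: a small restriction,
or a proper minor that is not bicircular. -/
theorem IsLatticePath.exists_isSevenPattern_or_isStrictMinor {M : Matroid α} (hM : M.IsLatticePath)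
    (hr : M.eRank = 4) (hb : ¬ M.IsBicircular) :
    (∃ x, M.IsSevenPattern 4 ∅ x) ∨ (∃ x, M.IsSevenPattern 4 {{0, 1, 2, 3}} x) ∨
      (∃ x, M.IsSevenPattern 4 {{0, 1}} x) ∨ ∃ N, N <m M ∧ ¬ N.IsBicircular := by
  obtain ⟨n, r, p, l, u, hMr, h⟩ := hM.exists_intervalPresentation hr.le
  obtain rfl : r = 4 := by
    rw [hr] at hMr
    exact_mod_cast hMr.symm
  have hrev : ∀ a : Fin 4 → ℤ, reverseEnds a 0 = -a 3 ∧ reverseEnds a 1 = -a 2 ∧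
      reverseEnds a 2 = -a 1 ∧ reverseEnds a 3 = -a 0 := fun a => ⟨rfl, rfl, rfl, rfl⟩
  obtain ⟨hl0, hl1, hl2, hl3⟩ := hrev l
  obtain ⟨hu0, hu1, hu2, hu3⟩ := hrev u
  have hcontract : (∃ e ∈ M.E, ¬ (M ／ {e}).IsBicircular) → ∃ N, N <m M ∧ ¬ N.IsBicircular := by
    rintro ⟨e, he, hcon⟩
    exact ⟨_, isStrictMinor_iff_isMinor_ssubset.2
      ⟨⟨{e}, ∅, by simp⟩, Set.sdiff_singleton_ssubset.2 he⟩, hcon⟩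
  rcases hasBicircularPresentation_or_obstruction h.strictMono_left h.strictMono_right with
    h' | h' | h' | h' | h' | h'
  · exact absurd (h.isBicircular h') hb
  · exact Or.inl (h.exists_isSevenPattern_empty h')
  · exact Or.inr ((h.exists_isSevenPattern_of_hasLeftObstruction h').imp_right Or.inl)
  · refine Or.inr ((h.reverse.exists_isSevenPattern_of_hasLeftObstruction ?_).imp_right Or.inl)
    simp only [HasLeftObstruction, hl0, hl1, hu0, hu1, hu2, hu3] at h' ⊢
    simp only [show Fin.rev (0 : Fin 4) = 3 from rfl, show Fin.rev (1 : Fin 4) = 2 from rfl,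
      show Fin.rev (2 : Fin 4) = 1 from rfl, show Fin.rev (3 : Fin 4) = 0 from rfl]
    omega
  · exact Or.inr (Or.inr (Or.inr (hcontract (h.exists_contract_not_isBicircular h'))))
  · refine Or.inr (Or.inr (Or.inr (hcontract (h.reverse.exists_contract_not_isBicircular ?_))))
    simp only [HasContractedObstruction, hl0, hl1, hl2, hl3, hu0, hu1, hu2, hu3] at h' ⊢
    simp only [show Fin.rev (0 : Fin 4) = 3 from rfl, show Fin.rev (1 : Fin 4) = 2 from rfl,
      show Fin.rev (2 : Fin 4) = 1 from rfl, show Fin.rev (3 : Fin 4) = 0 from rfl]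
    omega

/-- In an excluded minor there are no elements besides those of a restriction that is not bicircular. -/
theorem IsExcludedMinor.range_eq_ground {M : Matroid α} {𝒟 : Set (Finset (Fin 7))} {x : Fin 7 → α}
    (hM : M.IsExcludedMinor fun N => N.IsBicircular ∧ N.IsLatticePath)
    (hx : M.IsSevenPattern 4 𝒟 x) (hb : ¬ (M ↾ Set.range x).IsBicircular) :
    Set.range x = M.E := by
  by_contra hne
  exact hb (hM.2 _ (isStrictMinor_iff_isMinor_ssubset.2
    ⟨⟨∅, M.E \ Set.range x, by rw [contract_empty, delete_compl hx.2.1]⟩, hx.2.1.ssubset_of_ne hne⟩)).1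

/-- The proper minors have at most six elements. -/
theorem IsSevenPattern.isExcludedMinor {M : Matroid α} {𝒟 : Set (Finset (Fin 7))} {x : Fin 7 → α}
    (hM : M.IsLatticePath) (hr : M.eRank = 4) (hx : M.IsSevenPattern 4 𝒟 x)
    (hxE : Set.range x = M.E) (hb : ¬ M.IsBicircular) :
    M.IsExcludedMinor fun N => N.IsBicircular ∧ N.IsLatticePath := by
  refine ⟨fun h => hb h.1, fun N hN => ?_⟩
  have hNl := hM.of_isMinor hN.isMinor
  refine ⟨hNl.isBicircular_of_ncard_le_six ?_ ?_, hNl⟩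
  · obtain ⟨B, hB⟩ := N.exists_isBase
    rw [← hB.encard_eq_eRank, ← hr]
    exact (hB.indep.of_isMinor hN.isMinor).encard_le_eRank
  · have h1 := Set.ncard_lt_ncard hN.ssubset hM.finite_ground
    rw [← hxE, ← Set.image_univ, Set.ncard_image_of_injective _ hx.1, Set.ncard_univ,
      Nat.card_eq_fintype_card, Fintype.card_fin] at h1
    omega

end Matroid

theorem mainTheorem5 {α : Type*} (M : Matroid α) (hM : M.IsLatticePath) (hr : M.eRank = 4) :
    M.IsExcludedMinor (fun N => N.IsBicircular ∧ N.IsLatticePath) ↔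
      M.IsIsomorphic (Matroid.uniform 4 7) ∨
      M.IsIsomorphic (Matroid.truncationTo 4 ((Matroid.uniform 3 4).sum (Matroid.uniform 3 3))) ∨
      M.IsIsomorphic (Matroid.truncationTo 4 ((Matroid.uniform 1 2).sum (Matroid.uniform 4 5))) := by
  obtain ⟨y, hy, hyE⟩ := Matroid.exists_isSevenPattern_hyperplane
  obtain ⟨z, hz, hzE⟩ := Matroid.exists_isSevenPattern_pair
  rw [Matroid.isIsomorphic_iff_exists_isSevenPattern Matroid.isSevenPattern_uniform Set.range_id,
    Matroid.isIsomorphic_iff_exists_isSevenPattern hy hyE,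
    Matroid.isIsomorphic_iff_exists_isSevenPattern hz hzE]
  constructor
  · intro hex
    have hb : ¬ M.IsBicircular := fun h => hex.1 ⟨h, hM⟩
    rcases hM.exists_isSevenPattern_or_isStrictMinor hr hb with
      ⟨x, hx⟩ | ⟨x, hx⟩ | ⟨x, hx⟩ | ⟨N, hN, hcon⟩
    · exact Or.inl ⟨x, hx, hex.range_eq_ground hx
        (hx.restrict.not_isBicircular_of_empty (Or.inr rfl))⟩
    · exact Or.inr (Or.inl ⟨x, hx, hex.range_eq_ground hx
        hx.restrict.not_isBicircular_of_hyperplane⟩)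
    · exact Or.inr (Or.inr ⟨x, hx, hex.range_eq_ground hx
        (Matroid.IsSevenPattern.not_isBicircular_of_pair (by decide) hx.restrict (Or.inr rfl))⟩)
    · exact absurd (hex.2 N hN).1 hcon
  · rintro (⟨x, hx, hxE⟩ | ⟨x, hx, hxE⟩ | ⟨x, hx, hxE⟩)
    · exact hx.isExcludedMinor hM hr hxE (hx.not_isBicircular_of_empty (Or.inr rfl))
    · exact hx.isExcludedMinor hM hr hxE hx.not_isBicircular_of_hyperplane
    · exact hx.isExcludedMinor hM hr hxE
        (Matroid.IsSevenPattern.not_isBicircular_of_pair (by decide) hx (Or.inr rfl))
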